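/- **Setting.** Let $d,n\ge 1$, let $A_1,\dots,A_d\in\mathbb R^{n\times n}$ be symmetric, $E\in\mathbb R^{n\times n}$ skew-symmetric, and let $T:\mathbb R^n\times\mathbb R^n\times\mathbb R^n\to\mathbb R^n$ be trilinear, extended trilinearly to $\mathbb C^n$. Put $A(\beta)=\sum_\ell\beta_\ell A_\ell$, $A(\partial)=\sum_\ell A_\ell\partial_\ell$ and $\mathcal L(\alpha,\beta)=-\alpha I+A(\beta)-\mathrm iE$. Let $\kappa\in\mathbb R^d\setminus\{0\}$ and $\omega\in\mathbb R$ be such that $\ker\mathcal L(\omega,\kappa)$ is one-dimensional and $\mathcal L(j\omega,j\kappa)$ is invertible for $j=3,5$. Assume that $\mathcal L(0,\beta)$ has a smooth eigendecomposition: real eigenvalues $\lambda_\ell(\beta)$ and an orthonormal basis of eigenvectors $\psi_\ell(\beta)$, $\ell=1,\dots,n$, $\beta\in\mathbb R^d$, which are $C^\infty$ on $\mathbb R^d\setminus\{0\}$, with every $\lambda_\ell$ globally Lipschitz continuous on $\mathbb R^d$. For $j\in\{1,3\}$ let $\mathcal L(j\omega,j\kappa+\theta)=\Psi_j(\theta)\Lambda_j(\theta)\Psi_j(\theta)^*$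 be the corresponding eigendecomposition, with columns $\psi_{j\ell}(\theta)$ of $\Psi_j(\theta)$ and eigenvalues $\lambda_{j\ell}(\theta)$, enumerated such that $\lambda_{11}(0)=0$. Let $\widehat f(k)=(2\pi)^{-d/2}\int_{\mathbb R^d} f(x)e^{-\mathrm ik\cdot x}\,dx$ be the Fourier transform, let $W$ be the Wiener algebra of all $f$ with $\widehat f\in L^1(\mathbb R^d)$, $\|f\|_W=\|\widehat f\|_{L^1}$, and let $W^s$ be the space of all $f$ with $\partial^\alpha f\in W$ for $|\alpha|\le s$, $\|f\|_{W^s}=\sum_{|\alpha|\le s}\|\partial^\alpha f\|_W$. Fix $t_{\rm end}>0$. For $\varepsilon\in(0,1]$ and $p:\mathbb R^d\to\mathbb C^n$ consider the system $$\partial_tu_j+\tfrac{\mathrm i}{\varepsilon}\mathcal L(j\omega,j\kappa)u_j+A(\partial)u_j=\varepsilon\sum_{j_1+j_2+j_3=j}T(u_{j_1},u_{j_2},u_{j_3}),\qquad j\in\{1,3\},$$ with $j_1,j_2,j_3\in\{\pm1,\pm3\}$, $u_{-j}=\overline{u_j}$, $u_1(0)=p$, $u_3(0)=0$. A classical solution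 on $[0,t_{\rm end}/\varepsilon]$ has $u_j\in C^1([0,t_{\rm end}/\varepsilon],W)\cap C([0,t_{\rm end}/\varepsilon],W^1)$. Given such a solution, let $$z_j(t,k)=\exp\!\big(\tfrac{\mathrm it}{\varepsilon}\Lambda_j(\varepsilon k)\big)\Psi_j(\varepsilon k)^*\,\widehat u_j(t,k),\qquad j\in\{1,3\}.$$ Let $P(w_1,\dots,w_n)=(w_1,0,\dots,0)$, $P^\perp=I-P$, $\mathcal P_\varepsilon(k)=\psi_{11}(\varepsilon k)\psi_{11}(\varepsilon k)^*$, $\mathcal P_\varepsilon^\perp=I-\mathcal P_\varepsilon$, $(D_\mu w)(k)=\mathrm ik_\mu w(k)$, and for $y=(y_1,y_3)$ $$|||y|||_\varepsilon=2\|Py_1\|_{L^1}+\tfrac2\varepsilon\|P^\perp y_1\|_{L^1}+\tfrac2\varepsilon\|y_3\|_{L^1}.$$ **Proposition 2.** Let $M\ge0$. All initial functions $p$ below are polarized, i.e. $p(x)\in\ker\mathcal L(\omega,\kappa)$ for all $x$. (a) For every sufficiently large $r>0$ (depending on $M$ and the data fixed above) there is $t_\star\in(0,t_{\rm end}]$ such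 that for all $p\in W^1$ with $\|p\|_{W^1}\le M$, all $\varepsilon\in(0,1]$ and all classical solutions $u$ on $[0,t_{\rm end}/\varepsilon]$, $$\sup_{t\in[0,t_\star/\varepsilon]}|||z(t)|||_\varepsilon\le r.\qquad(*)$$ (b) For every $r$ there is a constant $C$, depending only on $r$, $M$ and the data fixed above (including $t_{\rm end}$) but not on $\varepsilon$, such that the following holds for all $t_\star\in(0,t_{\rm end}]$, all $p\in W^2$ with $\|p\|_{W^2}\le M$, all $\varepsilon\in(0,1]$ and all classical solutions $u$ on $[0,t_{\rm end}/\varepsilon]$: if $(*)$ holds for this $\varepsilon$ and $u$, then for every $\mu\in\{1,\dots,d\}$ $$\sup_{t\in[0,t_\star/\varepsilon]}|||D_\mu z(t)|||_\varepsilon\le C,\qquad \sup_{t\in[0,t_\star/\varepsilon]}\|D_\mu\mathcal P_\varepsilon^\perp\widehat u_1(t)\|_{L^1}\le C\varepsilon,\qquad \sup_{t\in[0,t_\star/\varepsilon]}\|\partial_\mu u_3(t)\|_W\le C\varepsilon.$$ -/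

import Mathlib

open MeasureTheory Set
open scoped ENNReal

noncomputable section

namespace Envelope

/-- The physical space (and the frequency space) `ℝ^d`. -/
abbrev Space (d : ℕ) : Type := EuclideanSpace ℝ (Fin d)

/-- The state space `ℂ^n` with the Euclidean norm. -/
abbrev Vec (n : ℕ) : Type := EuclideanSpace ℂ (Fin n)

/-! ### Fourier transform and Wiener spaces -/

/-- The inverse Fourier transform `(2π)^{-d/2} ∫ g(k) e^{i k·x} dk` of an integrable function. -/
def invFourier {d n : ℕ} (g : Space d → Vec n) (x : Space d) : Vec n :=
  ((2 * Real.pi) ^ (-(d : ℝ) / 2) : ℝ) •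
    ∫ k : Space d, Complex.exp (Complex.I * ((inner ℝ k x : ℝ) : ℂ)) • g k

/-- `g` is an integrable Fourier transform of `f`. -/
def IsFourier {d n : ℕ} (f g : Space d → Vec n) : Prop :=
  Integrable g ∧ ∀ x, f x = invFourier g x

/-- Membership in the Wiener algebra `W`. A tempered distribution whose Fourier transform is
integrable is a continuous function, and is represented by that function. -/
def MemW {d n : ℕ} (f : Space d → Vec n) : Prop := ∃ g, IsFourier f g

open Classical in
/-- The Fourier transform of `f ∈ W` (unique up to null sets), and `0` if `f ∉ W`. -/
def hat {d n : ℕ} (f : Space d → Vec n) : Space d → Vec n :=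
  if h : MemW f then h.choose else 0

theorem integrable_hat {d n : ℕ} (f : Space d → Vec n) : Integrable (hat f) := by
  unfold hat
  split_ifs with h
  · exact h.choose_spec.1
  · exact integrable_zero _ _ _

/-- The Fourier transform of `f ∈ W` as an element of `L¹(ℝ^d, ℂ^n)`;
the map `hatL1` is an isometric isomorphism from `W` to `L¹`. -/
def hatL1 {d n : ℕ} (f : Space d → Vec n) : Lp (Vec n) 1 (volume : Measure (Space d)) :=
  (integrable_hat f).toL1 (hat f)

/-- The norm of `L¹(ℝ^d, ℂ^n)`, with values in `[0, ∞]`. -/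
def normL1 {d n : ℕ} (g : Space d → Vec n) : ℝ≥0∞ := ∫⁻ k, ‖g k‖ₑ

open Classical in
/-- The norm of `W`, equal to `∞` outside `W`. -/
def normW {d n : ℕ} (f : Space d → Vec n) : ℝ≥0∞ :=
  if MemW f then normL1 (hat f) else ∞

/-- The partial derivative `∂_ℓ f`. -/
def pderiv {d n : ℕ} (l : Fin d) (f : Space d → Vec n) (x : Space d) : Vec n :=
  fderiv ℝ f x (EuclideanSpace.single l 1)

/-- The derivative `∂^α f` for a multi-index `α`. -/
def mderiv {d n : ℕ} (α : Fin d → ℕ) (f : Space d → Vec n) : Space d → Vec n :=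
  (List.finRange d).foldr (fun l g => (pderiv l)^[α l] g) f

/-- Membership in `W^s`: all derivatives of order at most `s` belong to `W`. (If the distributional
derivatives up to order `s` belong to `W`, then `f` is of class `C^s`.) -/
def MemWs {d n : ℕ} (s : ℕ) (f : Space d → Vec n) : Prop :=
  ContDiff ℝ s f ∧ ∀ α : Fin d → ℕ, ∑ l, α l ≤ s → MemW (mderiv α f)

/-- The norm of `W^s`, the sum of `‖∂^α f‖_W` over all multi-indices with `|α| ≤ s`. -/
def normWs {d n : ℕ} (s : ℕ) (f : Space d → Vec n) : ℝ≥0∞ :=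
  ∑ m ∈ Finset.range (s + 1), ∑ α ∈ Finset.piAntidiag (Finset.univ : Finset (Fin d)) m,
    normW (mderiv α f)

/-! ### The system for the envelopes -/

/-- The matrix `L(α, β) = -α I + ∑_ℓ β_ℓ A_ℓ - i E`. -/
def symbolL {d n : ℕ} (A : Fin d → Matrix (Fin n) (Fin n) ℝ) (Em : Matrix (Fin n) (Fin n) ℝ)
    (α : ℝ) (β : Space d) : Matrix (Fin n) (Fin n) ℂ :=
  -(α : ℂ) • (1 : Matrix (Fin n) (Fin n) ℂ) + ∑ l, (β l : ℂ) • (A l).map Complex.ofReal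
    - Complex.I • Em.map Complex.ofReal

/-- The complex trilinear extension of the real trilinear map `T` to `ℂ^n`. -/
def triExt {n : ℕ}
    (T : (Fin n → ℝ) →ₗ[ℝ] (Fin n → ℝ) →ₗ[ℝ] (Fin n → ℝ) →ₗ[ℝ] (Fin n → ℝ))
    (a b c : Vec n) : Vec n :=
  ∑ p, ∑ q, ∑ r, (a p * b q * c r) •
    WithLp.toLp 2 (fun i =>
      ((T (Pi.single p 1) (Pi.single q 1) (Pi.single r 1) i : ℝ) : ℂ))

/-- The set of harmonics `{±1, ±3}`. -/
def harmonics : Finset ℤ := {1, -1, 3, -3}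

/-- All `(j₁, j₂, j₃) ∈ {±1, ±3}³` with `j₁ + j₂ + j₃ = j`. -/
def triples (j : ℤ) : Finset (ℤ × ℤ × ℤ) :=
  (harmonics ×ˢ harmonics ×ˢ harmonics).filter fun J => J.1 + J.2.1 + J.2.2 = j

/-- Componentwise complex conjugation. -/
def conjVec {n : ℕ} (v : Vec n) : Vec n := WithLp.toLp 2 fun i => starRingEnd ℂ (v i)

/-- `u = (u_j)`, `j ∈ {±1, ±3}`, with `u_{-j} = conj u_j`, is a classical solution of
`∂_t u_j + (i/ε) L(jω, jκ) u_j + A(∂) u_j = ε ∑_{j₁+j₂+j₃=j} T(u_{j₁}, u_{j₂}, u_{j₃})`, `j ∈ {1, 3}`,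
on the time interval `[0, τ]` with initial data `u_1(0) = p`, `u_3(0) = 0`; the argument `u j t x`
is the value of `u_j(t, x)`. -/
structure IsClassicalSolution {d n : ℕ}
    (A : Fin d → Matrix (Fin n) (Fin n) ℝ) (Em : Matrix (Fin n) (Fin n) ℝ)
    (T : (Fin n → ℝ) →ₗ[ℝ] (Fin n → ℝ) →ₗ[ℝ] (Fin n → ℝ) →ₗ[ℝ] (Fin n → ℝ))
    (ω : ℝ) (κ : Space d) (ε τ : ℝ) (p : Space d → Vec n)
    (u : ℤ → ℝ → Space d → Vec n) : Prop where
  /-- `u_{-j}` is the complex conjugate of `u_j`. -/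
  conj : ∀ j ∈ ({1, 3} : Finset ℤ), ∀ t ∈ Icc 0 τ, ∀ x, u (-j) t x = conjVec (u j t x)
  /-- `u_j(t) ∈ W¹` (in particular `u_j(t) ∈ W`). -/
  memW1 : ∀ j ∈ ({1, 3} : Finset ℤ), ∀ t ∈ Icc 0 τ, MemWs 1 (u j t)
  /-- `u_j ∈ C¹([0, τ], W)`. -/
  contDiff_W : ∀ j ∈ ({1, 3} : Finset ℤ), ContDiffOn ℝ 1 (fun t => hatL1 (u j t)) (Icc 0 τ)
  /-- `u_j ∈ C([0, τ], W¹)`. -/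
  continuous_W1 : ∀ j ∈ ({1, 3} : Finset ℤ), ∀ α : Fin d → ℕ, ∑ l, α l ≤ 1 →
    ContinuousOn (fun t => hatL1 (mderiv α (u j t))) (Icc 0 τ)
  /-- The partial differential equation. -/
  pde : ∀ j ∈ ({1, 3} : Finset ℤ), ∀ t ∈ Ioc 0 τ, ∀ x,
    HasDerivWithinAt (fun s => u j s x)
      (-((Complex.I / (ε : ℂ)) •
            Matrix.toEuclideanLin (symbolL A Em ((j : ℝ) * ω) ((j : ℝ) • κ)) (u j t x))
        - ∑ l, Matrix.toEuclideanLin ((A l).map Complex.ofReal) (pderiv l (u j t) x)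
        + (ε : ℂ) • ∑ J ∈ triples j, triExt T (u J.1 t x) (u J.2.1 t x) (u J.2.2 t x))
      (Icc 0 τ) t
  /-- The initial data for `u_1`. -/
  initial_one : ∀ x, u 1 0 x = p x
  /-- The initial data for `u_3`. -/
  initial_three : ∀ x, u 3 0 x = 0

/-! ### Smooth eigendecomposition and transformed variables -/

/-- An eigendecomposition of the Hermitian matrices `L(0, β) = A(β) - i E`: real eigenvalues
`λ_ℓ(β)` and an orthonormal basis of eigenvectors `ψ_ℓ(β)` which are smooth on `ℝ^d ∖ {0}`, with
globally Lipschitz continuous eigenvalues. -/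
structure SmoothEigen {d n : ℕ}
    (A : Fin d → Matrix (Fin n) (Fin n) ℝ) (Em : Matrix (Fin n) (Fin n) ℝ) where
  /-- The eigenvalues. -/
  lam : Fin n → Space d → ℝ
  /-- The eigenvectors. -/
  psi : Fin n → Space d → Vec n
  eigen : ∀ l β, Matrix.toEuclideanLin (symbolL A Em 0 β) (psi l β) = (lam l β : ℂ) • psi l β
  orthonormal : ∀ β, Orthonormal ℂ fun l => psi l β
  lam_smooth : ∀ l, ContDiffOn ℝ ((⊤ : ℕ∞) : WithTop ℕ∞) (lam l) {0}ᶜ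
  psi_smooth : ∀ l, ContDiffOn ℝ ((⊤ : ℕ∞) : WithTop ℕ∞) (psi l) {0}ᶜ
  lam_lipschitz : ∀ l, ∃ C : ℝ, ∀ β' β, |lam l β' - lam l β| ≤ C * ∑ i, |β' i - β i|

section Transform

variable {d n : ℕ} {A : Fin d → Matrix (Fin n) (Fin n) ℝ} {Em : Matrix (Fin n) (Fin n) ℝ}

/-- The eigenvalue `λ_{jℓ}(θ)` of `L_j(θ) = L(jω, jκ + θ)`. -/
def lamJ (S : ℤ → SmoothEigen A Em) (ω : ℝ) (κ : Space d) (j : ℤ) (l : Fin n) (θ : Space d) : ℝ :=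
  (S j).lam l ((j : ℝ) • κ + θ) - (j : ℝ) * ω

/-- The eigenvector `ψ_{jℓ}(θ)` of `L_j(θ) = L(jω, jκ + θ)`. -/
def psiJ (S : ℤ → SmoothEigen A Em) (κ : Space d) (j : ℤ) (l : Fin n) (θ : Space d) : Vec n :=
  (S j).psi l ((j : ℝ) • κ + θ)

/-- The unitary matrix `Ψ_j(θ)` with columns `ψ_{jℓ}(θ)`. -/
def PsiJ (S : ℤ → SmoothEigen A Em) (κ : Space d) (j : ℤ) (θ : Space d) :
    Matrix (Fin n) (Fin n) ℂ :=
  Matrix.of fun i l => psiJ S κ j l θ i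

/-- The matrix `S_{j,ε}(t, k) = exp((i t / ε) Λ_j(ε k)) Ψ_j(ε k)^*`. -/
def SMat (S : ℤ → SmoothEigen A Em) (ω : ℝ) (κ : Space d) (ε : ℝ) (j : ℤ) (t : ℝ) (k : Space d) :
    Matrix (Fin n) (Fin n) ℂ :=
  Matrix.diagonal
      (fun l => Complex.exp (Complex.I * (t : ℂ) / (ε : ℂ) * (lamJ S ω κ j l (ε • k) : ℂ)))
    * (PsiJ S κ j (ε • k)).conjTranspose

/-- The transformed variable `z_j(t, k) = S_{j,ε}(t, k) û_j(t, k)`. -/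
def zVar (S : ℤ → SmoothEigen A Em) (ω : ℝ) (κ : Space d) (ε : ℝ) (u : ℤ → ℝ → Space d → Vec n)
    (j : ℤ) (t : ℝ) (k : Space d) : Vec n :=
  Matrix.toEuclideanLin (SMat S ω κ ε j t k) (hat (u j t) k)

/-- The projection `𝒫_ε(k) w = ψ_{11}(ε k) ψ_{11}(ε k)^* w`. -/
def projEps [NeZero n] (S : ℤ → SmoothEigen A Em) (κ : Space d) (ε : ℝ) (k : Space d) (w : Vec n) :
    Vec n :=
  inner ℂ (psiJ S κ 1 0 (ε • k)) w • psiJ S κ 1 0 (ε • k)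

end Transform

/-- The projection `P (w_1, …, w_n) = (w_1, 0, …, 0)`. -/
def projP {n : ℕ} [NeZero n] (w : Vec n) : Vec n := EuclideanSpace.single 0 (w 0)

/-- The Fourier multiplier `(D_μ w)(k) = i k_μ w(k)`. -/
def mulD {d n : ℕ} (μ : Fin d) (w : Space d → Vec n) (k : Space d) : Vec n :=
  (Complex.I * (k μ : ℂ)) • w k

/-- The scaled norm
`2 ‖P y_1‖_{L¹} + (2/ε) ‖(I - P) y_1‖_{L¹} + (2/ε) ‖y_3‖_{L¹}`, with values in `[0, ∞]`. -/
def scaledNorm {d n : ℕ} [NeZero n] (ε : ℝ) (y₁ y₃ : Space d → Vec n) : ℝ≥0∞ :=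
  2 * normL1 (fun k => projP (y₁ k))
    + ENNReal.ofReal (2 / ε) * normL1 (fun k => y₁ k - projP (y₁ k))
    + ENNReal.ofReal (2 / ε) * normL1 y₃

end Envelope

end

/-! On the Fourier side the system is an ordinary differential equation in L¹: û_j is moved by
-(i/ε) L(jω, jκ + εk), a skew-Hermitian matrix for every k, and forced by ε times a trilinear
convolution F_j. The skew part does not change |û_j(k)|, so every weighted L¹ norm grows at most at
the rate of the forcing (`rightSlopeLE_wreal`). With the trivial weight this bounds the solution on
a time interval of length of order 1/ε (`exists_time_wnorm_le`). For weights with w(x+y) ≤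
K(w(x)+w(y)) the forcing is linear in the weighted norm as long as the L¹ norm is bounded, and
Gronwall's inequality propagates moments (`Evolution.wnorm_growth`).

It remains to see that the noncritical components c = ⟨ψ_{jl}(εk), û_j⟩ stay O(ε). They obey c' =
-(i/ε) λ_{jl}(εk) c + ε⟨ψ_{jl}, F_j⟩, and λ_{jl}(0) ≠ 0 (`lamJ_ne_zero`). Integrating the size of
the forcing over a time 1/ε would give only O(1); the fast rotation has to be used. The normal form
y = c + i(ε²/λ_{jl}(0))⟨ψ_{jl}, F_j⟩ rotates like c and leaves two remainders. The first is the
detuning ε(1 - λ_{jl}(εk)/λ_{jl}(0))⟨ψ_{jl}, F_j⟩, which is O(ε²|k|) by the Lipschitz bound and so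
costs one moment. The second is ε² times the time derivative of F_j. That derivative contains û',
which is of size 1/ε on the noncritical components only, since the critical eigenvalue vanishes at
0. Hence the sum q of the noncritical norms satisfies, up to corrections of size ε², q' ≤ εKq + ε²L,
and on times of order 1/ε it remains O(ε) if it is so initially (`rightSlopeLE_normalForm`,
`exists_component_bound`). Initially it is so because polarization gives L(ω, κ + εk) p̂ = εA(k) p̂
(`exists_polarized_component_bound`).

The trivial weight together with one moment yields (a). The weight |k| together with two moments
yields (b), where the assumed bound on z serves to control the L¹ norm of û. Norms with bounded
weights are differentiated in the sense of Dini; unbounded weights are reached by truncation. -/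

noncomputable section

namespace Envelope

open Filter
open scoped NNReal Topology Convolution

set_option maxSynthPendingDepth 3

/-! ### Injectivity of the Fourier transform on L¹ -/

section

-- Every test function is the transform of a Schwartz function, and the symmetry of the Fourier
-- transform under the integral moves the transform onto g, where it vanishes.
open scoped FourierTransform in
theorem ae_eq_zero_of_fourier_eq_zero {V E : Type*} [NormedAddCommGroup V] [InnerProductSpace ℝ V]
    [FiniteDimensional ℝ V] [MeasurableSpace V] [BorelSpace V] [NormedAddCommGroup E]
    [NormedSpace ℂ E] [CompleteSpace E] {g : V → E} (hg : Integrable g) (h : ∀ x, 𝓕 g x = 0) :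
    g =ᵐ[volume] 0 := by
  apply ae_eq_zero_of_integral_contDiff_smul_eq_zero hg.locallyIntegrable
  intro φ φs φc
  have h₁ : HasCompactSupport (Complex.ofRealCLM ∘ φ) := φc.comp_left rfl
  have h₂ : ContDiff ℝ ((⊤ : ℕ∞) : WithTop ℕ∞) (Complex.ofRealCLM ∘ φ) := by fun_prop
  set Φ : SchwartzMap V ℂ := h₁.toSchwartzMap h₂ with hΦ
  have e : ∀ x, 𝓕 (𝓕⁻ Φ : SchwartzMap V ℂ) x = (φ x : ℂ) := by
    intro x
    rw [FourierTransform.fourier_fourierInv_eq]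
    rfl
  have key := VectorFourier.integral_fourierIntegral_smul_eq_flip (L := innerₗ V)
      Real.continuous_fourierChar continuous_inner ((𝓕⁻ Φ : SchwartzMap V ℂ).integrable (μ := volume)) hg
  have h3 : ∀ ξ, VectorFourier.fourierIntegral Real.fourierChar volume (innerₗ V)
      (⇑(𝓕⁻ Φ : SchwartzMap V ℂ)) ξ = (φ ξ : ℂ) := by
    intro ξ
    rw [← e, SchwartzMap.fourier_coe]
    rfl
  have h4 : ∀ ξ, VectorFourier.fourierIntegral Real.fourierChar volume (innerₗ V).flip g ξ = 0 := by
    intro ξ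
    rw [flip_innerₗ]
    exact h ξ
  simp only [h3, h4, smul_zero, integral_zero] at key
  rw [← key]
  congr 1

variable {d n : ℕ}

/-- The normalizing constant `(2π)^{-d/2}` of the Fourier transform. -/
def fourierConst (d : ℕ) : ℝ := (2 * Real.pi) ^ (-(d : ℝ) / 2)

theorem fourierConst_pos (d : ℕ) : 0 < fourierConst d := by
  unfold fourierConst; positivity

open scoped FourierTransform in
theorem invFourier_eq_fourier (g : Space d → Vec n) (x : Space d) :
    invFourier g x = fourierConst d • 𝓕 g (-(2 * Real.pi)⁻¹ • x) := by
  unfold invFourier fourierConst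
  congr 1
  rw [Real.fourier_eq]
  congr 1
  ext1 k
  rw [Circle.smul_def, Real.fourierChar_apply, inner_smul_right]
  congr 2
  push_cast
  have : (Real.pi : ℂ) ≠ 0 := by exact_mod_cast Real.pi_ne_zero
  field_simp

theorem integrable_cexp_smul {g : Space d → Vec n} (hg : Integrable g) (x : Space d) :
    Integrable fun k => Complex.exp (Complex.I * ((inner ℝ k x : ℝ) : ℂ)) • g k := by
  refine hg.mono (by
    have hc : Continuous fun k : Space d => Complex.exp (Complex.I * ((inner ℝ k x : ℝ) : ℂ)) := by
      fun_prop
    exact hc.aestronglyMeasurable.smul hg.1) (ae_of_all _ fun k => ?_)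
  rw [norm_smul, mul_comm Complex.I, Complex.norm_exp_ofReal_mul_I, one_mul]

theorem invFourier_add {f g : Space d → Vec n} (hf : Integrable f) (hg : Integrable g)
    (x : Space d) : invFourier (fun k => f k + g k) x = invFourier f x + invFourier g x := by
  simp only [invFourier, smul_add]
  rw [integral_add (integrable_cexp_smul hf x) (integrable_cexp_smul hg x), smul_add]

theorem invFourier_congr {f g : Space d → Vec n} (h : f =ᵐ[volume] g) (x : Space d) :
    invFourier f x = invFourier g x := by
  simp only [invFourier]
  congr 1
  apply integral_congr_ae
  filter_upwards [h] with k hk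
  rw [hk]

theorem invFourier_clm (B : Vec n →L[ℂ] Vec n) {f : Space d → Vec n} (hf : Integrable f)
    (x : Space d) : invFourier (fun k => B (f k)) x = B (invFourier f x) := by
  simp only [invFourier]
  rw [B.map_smul_of_tower]
  congr 1
  rw [← B.integral_comp_comm (integrable_cexp_smul hf x)]
  congr 1
  ext1 k
  rw [B.map_smul]

theorem norm_invFourier_le (f : Space d → Vec n) (x : Space d) :
    ‖invFourier f x‖ ≤ fourierConst d * ∫ k, ‖f k‖ := by
  change ‖fourierConst d • _‖ ≤ _
  rw [norm_smul, Real.norm_of_nonneg (fourierConst_pos d).le]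
  refine mul_le_mul_of_nonneg_left ?_ (fourierConst_pos d).le
  refine (norm_integral_le_integral_norm _).trans (le_of_eq ?_)
  congr 1
  ext1 k
  rw [norm_smul, mul_comm Complex.I, Complex.norm_exp_ofReal_mul_I, one_mul]

theorem ae_eq_of_invFourier_eq {f g : Space d → Vec n} (hf : Integrable f) (hg : Integrable g)
    (h : ∀ x, invFourier f x = invFourier g x) : f =ᵐ[volume] g := by
  have h0 : (fun k => f k + -(g k)) =ᵐ[volume] 0 := by
    refine ae_eq_zero_of_fourier_eq_zero (hf.add hg.neg) fun x => ?_
    have h1 := invFourier_eq_fourier (fun k => f k + -(g k)) (-(2 * Real.pi) • x)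
    have h2 : invFourier (fun k => -(g k)) (-(2 * Real.pi) • x) = -invFourier g (-(2 * Real.pi) • x) :=
      invFourier_clm (-ContinuousLinearMap.id ℂ (Vec n)) hg _
    rw [invFourier_add hf (show Integrable fun k => -(g k) from hg.neg), h2, h, add_neg_cancel, smul_smul] at h1
    have h3 : -(2 * Real.pi)⁻¹ * -(2 * Real.pi) = 1 := by
      have := Real.pi_ne_zero
      field_simp
    rw [h3, one_smul] at h1
    exact (smul_eq_zero.mp h1.symm).resolve_left (fourierConst_pos d).ne'
  filter_upwards [h0] with k hk
  have : f k + -(g k) = 0 := hk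
  rwa [← sub_eq_add_neg, sub_eq_zero] at this

theorem MemW.eq_invFourier {f : Space d → Vec n} (h : MemW f) (x : Space d) :
    f x = invFourier (hat f) x := by
  unfold hat
  rw [dif_pos h]
  exact h.choose_spec.2 x

/-- `hat` is defined by choice; uniqueness makes any integrable representative as good as the chosen
one. -/
theorem IsFourier.hat_ae_eq {f g : Space d → Vec n} (h : IsFourier f g) :
    hat f =ᵐ[volume] g := by
  refine ae_eq_of_invFourier_eq (integrable_hat f) h.1 fun x => ?_
  rw [← MemW.eq_invFourier ⟨g, h⟩, h.2]

theorem coeFn_hatL1 (f : Space d → Vec n) : hatL1 f =ᵐ[volume] hat f :=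
  Integrable.coeFn_toL1 _

end

/-! ### Fourier transforms of partial derivatives and of complex conjugates -/

section

variable {d n : ℕ}

theorem invFourier_shift (g : Space d → Vec n) (x y : Space d) :
    invFourier (fun k => Complex.exp (Complex.I * ((inner ℝ k y : ℝ) : ℂ)) • g k) x
      = invFourier g (x + y) := by
  simp only [invFourier]
  congr 2
  ext1 k
  rw [smul_smul, ← Complex.exp_add, inner_add_right]
  push_cast
  ring_nf

theorem ae_coord_notMem_countable (l : Fin d) {C : Set ℝ} (hC : C.Countable) :
    ∀ᵐ k : Space d, k l ∉ C := by
  have h1 : Measure.QuasiMeasurePreserving (Function.eval l : (Fin d → ℝ) → ℝ) volume volume :=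
    Measure.quasiMeasurePreserving_eval (fun _ => volume) l
  have h2 := h1.comp (PiLp.volume_preserving_ofLp (Fin d)).quasiMeasurePreserving
  have h3 : ∀ᵐ x : ℝ, x ∉ C := hC.ae_notMem volume
  exact h2.ae h3

/-- The exceptional set is a countable union of hyperplanes. This permits the division by e^{ik_l} -
1 in `hat_pderiv`. -/
theorem ae_cexp_coord_ne_one (l : Fin d) :
    ∀ᵐ k : Space d, Complex.exp (Complex.I * ((k l : ℝ) : ℂ)) ≠ 1 := by
  filter_upwards [ae_coord_notMem_countable l
    (countable_range fun m : ℤ => (m : ℝ) * (2 * Real.pi))] with k hk he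
  obtain ⟨m, hm⟩ := Complex.exp_eq_one_iff.mp he
  refine hk ⟨m, ?_⟩
  have h : ((k l : ℝ) : ℂ) = ((m * (2 * Real.pi) : ℝ) : ℂ) := by
    apply mul_left_cancel₀ Complex.I_ne_zero
    rw [hm]; push_cast; ring
  exact (Complex.ofReal_injective h).symm

/-- The symbol of the averaging operator `f ↦ ∫₀¹ f(· + s e_l) ds`. -/
def avgSymbol (y : ℝ) : ℂ := ∫ s in (0 : ℝ)..1, Complex.exp (Complex.I * ((s * y : ℝ) : ℂ))

theorem mul_avgSymbol (y : ℝ) :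
    Complex.I * (y : ℂ) * avgSymbol y = Complex.exp (Complex.I * (y : ℂ)) - 1 := by
  have h : ∀ s ∈ uIcc (0 : ℝ) 1, HasDerivAt (fun s : ℝ => Complex.exp (Complex.I * ((s * y : ℝ) : ℂ)))
      (Complex.I * (y : ℂ) * Complex.exp (Complex.I * ((s * y : ℝ) : ℂ))) s := by
    intro s _
    have h1 : HasDerivAt (fun s : ℝ => Complex.I * ((s * y : ℝ) : ℂ)) (Complex.I * (y : ℂ)) s := by
      have := ((hasDerivAt_id s).mul_const y).ofReal_comp.const_mul Complex.I
      simpa using this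
    simpa [mul_comm] using h1.cexp
  have := intervalIntegral.integral_eq_sub_of_hasDerivAt h
    (Continuous.intervalIntegrable (by fun_prop) _ _)
  rw [intervalIntegral.integral_const_mul] at this
  unfold avgSymbol
  rw [this]
  simp

/-- Fubini on [0,1] × ℝ^d, legitimate because the phases have modulus one and g is integrable. -/
theorem intervalIntegral_invFourier {g : Space d → Vec n} (hg : Integrable g) (x y : Space d) :
    ∫ s in (0 : ℝ)..1, invFourier g (x + s • y)
      = invFourier (fun k => avgSymbol (inner ℝ k y) • g k) x := by
  simp only [← invFourier_shift]
  simp only [invFourier]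
  rw [intervalIntegral.integral_smul]
  congr 1
  rw [intervalIntegral_integral_swap]
  · congr 1
    ext1 k
    rw [intervalIntegral.integral_smul, intervalIntegral.integral_smul_const]
    simp only [avgSymbol, inner_smul_right]
  · rw [uIoc_of_le zero_le_one]
    have hi : Integrable (fun p : ℝ × Space d => g p.2)
        ((volume.restrict (Ioc (0 : ℝ) 1)).prod volume) := by
      simpa using hg.comp_snd (volume.restrict (Ioc (0 : ℝ) 1))
    refine hi.mono ?_ (ae_of_all _ fun p => ?_)
    · have h1 : Continuous fun p : ℝ × Space d =>
          Complex.exp (Complex.I * ((inner ℝ p.2 x : ℝ) : ℂ)) := by fun_prop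
      have h2 : Continuous fun p : ℝ × Space d =>
          Complex.exp (Complex.I * ((inner ℝ p.2 (p.1 • y) : ℝ) : ℂ)) := by fun_prop
      exact h1.aestronglyMeasurable.smul (h2.aestronglyMeasurable.smul hi.1)
    · simp only [Function.uncurry]
      rw [norm_smul, norm_smul, mul_comm Complex.I, Complex.norm_exp_ofReal_mul_I,
        mul_comm Complex.I, Complex.norm_exp_ofReal_mul_I, one_mul, one_mul]

theorem norm_avgSymbol_le (y : ℝ) : ‖avgSymbol y‖ ≤ 1 := by
  have := intervalIntegral.norm_integral_le_of_norm_le_const (a := (0 : ℝ)) (b := 1) (C := 1)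
    (f := fun s : ℝ => Complex.exp (Complex.I * ((s * y : ℝ) : ℂ))) (fun s _ => by
      rw [mul_comm Complex.I, Complex.norm_exp_ofReal_mul_I])
  simpa [avgSymbol] using this

theorem continuous_avgSymbol : Continuous avgSymbol := by
  unfold avgSymbol
  apply intervalIntegral.continuous_parametric_intervalIntegral_of_continuous'
  fun_prop

/-- The Fourier transform of a partial derivative. -/
theorem hat_pderiv {f : Space d → Vec n} (hf : ContDiff ℝ 1 f) (h0 : MemW f) (l : Fin d)
    (h1 : MemW (pderiv l f)) :
    hat (pderiv l f) =ᵐ[volume] fun k => (Complex.I * ((k l : ℝ) : ℂ)) • hat f k := by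
  set e : Space d := EuclideanSpace.single l 1 with he
  have hin : ∀ k : Space d, inner ℝ k e = k l := fun k => by simp [he, EuclideanSpace.inner_single_right]
  have hm : ∀ y : ℝ, ‖Complex.exp (Complex.I * (y : ℂ)) - 1‖ ≤ 2 := fun y => by
    refine (norm_sub_le _ _).trans ?_
    rw [mul_comm Complex.I, Complex.norm_exp_ofReal_mul_I, norm_one]
    norm_num
  have hcl : Continuous fun k : Space d => k l := by fun_prop
  have i1 : Integrable fun k : Space d => avgSymbol (k l) • hat (pderiv l f) k :=
    (integrable_hat _).bdd_smul 1 (continuous_avgSymbol.comp hcl).aestronglyMeasurable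
      (ae_of_all _ fun k => norm_avgSymbol_le _)
  have i2 : Integrable fun k : Space d => Complex.exp (Complex.I * ((k l : ℝ) : ℂ)) • hat f k := by
    simpa [hin] using integrable_cexp_smul (integrable_hat f) e
  -- Both sides have f(x + e_l) - f(x) as inverse transform, the right one because this difference
  -- is the integral of ∂_l f along the segment. Differentiation under the inverse transform is
  -- avoided: integrability of k_l f̂ is not known beforehand.
  have key : (fun k : Space d => (Complex.exp (Complex.I * ((k l : ℝ) : ℂ))) • hat f k + -(hat f k))
      =ᵐ[volume] fun k => avgSymbol (k l) • hat (pderiv l f) k := by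
    refine ae_eq_of_invFourier_eq (i2.add (integrable_hat f).neg) i1 fun x => ?_
    have hint := intervalIntegral_invFourier (integrable_hat (pderiv l f)) x e
    simp only [hin] at hint
    rw [← hint, invFourier_add i2 (show Integrable fun k => -(hat f k) from (integrable_hat f).neg)]
    have hneg : invFourier (fun k => -(hat f k)) x = -invFourier (hat f) x :=
      invFourier_clm (-ContinuousLinearMap.id ℂ (Vec n)) (integrable_hat f) x
    have hsh := invFourier_shift (hat f) x e
    simp only [hin] at hsh
    rw [hneg, hsh, ← h0.eq_invFourier, ← h0.eq_invFourier, ← sub_eq_add_neg]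
    simp only [← h1.eq_invFourier]
    have hder : ∀ s ∈ uIcc (0 : ℝ) 1,
        HasDerivAt (fun s : ℝ => f (x + s • e)) (pderiv l f (x + s • e)) s := by
      intro s _
      have h2 : HasDerivAt (fun s : ℝ => x + s • e) e s := by
        simpa using ((hasDerivAt_id s).smul_const e).const_add x
      exact (((hf.differentiable one_ne_zero) _).hasFDerivAt).comp_hasDerivAt s h2
    rw [intervalIntegral.integral_eq_sub_of_hasDerivAt hder]
    · simp
    · apply Continuous.intervalIntegrable
      have := hf.continuous_fderiv one_ne_zero
      unfold pderiv
      fun_prop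
  filter_upwards [key, ae_cexp_coord_ne_one l] with k hk hne
  have hne' : Complex.exp (Complex.I * ((k l : ℝ) : ℂ)) - 1 ≠ 0 := sub_ne_zero.mpr hne
  -- Multiplication by ik_l turns the averaging symbol into e^{ik_l} - 1, which then cancels.
  have h2 := congrArg (fun v => (Complex.I * ((k l : ℝ) : ℂ)) • v) hk
  simp only [smul_smul, mul_avgSymbol] at h2
  apply smul_right_injective _ hne'
  simp only
  rw [← h2, ← sub_eq_add_neg, smul_sub, smul_smul, smul_smul, sub_mul, one_mul, sub_smul, mul_comm]

/-- Componentwise complex conjugation as a real-linear isometry. -/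
def conjLI (n : ℕ) : Vec n →ₗᵢ[ℝ] Vec n where
  toFun := conjVec
  map_add' u v := by ext i; simp [conjVec]
  map_smul' c v := by ext i; simp [conjVec]
  norm_map' v := by simp [conjVec, EuclideanSpace.norm_eq]

theorem conjVec_smul (c : ℂ) (v : Vec n) : conjVec (c • v) = (starRingEnd ℂ c) • conjVec v := by
  ext i; simp [conjVec]

theorem IsFourier.conj {f g : Space d → Vec n} (h : IsFourier f g) :
    IsFourier (fun x => conjVec (f x)) (fun k => conjVec (g (-k))) := by
  refine ⟨(conjLI n).toContinuousLinearMap.integrable_comp h.1.comp_neg, fun x => ?_⟩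
  simp only [h.2 x, invFourier]
  change conjLI n _ = _
  rw [(conjLI n).map_smul]
  congr 1
  change (conjLI n).toContinuousLinearMap _ = _
  rw [← ContinuousLinearMap.integral_comp_comm _ (integrable_cexp_smul h.1 x),
    ← integral_neg_eq_self]
  congr 1
  ext1 k
  change conjVec _ = _
  rw [conjVec_smul, ← Complex.exp_conj]
  simp

end

/-! ### Weighted L¹ norms -/

section WeightedNorm

variable {d : ℕ} {E F G : Type*} [NormedAddCommGroup E] [NormedAddCommGroup F]
  [NormedAddCommGroup G]

/-- The weighted `L¹` norm `∫ w |f|`, with values in `[0, ∞]`. -/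
def wnorm (w : Space d → ℝ≥0) (f : Space d → E) : ℝ≥0∞ := ∫⁻ k, (w k : ℝ≥0∞) * ‖f k‖ₑ

theorem wnorm_le_of_ae {w w' : Space d → ℝ≥0} {f : Space d → E} {g : Space d → F} (C : ℝ≥0)
    (h : ∀ᵐ k, (w k : ℝ) * ‖f k‖ ≤ C * (w' k * ‖g k‖)) : wnorm w f ≤ C * wnorm w' g := by
  unfold wnorm
  rw [← lintegral_const_mul' _ _ ENNReal.coe_ne_top]
  apply lintegral_mono_ae
  filter_upwards [h] with k hk
  rw [← ofReal_norm, ← ofReal_norm, ← ENNReal.ofReal_coe_nnreal, ← ENNReal.ofReal_coe_nnreal,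
    ← ENNReal.ofReal_coe_nnreal, ← ENNReal.ofReal_mul (by positivity),
    ← ENNReal.ofReal_mul (by positivity), ← ENNReal.ofReal_mul (by positivity)]
  exact ENNReal.ofReal_le_ofReal hk

theorem wnorm_mono_ae {w w' : Space d → ℝ≥0} {f : Space d → E} {g : Space d → F}
    (h : ∀ᵐ k, (w k : ℝ) * ‖f k‖ ≤ w' k * ‖g k‖) : wnorm w f ≤ wnorm w' g := by
  simpa using wnorm_le_of_ae 1 (by simpa using h)

theorem wnorm_congr_ae {w : Space d → ℝ≥0} {f : Space d → E} {g : Space d → F}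
    (h : ∀ᵐ k, ‖f k‖ = ‖g k‖) : wnorm w f = wnorm w g :=
  le_antisymm (wnorm_mono_ae (h.mono fun k hk => by rw [hk]))
    (wnorm_mono_ae (h.mono fun k hk => by rw [hk]))

theorem wnorm_mono_weight {w w' : Space d → ℝ≥0} (f : Space d → E) (h : ∀ k, w k ≤ w' k) :
    wnorm w f ≤ wnorm w' f :=
  wnorm_mono_ae (ae_of_all _ fun k =>
    mul_le_mul_of_nonneg_right (NNReal.coe_le_coe.mpr (h k)) (norm_nonneg _))

theorem aemeasurable_weight_mul_enorm {w : Space d → ℝ≥0} (hw : Measurable w) {f : Space d → E}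
    (hf : AEStronglyMeasurable f) : AEMeasurable (fun k => (w k : ℝ≥0∞) * ‖f k‖ₑ) :=
  hw.coe_nnreal_ennreal.aemeasurable.mul hf.enorm

theorem wnorm_add_le {w : Space d → ℝ≥0} (hw : Measurable w) {f : Space d → E}
    (hf : AEStronglyMeasurable f) (g : Space d → E) :
    wnorm w (fun k => f k + g k) ≤ wnorm w f + wnorm w g := by
  unfold wnorm
  rw [← lintegral_add_left' (aemeasurable_weight_mul_enorm hw hf)]
  refine lintegral_mono fun k => ?_
  rw [← mul_add]
  gcongr
  exact enorm_add_le _ _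

theorem wnorm_sum_le {ι : Type*} (s : Finset ι) {w : Space d → ℝ≥0} (hw : Measurable w)
    {f : ι → Space d → E} (hf : ∀ i ∈ s, AEStronglyMeasurable (f i)) :
    wnorm w (fun k => ∑ i ∈ s, f i k) ≤ ∑ i ∈ s, wnorm w (f i) := by
  unfold wnorm
  rw [← lintegral_finsetSum' _ fun i hi => aemeasurable_weight_mul_enorm hw (hf i hi)]
  refine lintegral_mono fun k => ?_
  rw [← Finset.mul_sum]
  gcongr
  exact enorm_sum_le _ _

theorem wnorm_lt_top {w : Space d → ℝ≥0} {N : ℝ≥0} (hN : ∀ k, w k ≤ N) {f : Space d → E}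
    (hf : Integrable f) : wnorm w f < ∞ := by
  have h : wnorm w f ≤ N * wnorm 1 f := wnorm_le_of_ae N (ae_of_all _ fun k => by
    simpa using mul_le_mul_of_nonneg_right (NNReal.coe_le_coe.mpr (hN k)) (norm_nonneg _))
  refine h.trans_lt (ENNReal.mul_lt_top ENNReal.coe_lt_top ?_)
  simpa [wnorm, HasFiniteIntegral] using hf.2

/-- Monotone convergence. Norms with bounded weights are finite and continuous on L¹, so
differential inequalities are proved for `min (W k) N` and passed to the limit with constants
independent of N. -/
theorem wnorm_eq_iSup_min {W : Space d → ℝ≥0} (hW : Measurable W) {f : Space d → E}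
    (hf : AEStronglyMeasurable f) :
    wnorm W f = ⨆ N : ℕ, wnorm (fun k => min (W k) N) f := by
  unfold wnorm
  rw [← lintegral_iSup']
  · congr 1
    ext1 k
    rw [← ENNReal.iSup_mul]
    congr 1
    apply le_antisymm
    · obtain ⟨N, hN⟩ := exists_nat_ge (W k)
      exact le_iSup_of_le N (by simp only [min_eq_left hN, le_refl])
    · exact iSup_le fun N => ENNReal.coe_le_coe.mpr (min_le_left _ _)
  · intro N
    exact (hW.min measurable_const).coe_nnreal_ennreal.aemeasurable.mul hf.enorm
  · refine ae_of_all _ fun k N N' h => ?_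
    dsimp only
    gcongr

theorem wnorm_le_of_forall_min {W : Space d → ℝ≥0} (hW : Measurable W) {f : Space d → E}
    (hf : AEStronglyMeasurable f) {C : ℝ≥0∞} (h : ∀ N : ℕ, wnorm (fun k => min (W k) N) f ≤ C) :
    wnorm W f ≤ C := by
  rw [wnorm_eq_iSup_min hW hf]
  exact iSup_le h

/-- `L¹(ℝ^d, E)`. -/
abbrev L1 (d : ℕ) (E : Type*) [NormedAddCommGroup E] := Lp E 1 (volume : Measure (Space d))

theorem wnorm_one_coe (f : L1 d E) : wnorm 1 f = ENNReal.ofReal ‖f‖ := by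
  rw [L1.norm_eq_integral_norm, ofReal_integral_norm_eq_lintegral_enorm (L1.integrable_coeFn f)]
  simp [wnorm]

end WeightedNorm

/-! ### Convolution estimates in weighted L¹ spaces -/

section Convolution

variable {d : ℕ} {E F G : Type*} [NormedAddCommGroup E] [NormedAddCommGroup F]
  [NormedAddCommGroup G] [NormedSpace ℂ E] [NormedSpace ℂ F] [NormedSpace ℂ G]

/-- Tonelli and a translation. The weight is kept at `y + t`, so that either a submultiplicative or
a quasi-subadditive bound can be inserted afterwards. -/
theorem wnorm_convolution_le (B : E →L[ℂ] F →L[ℂ] G) {w : Space d → ℝ≥0} (hw : Measurable w)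
    {f : Space d → E} {g : Space d → F} (hf : AEStronglyMeasurable f)
    (hg : AEStronglyMeasurable g) :
    wnorm w (f ⋆[B] g) ≤ ‖B‖ₑ * ∫⁻ t, ‖f t‖ₑ * ∫⁻ y, (w (y + t) : ℝ≥0∞) * ‖g y‖ₑ := by
  have hmeas : AEMeasurable (fun p : Space d × Space d =>
      (w p.1 : ℝ≥0∞) * (‖f p.2‖ₑ * ‖g (p.1 - p.2)‖ₑ)) (volume.prod volume) := by
    have := (hf.norm.convolution_integrand (μ := volume) (ContinuousLinearMap.mul ℝ ℝ) hg.norm).enorm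
    refine (hw.comp measurable_fst).coe_nnreal_ennreal.aemeasurable.mul (this.congr ?_)
    refine ae_of_all _ fun p => ?_
    simp [enorm_mul]
  calc wnorm w (f ⋆[B] g)
      ≤ ∫⁻ x, (w x : ℝ≥0∞) * (‖B‖ₑ * ∫⁻ t, ‖f t‖ₑ * ‖g (x - t)‖ₑ) := by
        refine lintegral_mono fun x => ?_
        dsimp only
        gcongr
        rw [convolution_def]
        refine (enorm_integral_le_lintegral_enorm _).trans ?_
        rw [← lintegral_const_mul' _ _ enorm_ne_top]
        refine lintegral_mono fun t => ?_
        rw [← mul_assoc, ← ofReal_norm, ← ofReal_norm B, ← ofReal_norm (f t),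
          ← ofReal_norm (g (x - t)), ← ENNReal.ofReal_mul (norm_nonneg _),
          ← ENNReal.ofReal_mul (by positivity)]
        exact ENNReal.ofReal_le_ofReal (B.le_opNorm₂ _ _)
    _ = ‖B‖ₑ * ∫⁻ x, ∫⁻ t, (w x : ℝ≥0∞) * (‖f t‖ₑ * ‖g (x - t)‖ₑ) := by
        rw [← lintegral_const_mul' _ _ enorm_ne_top]
        congr 1
        ext1 x
        rw [lintegral_const_mul' _ _ ENNReal.coe_ne_top, mul_left_comm]
    _ = ‖B‖ₑ * ∫⁻ t, ‖f t‖ₑ * ∫⁻ x, (w x : ℝ≥0∞) * ‖g (x - t)‖ₑ := by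
        rw [lintegral_lintegral_swap hmeas]
        congr 2
        ext1 t
        rw [← lintegral_const_mul' _ _ enorm_ne_top]
        congr 1
        ext1 x
        rw [mul_left_comm]
    _ = _ := by
        congr 2
        ext1 t
        rw [← lintegral_sub_right_eq_self (fun y => (w (y + t) : ℝ≥0∞) * ‖g y‖ₑ) t]
        simp

theorem wnorm_convolution_le_mul (B : E →L[ℂ] F →L[ℂ] G) {w : Space d → ℝ≥0} (hw : Measurable w)
    (hmul : ∀ x y, w (x + y) ≤ w x * w y) {f : Space d → E} {g : Space d → F}
    (hf : Integrable f) (hg : Integrable g) :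
    wnorm w (f ⋆[B] g) ≤ ‖B‖ₑ * (wnorm w f * wnorm w g) := by
  refine (wnorm_convolution_le B hw hf.1 hg.1).trans ?_
  gcongr
  unfold wnorm
  rw [← lintegral_mul_const'' _ (aemeasurable_weight_mul_enorm hw hf.1)]
  refine lintegral_mono fun t => ?_
  dsimp only
  rw [mul_comm (w t : ℝ≥0∞), mul_assoc]
  gcongr
  rw [← lintegral_const_mul' _ _ ENNReal.coe_ne_top]
  refine lintegral_mono fun y => ?_
  dsimp only
  rw [← mul_assoc]
  gcongr
  rw [mul_comm]
  exact_mod_cast hmul y t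

/-- Each term carries the weight on one factor only. The estimate is thus linear in the weighted
norm once the unweighted norms are bounded, which is what Gronwall's inequality needs. -/
theorem wnorm_convolution_le_add (B : E →L[ℂ] F →L[ℂ] G) {w : Space d → ℝ≥0} (hw : Measurable w)
    {K : ℝ≥0} (hadd : ∀ x y, w (x + y) ≤ K * (w x + w y)) {f : Space d → E} {g : Space d → F}
    (hf : Integrable f) (hg : Integrable g) :
    wnorm w (f ⋆[B] g)
      ≤ ‖B‖ₑ * (K * (wnorm w f * wnorm 1 g + wnorm 1 f * wnorm w g)) := by
  refine (wnorm_convolution_le B hw hf.1 hg.1).trans ?_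
  gcongr
  have h1 : ∀ t, ∫⁻ y, (w (y + t) : ℝ≥0∞) * ‖g y‖ₑ ≤ K * (w t * wnorm 1 g + wnorm w g) := by
    intro t
    unfold wnorm
    rw [← lintegral_const_mul' (w t : ℝ≥0∞) _ ENNReal.coe_ne_top, ← lintegral_add_right' _
      (aemeasurable_weight_mul_enorm hw hg.1),
      ← lintegral_const_mul' _ _ ENNReal.coe_ne_top]
    refine lintegral_mono fun y => ?_
    simp only [Pi.one_apply, ENNReal.coe_one, one_mul]
    rw [← add_mul, ← mul_assoc]
    gcongr
    rw [add_comm (w t : ℝ≥0∞)]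
    exact_mod_cast hadd y t
  calc ∫⁻ t, ‖f t‖ₑ * ∫⁻ y, (w (y + t) : ℝ≥0∞) * ‖g y‖ₑ
      ≤ ∫⁻ t, K * (((w t : ℝ≥0∞) * ‖f t‖ₑ) * wnorm 1 g + ‖f t‖ₑ * wnorm w g) := by
        refine lintegral_mono fun t => ?_
        calc _ ≤ ‖f t‖ₑ * (K * (w t * wnorm 1 g + wnorm w g)) := by gcongr; exact h1 t
          _ = _ := by ring
    _ = _ := by
        rw [lintegral_const_mul' _ _ ENNReal.coe_ne_top, lintegral_add_left'
          ((aemeasurable_weight_mul_enorm hw hf.1).mul_const _),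
          lintegral_mul_const'' _ (aemeasurable_weight_mul_enorm hw hf.1),
          lintegral_mul_const'' _ hf.1.enorm]
        simp [wnorm]

/-- Convolution with respect to a bounded bilinear map, as a bounded bilinear map on `L¹`. -/
def convL (B : E →L[ℂ] F →L[ℂ] G) : L1 d E →L[ℝ] L1 d F →L[ℝ] L1 d G :=
  LinearMap.mkContinuous₂
    (LinearMap.mk₂ ℝ
      (fun f g => ((L1.integrable_coeFn f).integrable_convolution B (L1.integrable_coeFn g)).toL1 _)
      (fun f f' g => by
        rw [← Integrable.toL1_add, Integrable.toL1_eq_toL1_iff]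
        have h1 := (L1.integrable_coeFn f).ae_convolution_exists B (L1.integrable_coeFn g)
        have h2 := (L1.integrable_coeFn f').ae_convolution_exists B (L1.integrable_coeFn g)
        rw [convolution_congr _ (Lp.coeFn_add f f') (ae_eq_refl _)]
        filter_upwards [h1, h2] with x hx1 hx2
        exact hx1.add_distrib hx2)
      (fun c f g => by
        rw [← Integrable.toL1_smul, Integrable.toL1_eq_toL1_iff,
          convolution_congr _ (Lp.coeFn_smul c f) (ae_eq_refl _)]
        refine ae_of_all _ fun x => ?_
        simp only [convolution_def, Pi.smul_apply]
        rw [← integral_smul]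
        congr 1
        ext1 t
        rw [ContinuousLinearMap.map_smul_of_tower]
        rfl)
      (fun f g g' => by
        rw [← Integrable.toL1_add, Integrable.toL1_eq_toL1_iff]
        have h1 := (L1.integrable_coeFn f).ae_convolution_exists B (L1.integrable_coeFn g)
        have h2 := (L1.integrable_coeFn f).ae_convolution_exists B (L1.integrable_coeFn g')
        rw [convolution_congr _ (ae_eq_refl _) (Lp.coeFn_add g g')]
        filter_upwards [h1, h2] with x hx1 hx2
        exact hx1.distrib_add hx2)
      (fun c f g => by
        rw [← Integrable.toL1_smul, Integrable.toL1_eq_toL1_iff,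
          convolution_congr _ (ae_eq_refl _) (Lp.coeFn_smul c g)]
        refine ae_of_all _ fun x => ?_
        simp only [convolution_def, Pi.smul_apply]
        rw [← integral_smul]
        congr 1
        ext1 t
        rw [ContinuousLinearMap.map_smul_of_tower]))
    ‖B‖
    (fun f g => by
      have h := wnorm_convolution_le_mul B (w := 1) measurable_const (fun x y => by simp)
        (L1.integrable_coeFn f) (L1.integrable_coeFn g)
      rw [wnorm_one_coe, wnorm_one_coe, ← ofReal_norm, ← ENNReal.ofReal_mul (norm_nonneg _),
        ← ENNReal.ofReal_mul (norm_nonneg _), ← mul_assoc] at h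
      simp only [LinearMap.mk₂_apply]
      rw [← ENNReal.ofReal_le_ofReal_iff (by positivity), ← wnorm_one_coe]
      refine le_trans (le_of_eq ?_) h
      apply wnorm_congr_ae
      filter_upwards [Integrable.coeFn_toL1
        ((L1.integrable_coeFn f).integrable_convolution B (L1.integrable_coeFn g))] with k hk
      rw [hk])

theorem coeFn_convL (B : E →L[ℂ] F →L[ℂ] G) (f : L1 d E) (g : L1 d F) :
    convL B f g =ᵐ[volume] (⇑f ⋆[B] ⇑g) :=
  Integrable.coeFn_toL1
    ((L1.integrable_coeFn f).integrable_convolution B (L1.integrable_coeFn g))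

theorem wnorm_convL_le_mul (B : E →L[ℂ] F →L[ℂ] G) {w : Space d → ℝ≥0} (hw : Measurable w)
    (hmul : ∀ x y, w (x + y) ≤ w x * w y) (f : L1 d E) (g : L1 d F) :
    wnorm w (convL B f g) ≤ ‖B‖ₑ * (wnorm w f * wnorm w g) := by
  rw [wnorm_congr_ae ((coeFn_convL B f g).mono fun k hk => by rw [hk])]
  exact wnorm_convolution_le_mul B hw hmul (L1.integrable_coeFn f) (L1.integrable_coeFn g)

theorem wnorm_convL_le_add (B : E →L[ℂ] F →L[ℂ] G) {w : Space d → ℝ≥0} (hw : Measurable w)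
    {K : ℝ≥0} (hadd : ∀ x y, w (x + y) ≤ K * (w x + w y)) (f : L1 d E) (g : L1 d F) :
    wnorm w (convL B f g)
      ≤ ‖B‖ₑ * (K * (wnorm w f * wnorm 1 g + wnorm 1 f * wnorm w g)) := by
  rw [wnorm_congr_ae ((coeFn_convL B f g).mono fun k hk => by rw [hk])]
  exact wnorm_convolution_le_add B hw hadd (L1.integrable_coeFn f) (L1.integrable_coeFn g)

open scoped FourierTransform in
theorem fourier_convL [CompleteSpace E] [CompleteSpace F] [CompleteSpace G]
    (B : E →L[ℂ] F →L[ℂ] G) (f : L1 d E) (g : L1 d F) (ξ : Space d) :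
    𝓕 (convL B f g : Space d → G) ξ = B (𝓕 (f : Space d → E) ξ) (𝓕 (g : Space d → F) ξ) := by
  rw [← Real.fourier_bilin_convolution_eq B (L1.integrable_coeFn f) (L1.integrable_coeFn g)]
  rw [Real.fourier_eq, Real.fourier_eq]
  apply integral_congr_ae
  filter_upwards [coeFn_convL B f g] with k hk
  rw [hk]

/-- The trilinear convolution product on `L¹` defined by a trilinear map. -/
def conv3 (t : E →L[ℂ] E →L[ℂ] E →L[ℂ] E) (a b c : L1 d E) : L1 d E :=
  convL (ContinuousLinearMap.id ℂ (E →L[ℂ] E)) (convL t a b) c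

theorem enorm_id_le (E : Type*) [NormedAddCommGroup E] [NormedSpace ℂ E] :
    ‖ContinuousLinearMap.id ℂ E‖ₑ ≤ 1 := by
  rw [← ofReal_norm, ← ENNReal.ofReal_one]
  exact ENNReal.ofReal_le_ofReal ContinuousLinearMap.norm_id_le

theorem wnorm_conv3_le_mul (t : E →L[ℂ] E →L[ℂ] E →L[ℂ] E) {w : Space d → ℝ≥0}
    (hw : Measurable w) (hmul : ∀ x y, w (x + y) ≤ w x * w y) (a b c : L1 d E) :
    wnorm w (conv3 t a b c) ≤ ‖t‖ₑ * (wnorm w a * wnorm w b * wnorm w c) := by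
  refine (wnorm_convL_le_mul _ hw hmul _ _).trans ?_
  calc _ ≤ 1 * (‖t‖ₑ * (wnorm w a * wnorm w b) * wnorm w c) := by
        gcongr
        · exact enorm_id_le _
        · exact wnorm_convL_le_mul _ hw hmul _ _
    _ = _ := by ring

/-- Two convolutions cost K twice. The term with the weight on c costs it once only, and `1 ≤ K`
raises it to the common factor `K ^ 2`. -/
theorem wnorm_conv3_le_add (t : E →L[ℂ] E →L[ℂ] E →L[ℂ] E) {w : Space d → ℝ≥0}
    (hw : Measurable w) {K : ℝ≥0} (hK : 1 ≤ K) (hadd : ∀ x y, w (x + y) ≤ K * (w x + w y))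
    (a b c : L1 d E) :
    wnorm w (conv3 t a b c) ≤ ‖t‖ₑ * K ^ 2 * (wnorm w a * wnorm 1 b * wnorm 1 c
      + wnorm 1 a * wnorm w b * wnorm 1 c + wnorm 1 a * wnorm 1 b * wnorm w c) := by
  refine (wnorm_convL_le_add _ hw hadd _ _).trans ?_
  have hK' : (K : ℝ≥0∞) ≤ K ^ 2 := by
    exact_mod_cast le_self_pow hK two_ne_zero
  calc _ ≤ 1 * (K * (‖t‖ₑ * (K * (wnorm w a * wnorm 1 b + wnorm 1 a * wnorm w b)) * wnorm 1 c
          + ‖t‖ₑ * (wnorm 1 a * wnorm 1 b) * wnorm w c)) := by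
        gcongr
        · exact enorm_id_le _
        · exact wnorm_convL_le_add _ hw hadd _ _
        · exact wnorm_convL_le_mul _ (w := 1) measurable_const (fun x y => by simp) _ _
    _ = ‖t‖ₑ * K ^ 2 * (wnorm w a * wnorm 1 b * wnorm 1 c + wnorm 1 a * wnorm w b * wnorm 1 c)
          + ‖t‖ₑ * K * (wnorm 1 a * wnorm 1 b * wnorm w c) := by ring
    _ ≤ ‖t‖ₑ * K ^ 2 * (wnorm w a * wnorm 1 b * wnorm 1 c + wnorm 1 a * wnorm w b * wnorm 1 c)
          + ‖t‖ₑ * K ^ 2 * (wnorm 1 a * wnorm 1 b * wnorm w c) := by gcongr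
    _ = _ := by ring

theorem hasDerivWithinAt_conv3 (t : E →L[ℂ] E →L[ℂ] E →L[ℂ] E) {a b c : ℝ → L1 d E}
    {a' b' c' : L1 d E} {s : Set ℝ} {x : ℝ} (ha : HasDerivWithinAt a a' s x)
    (hb : HasDerivWithinAt b b' s x) (hc : HasDerivWithinAt c c' s x) :
    HasDerivWithinAt (fun y => conv3 t (a y) (b y) (c y))
      (conv3 t (a x) (b x) c' + (conv3 t (a x) b' (c x) + conv3 t a' (b x) (c x))) s x := by
  have h1 := (convL (d := d) t).hasDerivWithinAt_of_bilinear ha hb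
  have h2 := (convL (d := d) (ContinuousLinearMap.id ℂ (E →L[ℂ] E))).hasDerivWithinAt_of_bilinear
    h1 hc
  rw [map_add, add_apply] at h2
  exact h2

theorem continuousOn_conv3 (t : E →L[ℂ] E →L[ℂ] E →L[ℂ] E) {a b c : ℝ → L1 d E} {s : Set ℝ}
    (ha : ContinuousOn a s) (hb : ContinuousOn b s) (hc : ContinuousOn c s) :
    ContinuousOn (fun y => conv3 t (a y) (b y) (c y)) s := by
  unfold conv3
  fun_prop

-- Three normalizing constants on the left against one on the right leave `fourierConst d ^ 2`, the
-- factor that `nonlin` carries.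
open scoped FourierTransform in
theorem invFourier_conv3 {n : ℕ} (t : Vec n →L[ℂ] Vec n →L[ℂ] Vec n →L[ℂ] Vec n)
    (a b c : L1 d (Vec n)) (x : Space d) :
    t (invFourier a x) (invFourier b x) (invFourier c x)
      = (fourierConst d ^ 2) • invFourier (conv3 t a b c) x := by
  simp only [invFourier_eq_fourier, conv3, fourier_convL, ContinuousLinearMap.id_apply,
    ContinuousLinearMap.map_smul_of_tower, smul_apply, smul_smul]
  congr 1
  ring

end Convolution

/-! ### Differential inequalities for upper right Dini derivatives -/

section Slope

/-- The upper right Dini derivative of `φ` at `t` is at most `c`. -/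
def RightSlopeLE (φ : ℝ → ℝ) (c t : ℝ) : Prop :=
  ∀ r, c < r → ∀ᶠ z in 𝓝[>] t, (z - t)⁻¹ * (φ z - φ t) < r

theorem RightSlopeLE.mono {φ : ℝ → ℝ} {c c' t : ℝ} (h : RightSlopeLE φ c t) (hc : c ≤ c') :
    RightSlopeLE φ c' t :=
  fun r hr => h r (hc.trans_lt hr)

theorem RightSlopeLE.add {φ ψ : ℝ → ℝ} {c c' t : ℝ} (h : RightSlopeLE φ c t)
    (h' : RightSlopeLE ψ c' t) : RightSlopeLE (fun s => φ s + ψ s) (c + c') t := by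
  intro r hr
  have h1 : 0 < (r - (c + c')) / 2 := by linarith
  filter_upwards [h (c + (r - (c + c')) / 2) (by linarith),
    h' (c' + (r - (c + c')) / 2) (by linarith)] with z hz hz'
  have : (z - t)⁻¹ * (φ z + ψ z - (φ t + ψ t))
      = (z - t)⁻¹ * (φ z - φ t) + (z - t)⁻¹ * (ψ z - ψ t) := by ring
  rw [this]
  linarith

theorem RightSlopeLE.sum {ι : Type*} (s : Finset ι) {φ : ι → ℝ → ℝ} {c : ι → ℝ} {t : ℝ}
    (h : ∀ i ∈ s, RightSlopeLE (φ i) (c i) t) :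
    RightSlopeLE (fun x => ∑ i ∈ s, φ i x) (∑ i ∈ s, c i) t := by
  classical
  induction s using Finset.induction_on with
  | empty =>
    intro r hr
    simpa using hr
  | insert i s hi ih =>
    simp only [Finset.sum_insert hi]
    exact (h i (Finset.mem_insert_self _ _)).add
      (ih fun j hj => h j (Finset.mem_insert_of_mem hj))

theorem le_gronwallBound_of_rightSlopeLE {φ c : ℝ → ℝ} {δ K e T : ℝ}
    (hφ : ContinuousOn φ (Icc 0 T)) (hs : ∀ t ∈ Ico 0 T, RightSlopeLE φ (c t) t) (h0 : φ 0 ≤ δ)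
    (hc : ∀ t ∈ Ico 0 T, c t ≤ K * φ t + e) : ∀ t ∈ Icc 0 T, φ t ≤ gronwallBound δ K e t := by
  intro t ht
  have := le_gronwallBound_of_liminf_deriv_right_le hφ
    (fun x hx r hr => (hs x hx r hr).frequently) h0 hc t ht
  simpa using this

/-- Comparison with a line: the slope is checked only where φ meets the line, so a slope bound that
is cubic in φ can be evaluated there explicitly. -/
theorem le_linear_of_rightSlopeLE {φ c : ℝ → ℝ} {δ K T : ℝ}
    (hφ : ContinuousOn φ (Icc 0 T)) (hs : ∀ t ∈ Ico 0 T, RightSlopeLE φ (c t) t) (h0 : φ 0 ≤ δ)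
    (hc : ∀ t ∈ Ico 0 T, φ t = δ + K * t → c t < K) : ∀ t ∈ Icc 0 T, φ t ≤ δ + K * t := by
  intro t ht
  refine image_le_of_liminf_slope_right_lt_deriv_boundary (B := fun t => δ + K * t)
    (B' := fun _ => K) hφ (fun x hx r hr => ?_) (by simpa using h0)
    (fun x => ?_) hc ht
  · refine ((hs x hx r hr).mono fun z hz => ?_).frequently
    rwa [slope_def_field, div_eq_inv_mul]
  · simpa using ((hasDerivAt_id x).const_mul K).const_add δ

end Slope

/-! ### Growth rates of weighted norms along curves in L¹ -/

section WeightedSlope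

variable {d : ℕ} {E : Type*} [NormedAddCommGroup E]

/-- The weighted `L¹` norm as a real number. -/
def wreal (w : Space d → ℝ≥0) (f : Space d → E) : ℝ := (wnorm w f).toReal

theorem wreal_nonneg (w : Space d → ℝ≥0) (f : Space d → E) : 0 ≤ wreal w f :=
  ENNReal.toReal_nonneg

theorem ofReal_wreal {w : Space d → ℝ≥0} {N : ℝ≥0} (hN : ∀ k, w k ≤ N) (f : L1 d E) :
    ENNReal.ofReal (wreal w f) = wnorm w f :=
  ENNReal.ofReal_toReal (wnorm_lt_top hN (L1.integrable_coeFn f)).ne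

theorem wreal_eq_integral {w : Space d → ℝ≥0} (hw : Measurable w) (f : L1 d E) :
    wreal w f = ∫ k, (w k : ℝ) * ‖f k‖ := by
  have hm : AEStronglyMeasurable fun k => (w k : ℝ) * ‖f k‖ :=
    hw.coe_nnreal_real.aestronglyMeasurable.mul (L1.integrable_coeFn f).1.norm
  rw [integral_eq_lintegral_of_nonneg_ae (ae_of_all _ fun k => by positivity) hm]
  unfold wreal wnorm
  congr 2
  ext1 k
  rw [ENNReal.ofReal_mul NNReal.zero_le_coe, ofReal_norm, ENNReal.ofReal_coe_nnreal]

theorem integrable_weight_mul_norm {w : Space d → ℝ≥0} (hw : Measurable w) {N : ℝ≥0}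
    (hN : ∀ k, w k ≤ N) (f : L1 d E) : Integrable fun k => (w k : ℝ) * ‖f k‖ :=
  (L1.integrable_coeFn f).norm.bdd_mul hw.coe_nnreal_real.aestronglyMeasurable
    (ae_of_all _ fun k => by
      rw [Real.norm_of_nonneg NNReal.zero_le_coe]; exact NNReal.coe_le_coe.mpr (hN k))

theorem wreal_add_le {w : Space d → ℝ≥0} (hw : Measurable w) {N : ℝ≥0} (hN : ∀ k, w k ≤ N)
    (f g : L1 d E) : wreal w (f + g : L1 d E) ≤ wreal w f + wreal w g := by
  simp only [wreal_eq_integral hw]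
  rw [← integral_add (integrable_weight_mul_norm hw hN f) (integrable_weight_mul_norm hw hN g)]
  refine integral_mono_ae (integrable_weight_mul_norm hw hN _)
    ((integrable_weight_mul_norm hw hN f).add (integrable_weight_mul_norm hw hN g)) ?_
  filter_upwards [Lp.coeFn_add f g] with k hk
  rw [hk, ← mul_add]
  exact mul_le_mul_of_nonneg_left (norm_add_le _ _) NNReal.zero_le_coe

theorem wreal_smul [NormedSpace ℝ E] {w : Space d → ℝ≥0} (hw : Measurable w) {c : ℝ} (hc : 0 ≤ c)
    (f : L1 d E) : wreal w (c • f : L1 d E) = c * wreal w f := by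
  simp only [wreal_eq_integral hw]
  rw [← integral_const_mul]
  apply integral_congr_ae
  filter_upwards [Lp.coeFn_smul c f] with k hk
  rw [hk, Pi.smul_apply, norm_smul, Real.norm_of_nonneg hc]
  ring

theorem wreal_le_norm {w : Space d → ℝ≥0} (hw : Measurable w) {N : ℝ≥0} (hN : ∀ k, w k ≤ N)
    (f : L1 d E) : wreal w f ≤ N * ‖f‖ := by
  rw [wreal_eq_integral hw, L1.norm_eq_integral_norm, ← integral_const_mul]
  refine integral_mono (integrable_weight_mul_norm hw hN f)
    ((L1.integrable_coeFn f).norm.const_mul _) fun k => ?_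
  exact mul_le_mul_of_nonneg_right (NNReal.coe_le_coe.mpr (hN k)) (norm_nonneg _)

theorem continuous_wreal {w : Space d → ℝ≥0} (hw : Measurable w) {N : ℝ≥0} (hN : ∀ k, w k ≤ N) :
    Continuous fun f : L1 d E => wreal w f := by
  have h : ∀ f g : L1 d E, wreal w f ≤ wreal w g + N * dist f g := by
    intro f g
    have h1 := wreal_add_le hw hN g (f - g)
    rw [add_sub_cancel] at h1
    rw [dist_eq_norm]
    linarith [wreal_le_norm hw hN (f - g)]
  exact (LipschitzWith.of_le_add_mul N h).continuous

/-- By Pythagoras ‖a + hb‖² = ‖a‖² + h²‖b‖², so for h > 0 the norm increases by at most h²‖b‖²/‖a‖.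
At a = 0 the slope would be ‖b‖, whence the hypothesis `hz`. -/
theorem tendsto_norm_add_smul_sub_norm_div [InnerProductSpace ℂ E] {a b : E}
    (hab : RCLike.re (inner ℂ a b) = 0) (hz : a = 0 → b = 0) (t : ℝ) :
    Tendsto (fun z : ℝ => (z - t)⁻¹ * (‖a + (z - t) • b‖ - ‖a‖)) (𝓝[>] t) (𝓝 0) := by
  by_cases ha : a = 0
  · simp [ha, hz ha]
  have ha' : 0 < ‖a‖ := norm_pos_iff.mpr ha
  have hsq : ∀ h : ℝ, ‖a + h • b‖ ^ 2 = ‖a‖ ^ 2 + h ^ 2 * ‖b‖ ^ 2 := by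
    intro h
    have h1 : h • b = (h : ℂ) • b := (Complex.coe_smul h b).symm
    rw [norm_add_sq (𝕜 := ℂ), h1, inner_smul_right, norm_smul]
    have : RCLike.re ((h : ℂ) * inner ℂ a b) = 0 := by
      have h2 : (inner ℂ a b).re = 0 := hab
      simp [h2]
    rw [this]
    simp [mul_pow]
  have hlim : Tendsto (fun z : ℝ => (z - t) * (‖b‖ ^ 2 / ‖a‖)) (𝓝[>] t) (𝓝 0) := by
    have : Tendsto (fun z : ℝ => (z - t) * (‖b‖ ^ 2 / ‖a‖)) (𝓝 t) (𝓝 ((t - t) * (‖b‖ ^ 2 / ‖a‖))) :=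
      Continuous.tendsto (by fun_prop) t
    rw [sub_self, zero_mul] at this
    exact this.mono_left nhdsWithin_le_nhds
  refine tendsto_of_tendsto_of_tendsto_of_le_of_le' tendsto_const_nhds hlim ?_ ?_
  · filter_upwards [self_mem_nhdsWithin] with z hz
    have hz' : 0 < z - t := sub_pos.mpr hz
    have h1 : ‖a‖ ≤ ‖a + (z - t) • b‖ := by
      apply le_of_sq_le_sq _ (norm_nonneg _)
      rw [hsq]; nlinarith [sq_nonneg ((z - t) * ‖b‖)]
    have : 0 ≤ (z - t)⁻¹ := by positivity
    exact mul_nonneg this (by linarith)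
  · filter_upwards [self_mem_nhdsWithin] with z hz
    have hz' : 0 < z - t := sub_pos.mpr hz
    rw [inv_mul_le_iff₀ hz', sub_le_iff_le_add']
    apply le_of_sq_le_sq _ (by positivity)
    rw [hsq]
    have e1 : ‖a‖ * ((z - t) * ((z - t) * (‖b‖ ^ 2 / ‖a‖))) = (z - t) ^ 2 * ‖b‖ ^ 2 := by
      field_simp
    nlinarith [sq_nonneg ((z - t) * ((z - t) * (‖b‖ ^ 2 / ‖a‖))), sq_nonneg ((z - t) * ‖b‖)]

/-- An evolution `f' = β + g` in `L¹` whose part `β` is pointwise orthogonal to `f` increases the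
weighted norm at most at the rate of the norm of `g`. -/
theorem rightSlopeLE_wreal [InnerProductSpace ℂ E] {w : Space d → ℝ≥0} (hw : Measurable w)
    {N : ℝ≥0} (hN : ∀ k, w k ≤ N) {f : ℝ → L1 d E} {β g : L1 d E} {t : ℝ}
    (hf : HasDerivWithinAt f (β + g) (Ici t) t)
    (horth : ∀ᵐ k, RCLike.re (inner ℂ (f t k) (β k)) = 0)
    (hz : ∀ᵐ k, f t k = 0 → β k = 0) :
    RightSlopeLE (fun s => wreal w (f s)) (wreal w g) t := by
  have hs := hasDerivWithinAt_iff_tendsto_slope.mp hf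
  rw [Ici_sdiff_left] at hs
  have h1 : Tendsto (fun z => (N : ℝ) * ‖slope f t z - (β + g)‖) (𝓝[>] t) (𝓝 0) := by
    have := ((hs.sub_const (β + g)).norm).const_mul (N : ℝ)
    simpa using this
  -- The orthogonal part contributes nothing to first order: the integrand tends to zero pointwise
  -- and is dominated by w‖β‖, which is integrable as w is bounded.
  have h2 : Tendsto (fun z : ℝ => (z - t)⁻¹ * (wreal w (f t + (z - t) • β : L1 d E) - wreal w (f t)))
      (𝓝[>] t) (𝓝 0) := by
    have h3 : ∀ z : ℝ, (z - t)⁻¹ * (wreal w (f t + (z - t) • β : L1 d E) - wreal w (f t))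
        = ∫ k, (w k : ℝ) * ((z - t)⁻¹ * (‖f t k + (z - t) • β k‖ - ‖f t k‖)) := by
      intro z
      simp only [wreal_eq_integral hw]
      rw [← integral_sub (integrable_weight_mul_norm hw hN _) (integrable_weight_mul_norm hw hN _),
        ← integral_const_mul]
      apply integral_congr_ae
      filter_upwards [Lp.coeFn_add (f t) ((z - t) • β), Lp.coeFn_smul (z - t) β] with k hk hk'
      rw [hk, Pi.add_apply, hk', Pi.smul_apply]
      ring
    simp only [h3]
    rw [show (0 : ℝ) = ∫ _ : Space d, (0 : ℝ) by simp]
    apply tendsto_integral_filter_of_dominated_convergence (fun k => (w k : ℝ) * ‖β k‖)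
    · refine Eventually.of_forall fun z => ?_
      have m1 := (L1.integrable_coeFn (f t)).1
      have m2 := (L1.integrable_coeFn β).1
      exact hw.coe_nnreal_real.aestronglyMeasurable.mul
        (((m1.add (m2.const_smul (z - t))).norm.sub m1.norm).const_mul _)
    · filter_upwards [self_mem_nhdsWithin] with z hz
      have hz' : 0 < z - t := sub_pos.mpr hz
      refine ae_of_all _ fun k => ?_
      rw [norm_mul, Real.norm_of_nonneg NNReal.zero_le_coe]
      refine mul_le_mul_of_nonneg_left ?_ NNReal.zero_le_coe
      rw [norm_mul, norm_inv, Real.norm_of_nonneg hz'.le, inv_mul_le_iff₀ hz', Real.norm_eq_abs]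
      refine (abs_norm_sub_norm_le _ _).trans ?_
      rw [add_sub_cancel_left, norm_smul, Real.norm_of_nonneg hz'.le]
    · exact integrable_weight_mul_norm hw hN β
    · filter_upwards [horth, hz] with k hk hk'
      have := (tendsto_norm_add_smul_sub_norm_div hk hk' t).const_mul (w k : ℝ)
      rwa [mul_zero] at this
  have h4 := (h2.add h1).add_const (wreal w g)
  rw [add_zero, zero_add] at h4
  intro r hr
  filter_upwards [h4.eventually (gt_mem_nhds hr), self_mem_nhdsWithin] with z hz1 hz2
  have hz' : 0 < z - t := sub_pos.mpr hz2
  refine lt_of_le_of_lt ?_ hz1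
  -- First-order expansion. The last term is o(z - t) in L¹, hence also in the weighted norm because
  -- w is bounded by N.
  have hdec : f z = (f t + (z - t) • β) + ((z - t) • g + (z - t) • (slope f t z - (β + g))) := by
    rw [slope_def_module, smul_sub, smul_smul, mul_inv_cancel₀ hz'.ne']
    module
  have h5 : wreal w (f z) ≤ wreal w (f t + (z - t) • β : L1 d E)
      + ((z - t) * wreal w g + (z - t) * (N * ‖slope f t z - (β + g)‖)) := by
    rw [← wreal_smul hw hz'.le g]
    have e1 := wreal_add_le hw hN (f t + (z - t) • β)
      ((z - t) • g + (z - t) • (slope f t z - (β + g)))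
    have e2 := wreal_add_le hw hN ((z - t) • g) ((z - t) • (slope f t z - (β + g)))
    rw [wreal_smul hw hz'.le (slope f t z - (β + g))] at e2
    have e3 := mul_le_mul_of_nonneg_left (wreal_le_norm hw hN (slope f t z - (β + g))) hz'.le
    rw [← hdec] at e1
    linarith
  rw [inv_mul_le_iff₀ hz']
  have e4 : (z - t) * ((z - t)⁻¹ * (wreal w (f t + (z - t) • β : L1 d E) - wreal w (f t))
      + ↑N * ‖slope f t z - (β + g)‖ + wreal w g)
      = (wreal w (f t + (z - t) • β : L1 d E) - wreal w (f t))
        + (z - t) * (↑N * ‖slope f t z - (β + g)‖) + (z - t) * wreal w g := by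
    rw [mul_add, mul_add, mul_inv_cancel_left₀ hz'.ne']
  rw [e4]
  linarith

/-- Multiplication by a bounded operator-valued function on `L¹`. -/
theorem exists_mulOp {F : Type*} [NormedAddCommGroup F] [NormedSpace ℂ E] [NormedSpace ℂ F]
    {m : Space d → E →L[ℂ] F} (hm : AEStronglyMeasurable m) {C : ℝ} (hC : ∀ k, ‖m k‖ ≤ C) :
    ∃ Q : L1 d E →L[ℝ] L1 d F, ∀ f : L1 d E, Q f =ᵐ[volume] fun k => m k (f k) := by
  have hi : ∀ f : L1 d E, Integrable fun k => m k (f k) := fun f => by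
    have h1 : AEStronglyMeasurable (fun k => m k (f k)) := by
      have hc : Continuous fun q : (E →L[ℂ] F) × E => q.1 q.2 := by fun_prop
      exact hc.comp_aestronglyMeasurable (hm.prodMk (L1.integrable_coeFn f).1)
    refine ((L1.integrable_coeFn f).norm.const_mul C).mono' h1 (ae_of_all _ fun k => ?_)
    exact ((m k).le_opNorm _).trans (mul_le_mul_of_nonneg_right (hC k) (norm_nonneg _))
  refine ⟨LinearMap.mkContinuous
    { toFun := fun f => (hi f).toL1
      map_add' := fun f g => by
        rw [← Integrable.toL1_add, Integrable.toL1_eq_toL1_iff]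
        filter_upwards [Lp.coeFn_add f g] with k hk
        rw [hk, Pi.add_apply, map_add, Pi.add_apply]
      map_smul' := fun c f => by
        rw [RingHom.id_apply, ← Integrable.toL1_smul, Integrable.toL1_eq_toL1_iff]
        filter_upwards [Lp.coeFn_smul c f] with k hk
        rw [hk, Pi.smul_apply, ContinuousLinearMap.map_smul_of_tower] } C ?_,
    fun f => Integrable.coeFn_toL1 (hi f)⟩
  intro f
  change ‖(hi f).toL1‖ ≤ _
  rw [L1.norm_eq_integral_norm, L1.norm_eq_integral_norm, ← integral_const_mul]
  refine integral_mono_ae (L1.integrable_coeFn _).norm ((L1.integrable_coeFn f).norm.const_mul C) ?_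
  filter_upwards [Integrable.coeFn_toL1 (hi f)] with k hk
  rw [hk]
  exact ((m k).le_opNorm _).trans (mul_le_mul_of_nonneg_right (hC k) (norm_nonneg _))

end WeightedSlope

/-! ### Operators on L¹ that represent evaluation, matrices, conjugation and the trilinear map -/

section

variable {d n : ℕ}

theorem foldr_pderiv_single (l : Fin d) (s : ℕ) (f : Space d → Vec n) (L : List (Fin d))
    (hL : L.Nodup) :
    L.foldr (fun m g => (pderiv m)^[(Pi.single l s : Fin d → ℕ) m] g) f
      = if l ∈ L then (pderiv l)^[s] f else f := by
  induction L with
  | nil => simp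
  | cons m L ih =>
    rw [List.nodup_cons] at hL
    rw [List.foldr_cons, ih hL.2]
    by_cases h : m = l
    · subst h
      simp [hL.1]
    · simp [Ne.symm h]

theorem mderiv_single (l : Fin d) (s : ℕ) (f : Space d → Vec n) :
    mderiv (Pi.single l s) f = (pderiv l)^[s] f := by
  unfold mderiv
  rw [foldr_pderiv_single l s f _ (List.nodup_finRange d), if_pos (List.mem_finRange l)]

theorem mderiv_zero (f : Space d → Vec n) : mderiv 0 f = f := by
  unfold mderiv
  induction List.finRange d with
  | nil => rfl
  | cons m L ih => rw [List.foldr_cons, ih]; rfl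

theorem MemWs.memW {s : ℕ} {f : Space d → Vec n} (h : MemWs s f) : MemW f := by
  simpa [mderiv_zero] using h.2 0 (by simp)

theorem MemWs.memW_iterate_pderiv {s m : ℕ} {f : Space d → Vec n} (h : MemWs s f) (hm : m ≤ s)
    (l : Fin d) : MemW ((pderiv l)^[m] f) := by
  rw [← mderiv_single]
  exact h.2 _ (by simpa [Finset.sum_pi_single] using hm)

theorem MemWs.memW_pderiv {f : Space d → Vec n} (h : MemWs 1 f) (l : Fin d) :
    MemW (pderiv l f) :=
  h.memW_iterate_pderiv (m := 1) le_rfl l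

/-- The inverse Fourier transform at a point as a bounded linear map on `L¹`. -/
def invFourierL (x : Space d) : L1 d (Vec n) →L[ℝ] Vec n :=
  LinearMap.mkContinuous
    { toFun := fun f => invFourier f x
      map_add' := fun f g => by
        rw [← invFourier_add (L1.integrable_coeFn f) (L1.integrable_coeFn g)]
        exact invFourier_congr (Lp.coeFn_add f g) x
      map_smul' := fun c f => by
        have h := invFourier_clm ((c : ℂ) • ContinuousLinearMap.id ℂ (Vec n))
          (L1.integrable_coeFn f) x
        have e : ∀ v : Vec n, ((c : ℂ) • ContinuousLinearMap.id ℂ (Vec n)) v = c • v := fun v => by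
          simp
        rw [RingHom.id_apply, ← e (invFourier f x), ← h]
        refine invFourier_congr ?_ x
        filter_upwards [Lp.coeFn_smul c f] with k hk
        rw [hk, e, Pi.smul_apply] }
    (fourierConst d) (fun f => by
      rw [L1.norm_eq_integral_norm]
      exact norm_invFourier_le f x)

theorem invFourierL_apply (x : Space d) (f : L1 d (Vec n)) :
    invFourierL x f = invFourier f x := rfl

/-- The evaluations at points x are bounded functionals that separate L¹, so identities known
pointwise in x lift to L¹. -/
theorem eq_of_invFourierL_eq {f g : L1 d (Vec n)} (h : ∀ x, invFourierL x f = invFourierL x g) :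
    f = g :=
  Lp.ext (ae_eq_of_invFourier_eq (L1.integrable_coeFn f) (L1.integrable_coeFn g) h)

theorem invFourierL_hatL1 {f : Space d → Vec n} (h : MemW f) (x : Space d) :
    invFourierL x (hatL1 f) = f x := by
  rw [invFourierL_apply, invFourier_congr (coeFn_hatL1 f), h.eq_invFourier]

/-- The pointwise action of a linear map on `L¹`. -/
def mapL (B : Vec n →L[ℂ] Vec n) : L1 d (Vec n) →L[ℝ] L1 d (Vec n) :=
  (B.restrictScalars ℝ).compLpL 1 volume

theorem coeFn_mapL (B : Vec n →L[ℂ] Vec n) (f : L1 d (Vec n)) :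
    mapL B f =ᵐ[volume] fun k => B (f k) :=
  (B.restrictScalars ℝ).coeFn_compLpL f

theorem invFourierL_mapL (B : Vec n →L[ℂ] Vec n) (f : L1 d (Vec n)) (x : Space d) :
    invFourierL x (mapL B f) = B (invFourierL x f) := by
  rw [invFourierL_apply, invFourierL_apply, invFourier_congr (coeFn_mapL B f),
    invFourier_clm B (L1.integrable_coeFn f)]

/-- The action of complex conjugation on the Fourier side, `f ↦ conj f(-·)`. -/
def conjRefl : L1 d (Vec n) →L[ℝ] L1 d (Vec n) :=
  ((conjLI n).toContinuousLinearMap.compLpL 1 volume).comp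
    (Lp.compMeasurePreservingₗᵢ ℝ (fun k : Space d => -k)
      (Measure.measurePreserving_neg volume)).toContinuousLinearMap

theorem coeFn_conjRefl (f : L1 d (Vec n)) :
    conjRefl f =ᵐ[volume] fun k => conjVec (f (-k)) := by
  have hm := Measure.measurePreserving_neg (volume : Measure (Space d))
  have h1 := (conjLI n).toContinuousLinearMap.coeFn_compLpL
    (Lp.compMeasurePreserving (fun k : Space d => -k) hm f)
  filter_upwards [h1, Lp.coeFn_compMeasurePreserving f hm] with k hk hk'
  have : (conjRefl f : L1 d (Vec n)) k = conjVec
      ((Lp.compMeasurePreserving (fun k : Space d => -k) hm f : L1 d (Vec n)) k) := hk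
  rw [this, hk']
  rfl

theorem norm_conjVec (v : Vec n) : ‖conjVec v‖ = ‖v‖ := (conjLI n).norm_map v

theorem wnorm_conjRefl {w : Space d → ℝ≥0} (hw : ∀ k, w (-k) = w k) (f : L1 d (Vec n)) :
    wnorm w (conjRefl f) = wnorm w f := by
  have h : wnorm w (conjRefl f) = wnorm w fun k => f (-k) :=
    wnorm_congr_ae ((coeFn_conjRefl f).mono fun k hk => by rw [hk, norm_conjVec])
  rw [h]
  unfold wnorm
  rw [← lintegral_neg_eq_self (fun k => (w k : ℝ≥0∞) * ‖f k‖ₑ)]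
  simp only [hw]

theorem hatL1_conj {f g : Space d → Vec n} (hf : MemW f) (h : ∀ x, g x = conjVec (f x)) :
    hatL1 g = conjRefl (hatL1 f) := by
  have hg : g = fun x => conjVec (f x) := funext h
  have hF : IsFourier f (hat f) := ⟨integrable_hat f, hf.eq_invFourier⟩
  apply Lp.ext
  have hm := (Measure.measurePreserving_neg (volume : Measure (Space d))).quasiMeasurePreserving
  filter_upwards [coeFn_hatL1 g, coeFn_conjRefl (hatL1 f), hm.ae (coeFn_hatL1 f),
    (hg ▸ hF.conj).hat_ae_eq] with k h1 h2 h3 h4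
  rw [h1, h2, h4, h3]

/-- The matrix `L(α, β)` as a linear map. -/
def symL (A : Fin d → Matrix (Fin n) (Fin n) ℝ) (Em : Matrix (Fin n) (Fin n) ℝ)
    (α : ℝ) (β : Space d) : Vec n →L[ℂ] Vec n :=
  LinearMap.toContinuousLinearMap (Matrix.toEuclideanLin (symbolL A Em α β))

theorem symL_apply (A : Fin d → Matrix (Fin n) (Fin n) ℝ) (Em : Matrix (Fin n) (Fin n) ℝ)
    (α : ℝ) (β : Space d) (v : Vec n) :
    symL A Em α β v = Matrix.toEuclideanLin (symbolL A Em α β) v := rfl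

theorem symL_shift (A : Fin d → Matrix (Fin n) (Fin n) ℝ) (Em : Matrix (Fin n) (Fin n) ℝ)
    (α : ℝ) (β θ : Space d) (v : Vec n) :
    symL A Em α (β + θ) v = symL A Em α β v
      + ∑ l, ((θ l : ℝ) : ℂ) • Matrix.toEuclideanLin ((A l).map Complex.ofReal) v := by
  have h : symbolL A Em α (β + θ) = symbolL A Em α β
      + ∑ l, ((θ l : ℝ) : ℂ) • (A l).map Complex.ofReal := by
    unfold symbolL
    simp only [PiLp.add_apply, Complex.ofReal_add, add_smul, Finset.sum_add_distrib]
    abel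
  rw [symL_apply, symL_apply, h, map_add, LinearMap.add_apply, map_sum, LinearMap.sum_apply]
  simp only [map_smul, LinearMap.smul_apply]

theorem symL_zero (A : Fin d → Matrix (Fin n) (Fin n) ℝ) (Em : Matrix (Fin n) (Fin n) ℝ)
    (α : ℝ) (β : Space d) (v : Vec n) :
    symL A Em α β v = symL A Em 0 β v - (α : ℂ) • v := by
  have h : symbolL A Em α β = symbolL A Em 0 β - (α : ℂ) • 1 := by
    unfold symbolL
    simp only [Complex.ofReal_zero, neg_zero, zero_smul, zero_add, neg_smul]
    abel
  rw [symL_apply, symL_apply, h, map_sub, LinearMap.sub_apply, map_smul, LinearMap.smul_apply,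
    Matrix.toLpLin_one]
  rfl

/-- The complex trilinear extension `triExt T` as a bounded trilinear map. -/
def triL (T : (Fin n → ℝ) →ₗ[ℝ] (Fin n → ℝ) →ₗ[ℝ] (Fin n → ℝ) →ₗ[ℝ] (Fin n → ℝ)) :
    Vec n →L[ℂ] Vec n →L[ℂ] Vec n →L[ℂ] Vec n :=
  ∑ p, ∑ q, ∑ r, (EuclideanSpace.proj (𝕜 := ℂ) p).smulRight
    ((EuclideanSpace.proj (𝕜 := ℂ) q).smulRight
      ((EuclideanSpace.proj (𝕜 := ℂ) r).smulRight (WithLp.toLp 2 (fun i =>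
        ((T (Pi.single p 1) (Pi.single q 1) (Pi.single r 1) i : ℝ) : ℂ)) : Vec n)))

theorem triL_apply (T : (Fin n → ℝ) →ₗ[ℝ] (Fin n → ℝ) →ₗ[ℝ] (Fin n → ℝ) →ₗ[ℝ] (Fin n → ℝ))
    (a b c : Vec n) : triL T a b c = triExt T a b c := by
  unfold triL triExt
  simp only [sum_apply, ContinuousLinearMap.smulRight_apply, smul_apply, smul_smul]
  rfl

end

/-! ### The evolution equation for the Fourier transforms -/

section

variable {d n : ℕ}

/-- The Fourier transform of the nonlinearity. -/
def nonlin (T : (Fin n → ℝ) →ₗ[ℝ] (Fin n → ℝ) →ₗ[ℝ] (Fin n → ℝ) →ₗ[ℝ] (Fin n → ℝ))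
    (j : ℤ) (a : ℤ → L1 d (Vec n)) : L1 d (Vec n) :=
  fourierConst d ^ 2 • ∑ J ∈ triples j, conv3 (triL T) (a J.1) (a J.2.1) (a J.2.2)

/-- The evolution of the Fourier transforms `a_j = û_j` in `L¹`. -/
structure Evolution (A : Fin d → Matrix (Fin n) (Fin n) ℝ) (Em : Matrix (Fin n) (Fin n) ℝ)
    (T : (Fin n → ℝ) →ₗ[ℝ] (Fin n → ℝ) →ₗ[ℝ] (Fin n → ℝ) →ₗ[ℝ] (Fin n → ℝ))
    (ω : ℝ) (κ : Space d) (ε τ : ℝ) (a : ℤ → ℝ → L1 d (Vec n)) : Prop where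
  conj : ∀ j ∈ ({1, 3} : Finset ℤ), ∀ t ∈ Icc 0 τ, a (-j) t = conjRefl (a j t)
  deriv : ∀ j ∈ ({1, 3} : Finset ℤ), ∀ t ∈ Icc 0 τ, ∃ β : L1 d (Vec n),
    (∀ᵐ k, β k = -((Complex.I / (ε : ℂ)) •
      symL A Em ((j : ℝ) * ω) ((j : ℝ) • κ + ε • k) (a j t k))) ∧
    HasDerivWithinAt (a j) (β + ε • nonlin T j fun i => a i t) (Icc 0 τ) t

theorem mem_harmonics_of_mem_triples {j : ℤ} {J : ℤ × ℤ × ℤ} (h : J ∈ triples j) :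
    J.1 ∈ harmonics ∧ J.2.1 ∈ harmonics ∧ J.2.2 ∈ harmonics := by
  simpa [triples, and_assoc] using (Finset.mem_filter.mp h).1

theorem cases_of_mem_harmonics {j : ℤ} (h : j ∈ harmonics) :
    ∃ i ∈ ({1, 3} : Finset ℤ), j = i ∨ j = -i := by
  simp only [harmonics, Finset.mem_insert, Finset.mem_singleton] at h
  rcases h with h | h | h | h
  · exact ⟨1, by simp, Or.inl h⟩
  · exact ⟨1, by simp, Or.inr h⟩
  · exact ⟨3, by simp, Or.inl h⟩
  · exact ⟨3, by simp, Or.inr h⟩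

theorem invFourierL_nonlin
    (T : (Fin n → ℝ) →ₗ[ℝ] (Fin n → ℝ) →ₗ[ℝ] (Fin n → ℝ) →ₗ[ℝ] (Fin n → ℝ))
    (j : ℤ) (a : ℤ → L1 d (Vec n)) (x : Space d) :
    invFourierL x (nonlin T j a) = ∑ J ∈ triples j,
      triExt T (invFourierL x (a J.1)) (invFourierL x (a J.2.1)) (invFourierL x (a J.2.2)) := by
  unfold nonlin
  rw [map_smul, map_sum, Finset.smul_sum]
  refine Finset.sum_congr rfl fun J _ => ?_
  rw [← triL_apply]
  simp only [invFourierL_apply]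
  rw [invFourier_conv3]

theorem continuousOn_nonlin
    (T : (Fin n → ℝ) →ₗ[ℝ] (Fin n → ℝ) →ₗ[ℝ] (Fin n → ℝ) →ₗ[ℝ] (Fin n → ℝ))
    (j : ℤ) {a : ℤ → ℝ → L1 d (Vec n)} {s : Set ℝ} (h : ∀ i ∈ harmonics, ContinuousOn (a i) s) :
    ContinuousOn (fun t => nonlin T j fun i => a i t) s := by
  unfold nonlin
  have h : ContinuousOn (fun t => ∑ J ∈ triples j,
      conv3 (triL T) (a J.1 t) (a J.2.1 t) (a J.2.2 t)) s := by
    refine continuousOn_finsetSum _ fun J hJ => ?_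
    obtain ⟨h1, h2, h3⟩ := mem_harmonics_of_mem_triples hJ
    exact continuousOn_conv3 _ (h _ h1) (h _ h2) (h _ h3)
  exact h.const_smul (fourierConst d ^ 2)

/-- The linear part of the right-hand side, before the derivatives are replaced by multipliers. -/
def linPart (A : Fin d → Matrix (Fin n) (Fin n) ℝ) (Em : Matrix (Fin n) (Fin n) ℝ)
    (α ε : ℝ) (β : Space d) (f : Space d → Vec n) : L1 d (Vec n) :=
  mapL (-(Complex.I / (ε : ℂ)) • symL A Em α β) (hatL1 f)
    - ∑ l, mapL (LinearMap.toContinuousLinearMap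
        (Matrix.toEuclideanLin ((A l).map Complex.ofReal))) (hatL1 (pderiv l f))

/-- ∂_l becomes ik_l, and the symbol is affine in its second argument: (i/ε)L(α,β) + iA(k) =
(i/ε)L(α, β + εk). -/
theorem coeFn_linPart (A : Fin d → Matrix (Fin n) (Fin n) ℝ) (Em : Matrix (Fin n) (Fin n) ℝ)
    (α : ℝ) {ε : ℝ} (hε : 0 < ε) (β : Space d) {f : Space d → Vec n} (hM : MemWs 1 f) :
    ∀ᵐ k, linPart A Em α ε β f k
      = -((Complex.I / (ε : ℂ)) • symL A Em α (β + ε • k) (hatL1 f k)) := by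
  have hp : ∀ᵐ k, ∀ l, hatL1 (pderiv l f) k = (Complex.I * ((k l : ℝ) : ℂ)) • hatL1 f k := by
    rw [ae_all_iff]
    intro l
    filter_upwards [coeFn_hatL1 (pderiv l f), coeFn_hatL1 f,
      hat_pderiv (by simpa using hM.1) hM.memW l (hM.memW_pderiv l)] with k h1 h2 h3
    rw [h1, h2, h3]
  have hs : ∀ᵐ k, ∀ l, mapL (LinearMap.toContinuousLinearMap
      (Matrix.toEuclideanLin ((A l).map Complex.ofReal))) (hatL1 (pderiv l f)) k
      = Matrix.toEuclideanLin ((A l).map Complex.ofReal) (hatL1 (pderiv l f) k) := by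
    rw [ae_all_iff]
    exact fun l => coeFn_mapL _ _
  have h3 := Lp.coeFn_sub (mapL (-(Complex.I / (ε : ℂ)) • symL A Em α β) (hatL1 f))
    (∑ l, mapL (LinearMap.toContinuousLinearMap
      (Matrix.toEuclideanLin ((A l).map Complex.ofReal))) (hatL1 (pderiv l f)))
  have h4 := coeFn_mapL (-(Complex.I / (ε : ℂ)) • symL A Em α β) (hatL1 f)
  have h5 := Lp.coeFn_finsetSum Finset.univ (fun l => mapL (LinearMap.toContinuousLinearMap
      (Matrix.toEuclideanLin ((A l).map Complex.ofReal))) (hatL1 (pderiv l f)))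
  filter_upwards [hp, hs, h3, h4, h5] with k h1 h2 h3 h4 h5
  unfold linPart
  rw [h3, Pi.sub_apply, h4, h5, Finset.sum_apply, symL_shift, smul_apply, smul_add, neg_smul,
    neg_add, sub_eq_add_neg]
  congr 2
  rw [Finset.smul_sum]
  refine Finset.sum_congr rfl fun l _ => ?_
  rw [h2, h1, map_smul, PiLp.smul_apply, smul_smul]
  congr 1
  have : (ε : ℂ) ≠ 0 := by exact_mod_cast hε.ne'
  push_cast [smul_eq_mul]
  field_simp

/-- The time derivative exists in L¹ by assumption, while the equation is known pointwise in x.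
Applying the evaluation functionals to the L¹ derivative and comparing with the equation identifies
the two. -/
theorem IsClassicalSolution.evolution {A : Fin d → Matrix (Fin n) (Fin n) ℝ}
    {Em : Matrix (Fin n) (Fin n) ℝ}
    {T : (Fin n → ℝ) →ₗ[ℝ] (Fin n → ℝ) →ₗ[ℝ] (Fin n → ℝ) →ₗ[ℝ] (Fin n → ℝ)}
    {ω : ℝ} {κ : Space d} {ε τ : ℝ} (hε : 0 < ε) (hτ : 0 < τ) {p : Space d → Vec n}
    {u : ℤ → ℝ → Space d → Vec n} (hu : IsClassicalSolution A Em T ω κ ε τ p u) :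
    Evolution A Em T ω κ ε τ fun j t => hatL1 (u j t) := by
  have hconj : ∀ j ∈ ({1, 3} : Finset ℤ), ∀ t ∈ Icc 0 τ,
      hatL1 (u (-j) t) = conjRefl (hatL1 (u j t)) := fun j hj t ht =>
    hatL1_conj (hu.memW1 j hj t ht).memW (hu.conj j hj t ht)
  have hcont : ∀ i ∈ harmonics, ContinuousOn (fun t => hatL1 (u i t)) (Icc 0 τ) := by
    intro i hi
    obtain ⟨j, hj, rfl | rfl⟩ := cases_of_mem_harmonics hi
    · exact (hu.contDiff_W _ hj).continuousOn
    · exact (conjRefl.continuous.comp_continuousOn (hu.contDiff_W j hj).continuousOn).congr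
        fun t ht => hconj j hj t ht
  have hmem : ∀ i ∈ harmonics, ∀ t ∈ Icc 0 τ, ∀ x, invFourierL x (hatL1 (u i t)) = u i t x := by
    intro i hi t ht x
    obtain ⟨j, hj, rfl | rfl⟩ := cases_of_mem_harmonics hi
    · exact invFourierL_hatL1 (hu.memW1 _ hj t ht).memW x
    · refine invFourierL_hatL1 ?_ x
      have hF : IsFourier (u j t) (hat (u j t)) :=
        ⟨integrable_hat _, (hu.memW1 j hj t ht).memW.eq_invFourier⟩
      rw [show u (-j) t = fun x => conjVec (u j t x) from funext (hu.conj j hj t ht)]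
      exact ⟨_, hF.conj⟩
  have hUD : UniqueDiffOn ℝ (Icc 0 τ) := uniqueDiffOn_Icc hτ
  have hsub : ({1, 3} : Finset ℤ) ⊆ harmonics := by decide
  refine ⟨hconj, fun j hj => ?_⟩
  set B : ℝ → L1 d (Vec n) := fun t =>
    linPart A Em ((j : ℝ) * ω) ε ((j : ℝ) • κ) (u j t) with hB
  set R : ℝ → L1 d (Vec n) := fun t => B t + ε • nonlin T j fun i => hatL1 (u i t) with hR
  have hpc : ∀ l, ContinuousOn (fun t => hatL1 (pderiv l (u j t))) (Icc 0 τ) := by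
    intro l
    have := hu.continuous_W1 j hj (Pi.single l 1) (by simp)
    simpa only [mderiv_single, Function.iterate_one] using this
  have hRc : ContinuousOn R (Icc 0 τ) := by
    refine ContinuousOn.add (ContinuousOn.sub ?_ ?_) ?_
    · exact (mapL _).continuous.comp_continuousOn (hcont j (hsub hj))
    · exact continuousOn_finsetSum _ fun l _ => (mapL _).continuous.comp_continuousOn (hpc l)
    · exact (continuousOn_nonlin T j hcont).const_smul ε
  have hV : ∀ t ∈ Icc 0 τ, HasDerivWithinAt (fun t => hatL1 (u j t))
      (derivWithin (fun t => hatL1 (u j t)) (Icc 0 τ) t) (Icc 0 τ) t := fun t ht =>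
    (((hu.contDiff_W j hj).differentiableOn one_ne_zero) t ht).hasDerivWithinAt
  have hVc : ContinuousOn (derivWithin (fun t => hatL1 (u j t)) (Icc 0 τ)) (Icc 0 τ) :=
    (hu.contDiff_W j hj).continuousOn_derivWithin hUD le_rfl
  have heq : EqOn (derivWithin (fun t => hatL1 (u j t)) (Icc 0 τ)) R (Ioc 0 τ) := by
    intro t ht
    have ht' : t ∈ Icc 0 τ := Ioc_subset_Icc_self ht
    refine eq_of_invFourierL_eq fun x => ?_
    have h1 := (invFourierL x).hasFDerivAt.comp_hasDerivWithinAt t (hV t ht')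
    have h2 : HasDerivWithinAt (fun s => u j s x) _ (Icc 0 τ) t :=
      h1.congr (fun s hs => (hmem j (hsub hj) s hs x).symm) (hmem j (hsub hj) t ht' x).symm
    have h3 := (hUD t ht').eq_deriv _ h2 (hu.pde j hj t ht x)
    rw [h3, hR, hB]
    simp only [linPart, map_add, map_sub, map_sum, map_smul, invFourierL_mapL, invFourierL_nonlin]
    rw [hmem j (hsub hj) t ht' x]
    have e1 : ∀ l, invFourierL x (hatL1 (pderiv l (u j t))) = pderiv l (u j t) x := fun l =>
      invFourierL_hatL1 ((hu.memW1 j hj t ht').memW_pderiv l) x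
    have e2 : ∀ J ∈ triples j, triExt T (invFourierL x (hatL1 (u J.1 t)))
        (invFourierL x (hatL1 (u J.2.1 t))) (invFourierL x (hatL1 (u J.2.2 t)))
        = triExt T (u J.1 t x) (u J.2.1 t x) (u J.2.2 t x) := by
      intro J hJ
      obtain ⟨m1, m2, m3⟩ := mem_harmonics_of_mem_triples hJ
      rw [hmem _ m1 t ht' x, hmem _ m2 t ht' x, hmem _ m3 t ht' x]
    rw [Finset.sum_congr rfl e2]
    simp only [e1]
    rw [smul_apply, neg_smul, Complex.coe_smul]
    rfl
  -- The equation is assumed for t > 0 only; both sides are continuous in L¹ on the closed interval,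
  -- so it extends to t = 0.
  have heq' : EqOn (derivWithin (fun t => hatL1 (u j t)) (Icc 0 τ)) R (Icc 0 τ) := by
    refine heq.of_subset_closure hVc hRc Ioc_subset_Icc_self ?_
    rw [closure_Ioc hτ.ne]
  intro t ht
  refine ⟨B t, ?_, ?_⟩
  · exact coeFn_linPart A Em _ hε _ (hu.memW1 j hj t ht)
  · have := hV t ht
    rw [heq' ht] at this
    exact this

end

/-! ### Estimates of the nonlinearity and of its time derivative -/

section

variable {d n : ℕ}

section WeightedL1

variable {E : Type*} [NormedAddCommGroup E]

theorem wnorm_coe_add_le {w : Space d → ℝ≥0} (hw : Measurable w) (f g : L1 d E) :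
    wnorm w (f + g : L1 d E) ≤ wnorm w f + wnorm w g := by
  rw [wnorm_congr_ae ((Lp.coeFn_add f g).mono fun k hk => by rw [hk])]
  exact wnorm_add_le hw (L1.integrable_coeFn f).1 _

theorem wnorm_coe_sum_le {ι : Type*} (s : Finset ι) {w : Space d → ℝ≥0} (hw : Measurable w)
    (f : ι → L1 d E) : wnorm w (∑ i ∈ s, f i : L1 d E) ≤ ∑ i ∈ s, wnorm w (f i) := by
  rw [wnorm_congr_ae ((Lp.coeFn_finsetSum s f).mono fun k hk => by rw [hk, Finset.sum_apply])]
  exact wnorm_sum_le s hw fun i _ => (L1.integrable_coeFn (f i)).1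

theorem wnorm_coe_smul_le {𝕜 : Type*} [NormedRing 𝕜] [Module 𝕜 E] [IsBoundedSMul 𝕜 E]
    (w : Space d → ℝ≥0) (c : 𝕜) (f : L1 d E) :
    wnorm w (c • f : L1 d E) ≤ ENNReal.ofReal ‖c‖ * wnorm w f := by
  have h := wnorm_le_of_ae (w := w) (w' := w) (f := (c • f : L1 d E)) (g := f) ‖c‖₊ (by
    filter_upwards [Lp.coeFn_smul c f] with k hk
    rw [hk, Pi.smul_apply, coe_nnnorm, mul_left_comm]
    exact mul_le_mul_of_nonneg_left (norm_smul_le _ _) NNReal.zero_le_coe)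
  rwa [← ENNReal.ofReal_coe_nnreal, coe_nnnorm] at h

theorem wreal_le_of_wnorm_le {w : Space d → ℝ≥0} {f : Space d → E} {X : ℝ} (hX : 0 ≤ X)
    (h : wnorm w f ≤ ENNReal.ofReal X) : wreal w f ≤ X :=
  ENNReal.toReal_le_of_le_ofReal hX h

theorem wnorm_le_of_wreal_le {w : Space d → ℝ≥0} {N : ℝ≥0} (hN : ∀ k, w k ≤ N) {f : L1 d E}
    {X : ℝ} (h : wreal w f ≤ X) : wnorm w f ≤ ENNReal.ofReal X := by
  rw [← ofReal_wreal hN]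
  exact ENNReal.ofReal_le_ofReal h

end WeightedL1

section Nonlinearity

variable (T : (Fin n → ℝ) →ₗ[ℝ] (Fin n → ℝ) →ₗ[ℝ] (Fin n → ℝ) →ₗ[ℝ] (Fin n → ℝ))

/-- The constant in the estimates of the nonlinearity. -/
def nonlinConst (d : ℕ) : ℝ := fourierConst d ^ 2 * 64 * ‖triL T‖

theorem nonlinConst_nonneg : 0 ≤ nonlinConst T d := by
  unfold nonlinConst; positivity

/-- `64 = 4 ^ 3` counts all triples of harmonics; the exact number with a given sum does not matter.
-/
theorem card_triples_le (j : ℤ) : (triples j).card ≤ 64 :=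
  (Finset.card_filter_le _ _).trans (by decide)

theorem wnorm_smul_sum_triples_le {w : Space d → ℝ≥0} (hw : Measurable w) (j : ℤ)
    {f : ℤ × ℤ × ℤ → L1 d (Vec n)} {X : ℝ}
    (h : ∀ J ∈ triples j, wnorm w (f J) ≤ ‖triL T‖ₑ * ENNReal.ofReal X) :
    wnorm w (fourierConst d ^ 2 • ∑ J ∈ triples j, f J : L1 d (Vec n))
      ≤ ENNReal.ofReal (nonlinConst T d * X) := by
  have h1 := wnorm_coe_smul_le w (fourierConst d ^ 2) (∑ J ∈ triples j, f J)
  refine h1.trans ?_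
  rw [Real.norm_of_nonneg (by positivity)]
  have h2 : wnorm w (∑ J ∈ triples j, f J : L1 d (Vec n))
      ≤ ENNReal.ofReal (64 * (‖triL T‖ * X)) := by
    calc _ ≤ ∑ J ∈ triples j, wnorm w (f J) := wnorm_coe_sum_le _ hw _
      _ ≤ ∑ J ∈ triples j, ENNReal.ofReal (‖triL T‖ * X) := by
        refine Finset.sum_le_sum fun J hJ => (h J hJ).trans ?_
        rw [← ofReal_norm, ENNReal.ofReal_mul (norm_nonneg _)]
      _ = (triples j).card * ENNReal.ofReal (‖triL T‖ * X) := by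
        rw [Finset.sum_const, nsmul_eq_mul]
      _ ≤ ENNReal.ofReal 64 * ENNReal.ofReal (‖triL T‖ * X) := by
        gcongr
        rw [ENNReal.ofReal_ofNat]
        exact_mod_cast card_triples_le j
      _ = _ := by rw [← ENNReal.ofReal_mul (by norm_num)]
  refine (mul_le_mul_right h2 _).trans (le_of_eq ?_)
  rw [← ENNReal.ofReal_mul (by positivity)]
  congr 1
  unfold nonlinConst
  ring

theorem wnorm_nonlin_le_mul {w : Space d → ℝ≥0} (hw : Measurable w)
    (hmul : ∀ x y, w (x + y) ≤ w x * w y) (j : ℤ) {a : ℤ → L1 d (Vec n)} {B : ℝ} (hB : 0 ≤ B)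
    (ha : ∀ i ∈ harmonics, wnorm w (a i) ≤ ENNReal.ofReal B) :
    wnorm w (nonlin T j a) ≤ ENNReal.ofReal (nonlinConst T d * B ^ 3) := by
  refine wnorm_smul_sum_triples_le T hw j fun J hJ => ?_
  obtain ⟨h1, h2, h3⟩ := mem_harmonics_of_mem_triples hJ
  refine (wnorm_conv3_le_mul _ hw hmul _ _ _).trans ?_
  rw [show B ^ 3 = B * B * B by ring, ENNReal.ofReal_mul (by positivity), ENNReal.ofReal_mul hB]
  gcongr
  exacts [ha _ h1, ha _ h2, ha _ h3]

theorem wnorm_nonlin_le_add {w : Space d → ℝ≥0} (hw : Measurable w) {K : ℝ≥0} (hK : 1 ≤ K)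
    (hadd : ∀ x y, w (x + y) ≤ K * (w x + w y)) (j : ℤ) {a : ℤ → L1 d (Vec n)} {B X : ℝ}
    (hB : 0 ≤ B) (ha : ∀ i ∈ harmonics, wnorm 1 (a i) ≤ ENNReal.ofReal B)
    (ha' : ∀ i ∈ harmonics, wnorm w (a i) ≤ ENNReal.ofReal X) :
    wnorm w (nonlin T j a) ≤ ENNReal.ofReal (nonlinConst T d * (K ^ 2 * (3 * B ^ 2 * X))) := by
  refine wnorm_smul_sum_triples_le T hw j fun J hJ => ?_
  obtain ⟨h1, h2, h3⟩ := mem_harmonics_of_mem_triples hJ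
  refine (wnorm_conv3_le_add _ hw hK hadd _ _ _).trans ?_
  have e : ENNReal.ofReal (K ^ 2 * (3 * B ^ 2 * X)) = (K : ℝ≥0∞) ^ 2 *
      (ENNReal.ofReal X * ENNReal.ofReal B * ENNReal.ofReal B
        + ENNReal.ofReal B * ENNReal.ofReal X * ENNReal.ofReal B
        + ENNReal.ofReal B * ENNReal.ofReal B * ENNReal.ofReal X) := by
    rw [ENNReal.ofReal_mul (by positivity), ENNReal.ofReal_pow NNReal.zero_le_coe,
      ENNReal.ofReal_coe_nnreal, ENNReal.ofReal_mul (by positivity),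
      ENNReal.ofReal_mul (by positivity), ENNReal.ofReal_pow hB, ENNReal.ofReal_ofNat]
    ring
  rw [e, mul_assoc]
  gcongr
  exacts [ha' _ h1, ha _ h2, ha _ h3, ha _ h1, ha' _ h2, ha _ h3, ha _ h1, ha _ h2, ha' _ h3]

/-- The product rule gives three terms, whence the factor 3. The derivative is chosen before the
weight, so that one `F'` serves all weights. -/
theorem exists_hasDerivWithinAt_nonlin (j : ℤ) {a : ℤ → ℝ → L1 d (Vec n)} {a' : ℤ → L1 d (Vec n)}
    {s : Set ℝ} {t : ℝ} (h : ∀ i ∈ harmonics, HasDerivWithinAt (a i) (a' i) s t) :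
    ∃ F' : L1 d (Vec n), HasDerivWithinAt (fun x => nonlin T j fun i => a i x) F' s t ∧
      ∀ w : Space d → ℝ≥0, Measurable w → (∀ x y, w (x + y) ≤ w x * w y) → ∀ B D : ℝ, 0 ≤ B →
        0 ≤ D → (∀ i ∈ harmonics, wnorm w (a i t) ≤ ENNReal.ofReal B) →
        (∀ i ∈ harmonics, wnorm w (a' i) ≤ ENNReal.ofReal D) →
        wnorm w F' ≤ ENNReal.ofReal (nonlinConst T d * (3 * B ^ 2 * D)) := by
  refine ⟨_, HasDerivWithinAt.const_smul (fourierConst d ^ 2)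
    (HasDerivWithinAt.fun_sum (u := triples j)
      (A := fun J x => conv3 (triL T) (a J.1 x) (a J.2.1 x) (a J.2.2 x))
      (A' := fun J => conv3 (triL T) (a J.1 t) (a J.2.1 t) (a' J.2.2)
        + (conv3 (triL T) (a J.1 t) (a' J.2.1) (a J.2.2 t)
        + conv3 (triL T) (a' J.1) (a J.2.1 t) (a J.2.2 t)))
      (fun J hJ => ?_)), ?_⟩
  · obtain ⟨h1, h2, h3⟩ := mem_harmonics_of_mem_triples hJ
    exact hasDerivWithinAt_conv3 _ (h _ h1) (h _ h2) (h _ h3)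
  · intro w hw hmul B D hB hD ha ha'
    refine wnorm_smul_sum_triples_le T hw j fun J hJ => ?_
    obtain ⟨h1, h2, h3⟩ := mem_harmonics_of_mem_triples hJ
    have e : ENNReal.ofReal (3 * B ^ 2 * D) =
      ENNReal.ofReal B * ENNReal.ofReal B * ENNReal.ofReal D
        + (ENNReal.ofReal B * ENNReal.ofReal D * ENNReal.ofReal B
        + ENNReal.ofReal D * ENNReal.ofReal B * ENNReal.ofReal B) := by
      rw [ENNReal.ofReal_mul (by positivity), ENNReal.ofReal_mul (by positivity),
        ENNReal.ofReal_pow hB, ENNReal.ofReal_ofNat]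
      ring
    rw [e, mul_add, mul_add]
    refine (wnorm_coe_add_le hw _ _).trans (add_le_add ?_
      ((wnorm_coe_add_le hw _ _).trans (add_le_add ?_ ?_)))
    · refine (wnorm_conv3_le_mul _ hw hmul _ _ _).trans ?_
      gcongr
      exacts [ha _ h1, ha _ h2, ha' _ h3]
    · refine (wnorm_conv3_le_mul _ hw hmul _ _ _).trans ?_
      gcongr
      exacts [ha _ h1, ha' _ h2, ha _ h3]
    · refine (wnorm_conv3_le_mul _ hw hmul _ _ _).trans ?_
      gcongr
      exacts [ha' _ h1, ha _ h2, ha _ h3]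

end Nonlinearity

/-! ### Skew-symmetry of the linear part and growth of the L¹ norm -/

section GrowthOfNorms

variable {A : Fin d → Matrix (Fin n) (Fin n) ℝ} {Em : Matrix (Fin n) (Fin n) ℝ}
  {T : (Fin n → ℝ) →ₗ[ℝ] (Fin n → ℝ) →ₗ[ℝ] (Fin n → ℝ) →ₗ[ℝ] (Fin n → ℝ)}
  {ω : ℝ} {κ : Space d} {ε τ : ℝ} {a : ℤ → ℝ → L1 d (Vec n)}

/-- A(β) is real symmetric, and -iE is Hermitian because E is real and skew-symmetric. -/
theorem symL_isSymmetric (hA : ∀ l, (A l).IsSymm) (hE : Em.transpose = -Em) (α : ℝ) (β : Space d)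
    (v w : Vec n) : inner ℂ (symL A Em α β v) w = inner ℂ v (symL A Em α β w) := by
  have h : (symbolL A Em α β).IsHermitian := by
    ext i j
    have h1 : ∀ l, A l j i = A l i j := fun l => (hA l).apply i j
    have h2 : Em j i = -Em i j := congrFun (congrFun hE i) j
    simp only [symbolL, Matrix.conjTranspose_apply, Matrix.sub_apply, Matrix.add_apply,
      Matrix.smul_apply, Matrix.sum_apply, Matrix.map_apply, smul_eq_mul, star_sub, star_add,
      star_mul', star_neg, Complex.star_def, Complex.conj_ofReal, Complex.conj_I, h1, h2,
      star_sum, Matrix.one_apply, apply_ite (starRingEnd ℂ), map_one, map_zero,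
      eq_comm (a := i) (b := j)]
    push_cast
    ring_nf
  exact (Matrix.isSymmetric_toEuclideanLin_iff.mpr h) v w

/-- A Hermitian form is real on the diagonal and becomes imaginary after multiplication by i/ε. This
orthogonality removes the term of size 1/ε from the growth of `û_j`. -/
theorem re_inner_neg_smul_symL (hA : ∀ l, (A l).IsSymm) (hE : Em.transpose = -Em) (α ε : ℝ)
    (β : Space d) (v : Vec n) :
    RCLike.re (inner ℂ v (-((Complex.I / (ε : ℂ)) • symL A Em α β v))) = 0 := by
  have h1 : (starRingEnd ℂ) (inner ℂ v (symL A Em α β v)) = inner ℂ v (symL A Em α β v) := by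
    rw [inner_conj_symm, symL_isSymmetric hA hE]
  obtain ⟨r, hr⟩ := Complex.conj_eq_iff_real.mp h1
  rw [inner_neg_right, inner_smul_right, hr]
  have : Complex.I / (ε : ℂ) * (r : ℂ) = Complex.I * ((r / ε : ℝ) : ℂ) := by push_cast; ring
  rw [this]
  simp

theorem Evolution.mono {τ' : ℝ} (h : Evolution A Em T ω κ ε τ a) (hτ : τ' ≤ τ) :
    Evolution A Em T ω κ ε τ' a where
  conj j hj t ht := h.conj j hj t ⟨ht.1, ht.2.trans hτ⟩
  deriv j hj t ht := by
    obtain ⟨β, h1, h2⟩ := h.deriv j hj t ⟨ht.1, ht.2.trans hτ⟩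
    exact ⟨β, h1, h2.mono (Icc_subset_Icc_right hτ)⟩

theorem Evolution.continuousOn (h : Evolution A Em T ω κ ε τ a) {j : ℤ}
    (hj : j ∈ ({1, 3} : Finset ℤ)) : ContinuousOn (a j) (Icc 0 τ) := fun t ht => by
  obtain ⟨β, -, h2⟩ := h.deriv j hj t ht
  exact h2.continuousWithinAt

theorem Evolution.wnorm_le (h : Evolution A Em T ω κ ε τ a) {w : Space d → ℝ≥0}
    (hw : ∀ k, w (-k) = w k) {t : ℝ} (ht : t ∈ Icc 0 τ) {C : ℝ≥0∞}
    (hC : ∀ j ∈ ({1, 3} : Finset ℤ), wnorm w (a j t) ≤ C) :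
    ∀ i ∈ harmonics, wnorm w (a i t) ≤ C := by
  intro i hi
  obtain ⟨j, hj, rfl | rfl⟩ := cases_of_mem_harmonics hi
  · exact hC _ hj
  · rw [h.conj j hj t ht, wnorm_conjRefl hw]
    exact hC _ hj

theorem _root_.HasDerivWithinAt.Ici_of_Icc {F : Type*} [NormedAddCommGroup F] [NormedSpace ℝ F]
    {f : ℝ → F} {f' : F} {t τ : ℝ} (h : HasDerivWithinAt f f' (Icc 0 τ) t) (ht : t ∈ Ico 0 τ) :
    HasDerivWithinAt f f' (Ici t) t :=
  h.mono_of_mem_nhdsWithin (Filter.mem_of_superset (Icc_mem_nhdsGE ht.2) (Icc_subset_Icc_left ht.1))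

theorem Evolution.rightSlopeLE (hA : ∀ l, (A l).IsSymm) (hE : Em.transpose = -Em) (hε : 0 < ε)
    (h : Evolution A Em T ω κ ε τ a) {w : Space d → ℝ≥0} (hw : Measurable w) {N : ℝ≥0}
    (hN : ∀ k, w k ≤ N) {j : ℤ} (hj : j ∈ ({1, 3} : Finset ℤ)) {t : ℝ} (ht : t ∈ Ico 0 τ) {X : ℝ}
    (hX : 0 ≤ X) (hF : wnorm w (nonlin T j fun i => a i t) ≤ ENNReal.ofReal X) :
    RightSlopeLE (fun s => wreal w (a j s)) (ε * X) t := by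
  obtain ⟨β, hβ, hd⟩ := h.deriv j hj t ⟨ht.1, ht.2.le⟩
  refine (rightSlopeLE_wreal hw hN (hd.Ici_of_Icc ht) ?_ ?_).mono ?_
  · filter_upwards [hβ] with k hk
    rw [hk]
    exact re_inner_neg_smul_symL hA hE _ _ _ _
  · filter_upwards [hβ] with k hk h0
    rw [hk, h0, map_zero, smul_zero, neg_zero]
  · rw [wreal_smul hw hε.le]
    exact mul_le_mul_of_nonneg_left (wreal_le_of_wnorm_le hX hF) hε.le

theorem Evolution.continuousOn_wreal (h : Evolution A Em T ω κ ε τ a) {w : Space d → ℝ≥0}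
    (hw : Measurable w) {N : ℝ≥0} (hN : ∀ k, w k ≤ N) {j : ℤ} (hj : j ∈ ({1, 3} : Finset ℤ)) :
    ContinuousOn (fun t => wreal w (a j t)) (Icc 0 τ) :=
  (continuous_wreal hw hN).comp_continuousOn (h.continuousOn hj)

/-- On time intervals of length `O(1/ε)` the `L¹` norm at most doubles. -/
theorem exists_time_wnorm_le (hA : ∀ l, (A l).IsSymm) (hE : Em.transpose = -Em)
    (T : (Fin n → ℝ) →ₗ[ℝ] (Fin n → ℝ) →ₗ[ℝ] (Fin n → ℝ) →ₗ[ℝ] (Fin n → ℝ)) (ω : ℝ) (κ : Space d)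
    {tend : ℝ} (htend : 0 < tend) {B : ℝ} (hB : 0 < B) :
    ∃ tstar ∈ Ioc 0 tend, ∀ ε : ℝ, 0 < ε → ∀ a : ℤ → ℝ → L1 d (Vec n),
      Evolution A Em T ω κ ε (tstar / ε) a → wnorm 1 (a 1 0) ≤ ENNReal.ofReal B → a 3 0 = 0 →
      ∀ t ∈ Icc 0 (tstar / ε), ∀ j ∈ ({1, 3} : Finset ℤ),
        wnorm 1 (a j t) ≤ ENNReal.ofReal (2 * B) := by
  -- As long as the sum of the two norms is at most 2B, its slope is at most ε(K₀ - 1); the extra 1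
  -- makes the comparison strict. The line B + εK₀s stays below 2B while εs ≤ B/K₀, which dictates
  -- the choice of `tstar`.
  set K₀ : ℝ := 2 * (nonlinConst T d * (2 * B) ^ 3) + 1 with hK₀
  have hc := nonlinConst_nonneg (d := d) T
  have hK₀pos : 0 < K₀ := by positivity
  refine ⟨min tend (B / K₀), ⟨lt_min htend (by positivity), min_le_left _ _⟩, ?_⟩
  intro ε hε a ha h1 h3 t ht
  have hN : ∀ k : Space d, (1 : Space d → ℝ≥0) k ≤ 1 := fun k => le_rfl
  have hw : Measurable (1 : Space d → ℝ≥0) := measurable_const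
  set τ := min tend (B / K₀) / ε with hτ
  have hbound : ∀ s ∈ Icc 0 τ, B + ε * K₀ * s ≤ 2 * B := by
    intro s hs
    have h4 : ε * s ≤ B / K₀ := by
      have := hs.2
      rw [hτ, le_div_iff₀ hε] at this
      calc ε * s = s * ε := mul_comm _ _
        _ ≤ _ := this.trans (min_le_right _ _)
    rw [le_div_iff₀ hK₀pos] at h4
    nlinarith
  have key := le_linear_of_rightSlopeLE (T := τ) (δ := B) (K := ε * K₀)
    (φ := fun s => wreal 1 (a 1 s) + wreal 1 (a 3 s))
    (c := fun s => ε * (nonlinConst T d * (wreal 1 (a 1 s) + wreal 1 (a 3 s)) ^ 3)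
      + ε * (nonlinConst T d * (wreal 1 (a 1 s) + wreal 1 (a 3 s)) ^ 3))
    ((ha.continuousOn_wreal hw hN (by simp)).add (ha.continuousOn_wreal hw hN (by simp)))
    (fun s hs => by
      have hF : ∀ j, wnorm 1 (nonlin T j fun i => a i s) ≤ ENNReal.ofReal
          (nonlinConst T d * (wreal 1 (a 1 s) + wreal 1 (a 3 s)) ^ 3) := fun j => by
        refine wnorm_nonlin_le_mul T hw (fun x y => by simp) j
          (add_nonneg (wreal_nonneg _ _) (wreal_nonneg _ _)) ?_
        refine ha.wnorm_le (fun k => rfl) ⟨hs.1, hs.2.le⟩ fun j hj => ?_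
        refine wnorm_le_of_wreal_le hN ?_
        have p1 := wreal_nonneg (d := d) 1 (a 1 s)
        have p3 := wreal_nonneg (d := d) 1 (a 3 s)
        simp only [Finset.mem_insert, Finset.mem_singleton] at hj
        rcases hj with rfl | rfl <;> linarith
      have hX : 0 ≤ nonlinConst T d * (wreal 1 (a 1 s) + wreal 1 (a 3 s)) ^ 3 :=
        mul_nonneg hc (pow_nonneg (add_nonneg (wreal_nonneg _ _) (wreal_nonneg _ _)) _)
      exact (ha.rightSlopeLE hA hE hε hw hN (by simp) hs hX (hF 1)).add
        (ha.rightSlopeLE hA hE hε hw hN (by simp) hs hX (hF 3)))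
    (by
      have e1 := wreal_le_of_wnorm_le hB.le h1
      have e3 : wreal 1 (a 3 0) = 0 := by
        rw [wreal_eq_integral hw, h3]
        rw [integral_eq_zero_of_ae]
        filter_upwards [Lp.coeFn_zero (Vec n) 1 (volume : Measure (Space d))] with k hk
        rw [hk]
        simp
      linarith)
    (fun s hs he => by
      have h5 := hbound s ⟨hs.1, hs.2.le⟩
      rw [he]
      have h6 : (B + ε * K₀ * s) ^ 3 ≤ (2 * B) ^ 3 :=
        pow_le_pow_left₀ (by have := hs.1; positivity) h5 3
      have h7 := mul_le_mul_of_nonneg_left h6 hc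
      rw [hK₀] at *
      nlinarith)
  have h8 := (key t ht).trans (hbound t ht)
  have p1 := wreal_nonneg (d := d) 1 (a 1 t)
  have p3 := wreal_nonneg (d := d) 1 (a 3 t)
  intro j hj
  refine wnorm_le_of_wreal_le hN ?_
  simp only [Finset.mem_insert, Finset.mem_singleton] at hj
  rcases hj with rfl | rfl <;> linarith

end GrowthOfNorms

end

/-! ### Propagation of moments -/

section

variable {d n : ℕ}

section Moments

variable {A : Fin d → Matrix (Fin n) (Fin n) ℝ} {Em : Matrix (Fin n) (Fin n) ℝ}
  {T : (Fin n → ℝ) →ₗ[ℝ] (Fin n → ℝ) →ₗ[ℝ] (Fin n → ℝ) →ₗ[ℝ] (Fin n → ℝ)}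
  {ω : ℝ} {κ : Space d} {ε τ : ℝ} {a : ℤ → ℝ → L1 d (Vec n)}

theorem wreal_zero {E : Type*} [NormedAddCommGroup E] {w : Space d → ℝ≥0} (hw : Measurable w) :
    wreal w (0 : L1 d E) = 0 := by
  rw [wreal_eq_integral hw]
  apply integral_eq_zero_of_ae
  filter_upwards [Lp.coeFn_zero E 1 (volume : Measure (Space d))] with k hk
  rw [hk]
  simp

/-- As long as the `L¹` norm is bounded, bounded weighted norms grow at most exponentially on the
time scale `1/ε`. -/
theorem Evolution.wnorm_growth_of_bounded (hA : ∀ l, (A l).IsSymm) (hE : Em.transpose = -Em)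
    (hε : 0 < ε) (ha : Evolution A Em T ω κ ε τ a) {tend : ℝ} (hτ : ε * τ ≤ tend)
    {w : Space d → ℝ≥0} (hw : Measurable w) {N : ℝ≥0} (hN : ∀ k, w k ≤ N)
    (heven : ∀ k, w (-k) = w k) {K : ℝ≥0} (hK : 1 ≤ K) (hadd : ∀ x y, w (x + y) ≤ K * (w x + w y))
    {B M : ℝ} (hB : 0 ≤ B) (hM : 0 ≤ M)
    (hBa : ∀ t ∈ Icc 0 τ, ∀ j ∈ ({1, 3} : Finset ℤ), wnorm 1 (a j t) ≤ ENNReal.ofReal B)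
    (h1 : wnorm w (a 1 0) ≤ ENNReal.ofReal M) (h3 : a 3 0 = 0) :
    ∀ t ∈ Icc 0 τ, ∀ j ∈ ({1, 3} : Finset ℤ), wnorm w (a j t)
      ≤ ENNReal.ofReal (M * Real.exp (2 * (nonlinConst T d * (K ^ 2 * (3 * B ^ 2))) * tend)) := by
  set K₀ : ℝ := 2 * (nonlinConst T d * (K ^ 2 * (3 * B ^ 2))) with hK₀
  have hc := nonlinConst_nonneg (d := d) T
  have hK₀pos : 0 ≤ K₀ := by positivity
  have key := le_gronwallBound_of_rightSlopeLE (T := τ) (δ := M) (K := ε * K₀) (e := 0)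
    (φ := fun s => wreal w (a 1 s) + wreal w (a 3 s))
    (c := fun s => ε * (nonlinConst T d * (K ^ 2 * (3 * B ^ 2 * (wreal w (a 1 s) + wreal w (a 3 s)))))
      + ε * (nonlinConst T d * (K ^ 2 * (3 * B ^ 2 * (wreal w (a 1 s) + wreal w (a 3 s))))))
    ((ha.continuousOn_wreal hw hN (by simp)).add (ha.continuousOn_wreal hw hN (by simp)))
    (fun s hs => by
      have p1 := wreal_nonneg w (a 1 s)
      have p3 := wreal_nonneg w (a 3 s)
      have hs' : s ∈ Icc 0 τ := ⟨hs.1, hs.2.le⟩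
      -- The bound is linear in the weighted norm, with B absorbing the two unweighted factors;
      -- hence the time is not restricted any further.
      have hF : ∀ j, wnorm w (nonlin T j fun i => a i s) ≤ ENNReal.ofReal
          (nonlinConst T d * (K ^ 2 * (3 * B ^ 2 * (wreal w (a 1 s) + wreal w (a 3 s))))) :=
        fun j => wnorm_nonlin_le_add T hw hK hadd j hB
          (ha.wnorm_le (fun k => rfl) hs' (hBa s hs'))
          (ha.wnorm_le heven hs' fun j hj => by
            refine wnorm_le_of_wreal_le hN ?_
            simp only [Finset.mem_insert, Finset.mem_singleton] at hj
            rcases hj with rfl | rfl <;> linarith)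
      exact (ha.rightSlopeLE hA hE hε hw hN (by simp) hs (by positivity) (hF 1)).add
        (ha.rightSlopeLE hA hE hε hw hN (by simp) hs (by positivity) (hF 3)))
    (by
      have e1 := wreal_le_of_wnorm_le hM h1
      simp only [h3, wreal_zero hw]
      linarith)
    (fun s hs => by rw [hK₀]; apply le_of_eq; ring)
  intro t ht j hj
  have h4 := key t ht
  rw [gronwallBound_ε0] at h4
  have h5 : ε * K₀ * t ≤ K₀ * tend := by
    have : ε * t ≤ tend := (mul_le_mul_of_nonneg_left ht.2 hε.le).trans hτ
    nlinarith
  have h6 := mul_le_mul_of_nonneg_left (Real.exp_le_exp.mpr h5) hM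
  have p1 := wreal_nonneg w (a 1 t)
  have p3 := wreal_nonneg w (a 3 t)
  refine wnorm_le_of_wreal_le hN ?_
  simp only [Finset.mem_insert, Finset.mem_singleton] at hj
  rcases hj with rfl | rfl <;> linarith

/-- Weighted norms are propagated on the time scale `1/ε`, also for unbounded weights. -/
theorem Evolution.wnorm_growth (hA : ∀ l, (A l).IsSymm) (hE : Em.transpose = -Em)
    (hε : 0 < ε) (ha : Evolution A Em T ω κ ε τ a) {tend : ℝ} (hτ : ε * τ ≤ tend)
    {w : Space d → ℝ≥0} (hw : Measurable w) (heven : ∀ k, w (-k) = w k) {K : ℝ≥0} (hK : 1 ≤ K)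
    (hadd : ∀ x y, w (x + y) ≤ K * (w x + w y)) {B M : ℝ} (hB : 0 ≤ B) (hM : 0 ≤ M)
    (hBa : ∀ t ∈ Icc 0 τ, ∀ j ∈ ({1, 3} : Finset ℤ), wnorm 1 (a j t) ≤ ENNReal.ofReal B)
    (h1 : wnorm w (a 1 0) ≤ ENNReal.ofReal M) (h3 : a 3 0 = 0) :
    ∀ t ∈ Icc 0 τ, ∀ j ∈ ({1, 3} : Finset ℤ), wnorm w (a j t)
      ≤ ENNReal.ofReal (M * Real.exp (2 * (nonlinConst T d * (K ^ 2 * (3 * B ^ 2))) * tend)) := by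
  intro t ht j hj
  refine wnorm_le_of_forall_min hw (L1.integrable_coeFn _).1 fun N => ?_
  refine ha.wnorm_growth_of_bounded hA hE hε hτ (hw.min measurable_const) (N := N)
    (fun k => min_le_right _ _) (fun k => by rw [heven]) hK (fun x y => ?_) hB hM hBa
    ((wnorm_mono_weight _ fun k => min_le_left _ _).trans h1) h3 t ht j hj
  -- Because 1 ≤ K, truncation at N preserves quasi-subadditivity with the same K, and the resulting
  -- bound is independent of N.
  have hN : (N : ℝ≥0) ≤ K * N := le_mul_of_one_le_left zero_le hK
  have hxy := hadd x y
  rcases le_total (w x) N with hx | hx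
  · rcases le_total (w y) N with hy | hy
    · rw [min_eq_left hx, min_eq_left hy]
      exact (min_le_left _ _).trans hxy
    · rw [min_eq_right hy]
      refine (min_le_right _ _).trans (hN.trans ?_)
      gcongr
      exact le_add_self
  · rw [min_eq_right hx]
    refine (min_le_right _ _).trans (hN.trans ?_)
    gcongr
    exact le_self_add

/-- The weight `(1 + |k|)^s`. -/
def polyWeight (d s : ℕ) (k : Space d) : ℝ≥0 := (1 + ‖k‖₊) ^ s

theorem measurable_polyWeight (s : ℕ) : Measurable (polyWeight d s) := by
  unfold polyWeight; fun_prop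

theorem polyWeight_neg (s : ℕ) (k : Space d) : polyWeight d s (-k) = polyWeight d s k := by
  simp [polyWeight]

/-- Both structure conditions are used: this one for products in the normal form argument, the
additive one for the propagation of moments. -/
theorem polyWeight_add_le_mul (s : ℕ) (x y : Space d) :
    polyWeight d s (x + y) ≤ polyWeight d s x * polyWeight d s y := by
  unfold polyWeight
  rw [← mul_pow]
  gcongr
  calc 1 + ‖x + y‖₊ ≤ 1 + (‖x‖₊ + ‖y‖₊) := by gcongr; exact nnnorm_add_le _ _
    _ ≤ 1 + (‖x‖₊ + ‖y‖₊) + ‖x‖₊ * ‖y‖₊ := le_self_add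
    _ = _ := by ring

theorem polyWeight_add_le_add (s : ℕ) (x y : Space d) :
    polyWeight d s (x + y) ≤ 2 ^ s * (polyWeight d s x + polyWeight d s y) := by
  unfold polyWeight
  have h : 1 + ‖x + y‖₊ ≤ 2 * max (1 + ‖x‖₊) (1 + ‖y‖₊) := by
    calc 1 + ‖x + y‖₊ ≤ 1 + (‖x‖₊ + ‖y‖₊) := by gcongr; exact nnnorm_add_le _ _
      _ ≤ (1 + ‖x‖₊) + (1 + ‖y‖₊) := by
        rw [add_add_add_comm]; gcongr; exact le_self_add
      _ ≤ max (1 + ‖x‖₊) (1 + ‖y‖₊) + max (1 + ‖x‖₊) (1 + ‖y‖₊) :=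
        add_le_add (le_max_left _ _) (le_max_right _ _)
      _ = _ := by ring
  refine (pow_le_pow_left' h s).trans ?_
  rw [mul_pow]
  gcongr
  rcases le_total (1 + ‖x‖₊) (1 + ‖y‖₊) with hxy | hxy
  · rw [max_eq_right hxy]; exact le_add_self
  · rw [max_eq_left hxy]; exact le_self_add

end Moments

end

/-! ### Spectral components, nonresonance and the normal form transformation -/

section

variable {d n : ℕ}

section Spectral

variable {A : Fin d → Matrix (Fin n) (Fin n) ℝ} {Em : Matrix (Fin n) (Fin n) ℝ}
  (S : ℤ → SmoothEigen A Em) (ω : ℝ) (κ : Space d)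

theorem symL_psiJ (j : ℤ) (l : Fin n) (θ : Space d) :
    symL A Em ((j : ℝ) * ω) ((j : ℝ) • κ + θ) (psiJ S κ j l θ)
      = (lamJ S ω κ j l θ : ℂ) • psiJ S κ j l θ := by
  rw [symL_zero, symL_apply]
  unfold psiJ lamJ
  rw [(S j).eigen, Complex.ofReal_sub, sub_smul]

theorem orthonormal_psiJ (j : ℤ) (θ : Space d) : Orthonormal ℂ fun l => psiJ S κ j l θ :=
  (S j).orthonormal _

theorem norm_psiJ (j : ℤ) (l : Fin n) (θ : Space d) : ‖psiJ S κ j l θ‖ = 1 :=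
  (orthonormal_psiJ S κ j θ).1 l

theorem inner_psiJ_symL (hA : ∀ l, (A l).IsSymm) (hE : Em.transpose = -Em) (j : ℤ) (l : Fin n)
    (θ : Space d) (v : Vec n) :
    inner ℂ (psiJ S κ j l θ) (symL A Em ((j : ℝ) * ω) ((j : ℝ) • κ + θ) v)
      = (lamJ S ω κ j l θ : ℂ) * inner ℂ (psiJ S κ j l θ) v := by
  rw [← symL_isSymmetric hA hE, symL_psiJ, inner_smul_left, Complex.conj_ofReal]

/-- The orthonormal basis of eigenvectors. -/
def psiBasis (j : ℤ) (θ : Space d) : OrthonormalBasis (Fin n) ℂ (Vec n) :=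
  OrthonormalBasis.mk (orthonormal_psiJ S κ j θ)
    ((orthonormal_psiJ S κ j θ).linearIndependent.span_eq_top_of_card_eq_finrank'
      (by simp)).ge

theorem sum_inner_psiJ_smul (j : ℤ) (θ : Space d) (v : Vec n) :
    ∑ l, inner ℂ (psiJ S κ j l θ) v • psiJ S κ j l θ = v := by
  simpa [psiBasis] using (psiBasis S κ j θ).sum_repr' v

theorem sum_norm_sq_inner_psiJ (j : ℤ) (θ : Space d) (v : Vec n) :
    ∑ l, ‖inner ℂ (psiJ S κ j l θ) v‖ ^ 2 = ‖v‖ ^ 2 := by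
  simpa [psiBasis] using (psiBasis S κ j θ).sum_sq_norm_inner_right v

theorem norm_inner_psiJ_le (j : ℤ) (l : Fin n) (θ : Space d) (v : Vec n) :
    ‖inner ℂ (psiJ S κ j l θ) v‖ ≤ ‖v‖ := by
  simpa [norm_psiJ] using norm_inner_le_norm (𝕜 := ℂ) (psiJ S κ j l θ) v

theorem norm_symL_le_sum (hA : ∀ l, (A l).IsSymm) (hE : Em.transpose = -Em) (j : ℤ)
    (θ : Space d) (v : Vec n) :
    ‖symL A Em ((j : ℝ) * ω) ((j : ℝ) • κ + θ) v‖
      ≤ ∑ l, |lamJ S ω κ j l θ| * ‖inner ℂ (psiJ S κ j l θ) v‖ := by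
  conv_lhs => rw [← sum_inner_psiJ_smul S κ j θ (symL A Em _ _ v)]
  refine (norm_sum_le _ _).trans (Finset.sum_le_sum fun l _ => ?_)
  rw [norm_smul, norm_psiJ, mul_one, inner_psiJ_symL S ω κ hA hE, norm_mul, Complex.norm_real,
    Real.norm_eq_abs]

/-- One constant for all branches: the given bounds are in terms of the ℓ¹ norm, which costs a
factor d, and the absolute values of their constants are summed over the finitely many j and l. -/
theorem exists_lamJ_lipschitz :
    ∃ Λ : ℝ, 0 ≤ Λ ∧ ∀ j ∈ ({1, 3} : Finset ℤ), ∀ l θ,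
      |lamJ S ω κ j l θ - lamJ S ω κ j l 0| ≤ Λ * ‖θ‖ := by
  choose C hC using fun j l => (S j).lam_lipschitz l
  refine ⟨∑ j ∈ ({1, 3} : Finset ℤ), ∑ l, |C j l| * d, by positivity, fun j hj l θ => ?_⟩
  have h1 : |lamJ S ω κ j l θ - lamJ S ω κ j l 0| ≤ |C j l| * d * ‖θ‖ := by
    have h2 := hC j l ((j : ℝ) • κ + θ) ((j : ℝ) • κ + 0)
    unfold lamJ
    rw [sub_sub_sub_cancel_right]
    refine h2.trans ?_
    calc C j l * ∑ i, |((j : ℝ) • κ + θ) i - ((j : ℝ) • κ + 0) i|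
        ≤ |C j l| * ∑ _i : Fin d, ‖θ‖ := by
          refine mul_le_mul (le_abs_self _) (Finset.sum_le_sum fun i _ => ?_)
            (Finset.sum_nonneg fun i _ => abs_nonneg _) (abs_nonneg _)
          simpa using PiLp.norm_apply_le θ i
      _ = _ := by simp [mul_assoc]
  refine h1.trans (mul_le_mul_of_nonneg_right ?_ (norm_nonneg _))
  refine le_trans ?_ (Finset.single_le_sum (f := fun j => ∑ l, |C j l| * (d : ℝ))
    (fun j _ => Finset.sum_nonneg fun l _ => by positivity) hj)
  exact Finset.single_le_sum (f := fun l => |C j l| * (d : ℝ)) (fun l _ => by positivity)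
    (Finset.mem_univ l)

/-- The modes other than the critical mode `(1, 0)`. -/
def modes (n : ℕ) [NeZero n] : Finset (ℤ × Fin n) :=
  (({1, 3} : Finset ℤ) ×ˢ Finset.univ).erase (1, 0)

theorem fst_mem_of_mem_modes [NeZero n] {i : ℤ × Fin n} (hi : i ∈ modes n) :
    i.1 ∈ ({1, 3} : Finset ℤ) :=
  (Finset.mem_product.mp (Finset.mem_of_mem_erase hi)).1

/-- Nonresonance of all modes but the critical one. For j = 1 a further zero eigenvalue would place
two orthonormal vectors in a one-dimensional kernel; for j = 3 it would contradict invertibility. -/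
theorem lamJ_ne_zero [NeZero n]
    (hker : Module.finrank ℂ (LinearMap.ker (Matrix.toEuclideanLin (symbolL A Em ω κ))) = 1)
    (hinv : IsUnit (symbolL A Em (((3 : ℤ) : ℝ) * ω) (((3 : ℤ) : ℝ) • κ)))
    (hS : lamJ S ω κ 1 0 0 = 0) {i : ℤ × Fin n} (hi : i ∈ modes n) : lamJ S ω κ i.1 i.2 0 ≠ 0 := by
  obtain ⟨j, l⟩ := i
  intro h0
  have hj := fst_mem_of_mem_modes hi
  have hne := Finset.ne_of_mem_erase hi
  have hz : ∀ (j : ℤ) (l : Fin n), lamJ S ω κ j l 0 = 0 →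
      symL A Em ((j : ℝ) * ω) ((j : ℝ) • κ) (psiJ S κ j l 0) = 0 := fun j l h => by
    have := symL_psiJ S ω κ j l 0
    rwa [add_zero, h, Complex.ofReal_zero, zero_smul] at this
  simp only [Finset.mem_insert, Finset.mem_singleton] at hj
  rcases hj with rfl | rfl
  · have hl : l ≠ 0 := fun h => hne (by rw [h])
    have e1 := hz 1 l h0
    have e2 := hz 1 0 hS
    simp only [Int.cast_one, one_mul, one_smul] at e1 e2
    obtain ⟨v, -, hv⟩ := finrank_eq_one_iff'.mp hker
    obtain ⟨c1, hc1⟩ := hv ⟨psiJ S κ 1 l 0, e1⟩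
    obtain ⟨c2, hc2⟩ := hv ⟨psiJ S κ 1 0 0, e2⟩
    have hc1' : c1 • (v : Vec n) = psiJ S κ 1 l 0 := congrArg Subtype.val hc1
    have hc2' : c2 • (v : Vec n) = psiJ S κ 1 0 0 := congrArg Subtype.val hc2
    have ho := (orthonormal_psiJ S κ 1 0).2 hl
    simp only at ho
    rw [← hc1', ← hc2', inner_smul_left, inner_smul_right] at ho
    have n1 : c1 ≠ 0 := fun h => by
      have := norm_psiJ S κ 1 l 0
      rw [← hc1', h, zero_smul, norm_zero] at this
      exact zero_ne_one this
    have n2 : c2 ≠ 0 := fun h => by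
      have := norm_psiJ S κ 1 0 0
      rw [← hc2', h, zero_smul, norm_zero] at this
      exact zero_ne_one this
    have n3 : (v : Vec n) ≠ 0 := fun h => by
      have := norm_psiJ S κ 1 l 0
      rw [← hc1', h, smul_zero, norm_zero] at this
      exact zero_ne_one this
    have n4 : inner ℂ (v : Vec n) (v : Vec n) ≠ (0 : ℂ) := inner_self_ne_zero.mpr n3
    have n5 : (starRingEnd ℂ) c1 ≠ 0 := (map_ne_zero _).mpr n1
    exact mul_ne_zero n5 (mul_ne_zero n2 n4) ho
  · have e1 := hz 3 l h0
    obtain ⟨U, hU⟩ := hinv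
    have e2 : psiJ S κ 3 l 0 = 0 := by
      have h3 : Matrix.toEuclideanLin (↑U⁻¹ : Matrix (Fin n) (Fin n) ℂ)
          (symL A Em (((3 : ℤ) : ℝ) * ω) (((3 : ℤ) : ℝ) • κ) (psiJ S κ 3 l 0)) = psiJ S κ 3 l 0 := by
        rw [symL_apply, ← hU, ← LinearMap.comp_apply, ← Matrix.toLpLin_mul_same, Units.inv_mul,
          Matrix.toLpLin_one]
        rfl
      rw [← h3, e1, map_zero]
    have := norm_psiJ S κ 3 l 0
    rw [e2, norm_zero] at this
    exact zero_ne_one this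

/-- Eigenvectors may be discontinuous at the origin, but continuity off a single point suffices for
measurability. -/
theorem measurable_psiJ (ε : ℝ) (j : ℤ) (l : Fin n) :
    Measurable fun k : Space d => psiJ S κ j l (ε • k) := by
  have h : Measurable ((S j).psi l) :=
    measurable_of_continuousOn_compl_singleton 0 ((S j).psi_smooth l).continuousOn
  unfold psiJ
  exact h.comp (by fun_prop)

theorem measurable_lamJ (ε : ℝ) (j : ℤ) (l : Fin n) :
    Measurable fun k : Space d => lamJ S ω κ j l (ε • k) := by
  have h : Measurable ((S j).lam l) :=
    measurable_of_continuousOn_compl_singleton 0 ((S j).lam_smooth l).continuousOn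
  unfold lamJ
  exact (h.comp (by fun_prop)).sub_const _

theorem exists_component (ε : ℝ) (j : ℤ) (l : Fin n) :
    ∃ Q : L1 d (Vec n) →L[ℝ] L1 d ℂ, ∀ f : L1 d (Vec n),
      Q f =ᵐ[volume] fun k => inner ℂ (psiJ S κ j l (ε • k)) (f k) := by
  have hm : AEStronglyMeasurable (fun k : Space d => innerSL ℂ (psiJ S κ j l (ε • k))) := by
    have := (innerSL ℂ (E := Vec n)).continuous.comp_stronglyMeasurable
      (measurable_psiJ S κ ε j l).stronglyMeasurable
    exact this.aestronglyMeasurable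
  exact exists_mulOp hm (C := 1) fun k => by rw [innerSL_apply_norm, norm_psiJ]

/-- The component `f ↦ ⟨ψ_{jl}(ε ·), f⟩` of elements of `L¹`. -/
def component (ε : ℝ) (j : ℤ) (l : Fin n) : L1 d (Vec n) →L[ℝ] L1 d ℂ :=
  (exists_component S κ ε j l).choose

theorem coeFn_component (ε : ℝ) (j : ℤ) (l : Fin n) (f : L1 d (Vec n)) :
    component S κ ε j l f =ᵐ[volume] fun k => inner ℂ (psiJ S κ j l (ε • k)) (f k) :=
  (exists_component S κ ε j l).choose_spec f

theorem wnorm_component_le (ε : ℝ) (j : ℤ) (l : Fin n) (w : Space d → ℝ≥0) (f : L1 d (Vec n)) :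
    wnorm w (component S κ ε j l f) ≤ wnorm w f :=
  wnorm_mono_ae ((coeFn_component S κ ε j l f).mono fun k hk => by
    rw [hk]
    exact mul_le_mul_of_nonneg_left (norm_inner_psiJ_le S κ j l _ _) NNReal.zero_le_coe)

/-- The normal form transformation of a component: adding a multiple of size `ε²` of the
nonlinearity removes the nonresonant forcing of size `ε`. -/
def normalForm (ε : ℝ) (j : ℤ) (l : Fin n) (f g : L1 d (Vec n)) : L1 d ℂ :=
  component S κ ε j l f
    + (Complex.I * ((ε ^ 2 / lamJ S ω κ j l 0 : ℝ) : ℂ)) • component S κ ε j l g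

theorem wnorm_correction_le (ε : ℝ) (j : ℤ) (l : Fin n) (w : Space d → ℝ≥0) (g : L1 d (Vec n)) :
    wnorm w ((Complex.I * ((ε ^ 2 / lamJ S ω κ j l 0 : ℝ) : ℂ)) • component S κ ε j l g : L1 d ℂ)
      ≤ ENNReal.ofReal (ε ^ 2 / |lamJ S ω κ j l 0|) * wnorm w g := by
  refine (wnorm_coe_smul_le w _ _).trans ?_
  rw [norm_mul, Complex.norm_I, one_mul, Complex.norm_real, Real.norm_eq_abs, abs_div,
    abs_of_nonneg (sq_nonneg ε)]
  gcongr
  exact wnorm_component_le S κ ε j l w g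

/-- Arithmetic of the detuning remainder: δ stands for |λ(εk) - λ(0)|, and the factor x = |k| that
bounds it is absorbed by passing from w to W. -/
theorem weighted_detuning_le {w W x ε m Λ δ f g : ℝ} (hw : 0 ≤ w) (hW : w * x ≤ W) (hε : 0 ≤ ε)
    (hm : 0 ≤ m) (hΛ : 0 ≤ Λ) (hx : 0 ≤ x) (hδ : δ ≤ Λ * ε * x) (hg : 0 ≤ g) (hgf : g ≤ f) :
    w * (ε / m * δ * g) ≤ ε ^ 2 / m * Λ * (W * f) := by
  have hf : 0 ≤ f := hg.trans hgf
  calc w * (ε / m * δ * g) ≤ w * (ε / m * (Λ * ε * x) * f) := by gcongr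
    _ = ε ^ 2 / m * Λ * ((w * x) * f) := by ring
    _ ≤ _ := by gcongr

-- Write Q for the component and y for its normal form. Then y' = -(i/ε)λ(εk)y + ε(1 - λ(εk)/λ(0))QF
-- + i(ε²/λ(0))QF'. The first term is pointwise orthogonal to y. The Lipschitz bound turns the
-- second into the contribution ΛX, at the price of one moment of F, and the third contributes Y.
set_option maxHeartbeats 800000 in
theorem rightSlopeLE_normalForm (hA : ∀ l, (A l).IsSymm) (hE : Em.transpose = -Em) {ε : ℝ}
    (hε : 0 < ε) {j : ℤ} {l : Fin n} (hμ : lamJ S ω κ j l 0 ≠ 0) {Λ : ℝ} (hΛ : 0 ≤ Λ)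
    (hlip : ∀ θ, |lamJ S ω κ j l θ - lamJ S ω κ j l 0| ≤ Λ * ‖θ‖)
    {a F : ℝ → L1 d (Vec n)} {β F' : L1 d (Vec n)} {t : ℝ}
    (hβ : ∀ᵐ k, β k = -((Complex.I / (ε : ℂ)) •
      symL A Em ((j : ℝ) * ω) ((j : ℝ) • κ + ε • k) (a t k)))
    (ha : HasDerivWithinAt a (β + ε • F t) (Ici t) t) (hF : HasDerivWithinAt F F' (Ici t) t)
    {w W : Space d → ℝ≥0} (hw : Measurable w) {N : ℝ≥0} (hN : ∀ k, w k ≤ N)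
    (hW : Measurable W) (hW1 : ∀ k, 1 + ‖k‖₊ ≤ W k) (hwW : ∀ k, w k * (1 + ‖k‖₊) ≤ W k)
    {X Y : ℝ} (hX : 0 ≤ X) (hY : 0 ≤ Y) (hFX : wnorm W (F t) ≤ ENNReal.ofReal X)
    (hFY : wnorm w F' ≤ ENNReal.ofReal Y) :
    RightSlopeLE (fun s => wreal w (normalForm S ω κ ε j l (a s) (F s)))
      (ε ^ 2 / |lamJ S ω κ j l 0| * (Λ * X + Y)) t := by
  set Q := component S κ ε j l with hQ
  set μ := lamJ S ω κ j l 0 with hμdef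
  set c : ℂ := Complex.I * ((ε ^ 2 / μ : ℝ) : ℂ) with hc
  have hμ' : 0 < |μ| := abs_pos.mpr hμ
  have hlin : ∀ k : Space d, |lamJ S ω κ j l (ε • k) - μ| ≤ Λ * ε * ‖k‖ := fun k => by
    have := hlip (ε • k)
    rwa [norm_smul, Real.norm_of_nonneg hε.le, ← mul_assoc] at this
  have hWF : Integrable fun k => (W k : ℝ) * ‖F t k‖ := by
    refine ⟨hW.coe_nnreal_real.aestronglyMeasurable.mul (L1.integrable_coeFn _).1.norm, ?_⟩
    refine lt_of_le_of_lt (le_of_eq ?_) (hFX.trans_lt ENNReal.ofReal_lt_top)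
    unfold wnorm
    congr 1
    ext1 k
    rw [enorm_mul, enorm_norm]
    congr 1
    rw [← ofReal_norm, Real.norm_of_nonneg NNReal.zero_le_coe, ENNReal.ofReal_coe_nnreal]
  -- This term is added and subtracted: it completes the rotation of the component to that of y, and
  -- what is left of εQF is the detuning. As λ(εk) grows at most linearly in k, its integrability
  -- rests on the W-norm of F.
  have hHi : Integrable fun k => ((ε * lamJ S ω κ j l (ε • k) / μ : ℝ) : ℂ) * Q (F t) k := by
    refine (hWF.const_mul (ε * (|μ| + Λ * ε) / |μ|)).mono'
      (AEStronglyMeasurable.mul (Measurable.aestronglyMeasurable (by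
        have := measurable_lamJ S ω κ ε j l
        fun_prop)) (L1.integrable_coeFn _).1) ?_
    filter_upwards [coeFn_component S κ ε j l (F t)] with k hk
    rw [norm_mul, Complex.norm_real, Real.norm_eq_abs, abs_div, abs_mul, abs_of_pos hε, hQ, hk]
    have h1 : |lamJ S ω κ j l (ε • k)| ≤ (|μ| + Λ * ε) * W k := by
      have h2 := hlin k
      have h3 : |lamJ S ω κ j l (ε • k)| ≤ |μ| + |lamJ S ω κ j l (ε • k) - μ| := by
        have := abs_add_le μ (lamJ S ω κ j l (ε • k) - μ)
        rwa [add_sub_cancel] at this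
      have h4 : 1 + ‖k‖ ≤ W k := by exact_mod_cast hW1 k
      have h5 : 0 ≤ Λ * ε := by positivity
      nlinarith [norm_nonneg k]
    have h6 := norm_inner_psiJ_le S κ j l (ε • k) (F t k)
    calc ε * |lamJ S ω κ j l (ε • k)| / |μ| * ‖inner ℂ (psiJ S κ j l (ε • k)) (F t k)‖
        ≤ ε * ((|μ| + Λ * ε) * W k) / |μ| * ‖F t k‖ := by gcongr
      _ = _ := by ring
  set H : L1 d ℂ := hHi.toL1 with hH
  have hHk : H =ᵐ[volume] fun k => ((ε * lamJ S ω κ j l (ε • k) / μ : ℝ) : ℂ) * Q (F t) k :=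
    Integrable.coeFn_toL1 hHi
  have hder : HasDerivWithinAt (fun s => normalForm S ω κ ε j l (a s) (F s))
      ((Q β + H) + ((ε • Q (F t) - H) + c • Q F')) (Ici t) t := by
    have h1 := Q.hasFDerivAt.comp_hasDerivWithinAt t ha
    have h2 := (Q.hasFDerivAt.comp_hasDerivWithinAt t hF).const_smul c
    refine (h1.add h2).congr_deriv ?_
    rw [map_add, map_smul]
    abel
  have hyk : ∀ᵐ k, normalForm S ω κ ε j l (a t) (F t) k = Q (a t) k + c * Q (F t) k := by
    filter_upwards [Lp.coeFn_add (Q (a t)) (c • Q (F t)), Lp.coeFn_smul c (Q (F t))] with k h1 h2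
    have : normalForm S ω κ ε j l (a t) (F t) k = (Q (a t) + c • Q (F t) : L1 d ℂ) k := rfl
    rw [this, h1, Pi.add_apply, h2, Pi.smul_apply, smul_eq_mul]
  have hεc : (ε : ℂ) ≠ 0 := by exact_mod_cast hε.ne'
  have hμc : (μ : ℂ) ≠ 0 := by exact_mod_cast hμ
  have hβk : ∀ᵐ k, (Q β + H : L1 d ℂ) k
      = -(Complex.I * ((lamJ S ω κ j l (ε • k) / ε : ℝ) : ℂ))
        * normalForm S ω κ ε j l (a t) (F t) k := by
    filter_upwards [Lp.coeFn_add (Q β) H, hHk, hyk, hβ, coeFn_component S κ ε j l β,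
      coeFn_component S κ ε j l (a t)] with k h1 h2 h3 h4 h5 h6
    rw [h1, Pi.add_apply, h2, h3, hQ, h5, h4, h6, inner_neg_right, inner_smul_right,
      inner_psiJ_symL S ω κ hA hE, hc]
    push_cast
    field_simp
    linear_combination ((lamJ S ω κ j l (ε • k) : ℂ) * (ε : ℂ) ^ 2
      * component S κ ε j l (F t) k) * Complex.I_sq
  refine (rightSlopeLE_wreal hw hN hder ?_ ?_).mono ?_
  · filter_upwards [hβk] with k hk
    rw [hk]
    set y := normalForm S ω κ ε j l (a t) (F t) k
    rw [show -(Complex.I * ((lamJ S ω κ j l (ε • k) / ε : ℝ) : ℂ)) * y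
      = (-(Complex.I * ((lamJ S ω κ j l (ε • k) / ε : ℝ) : ℂ))) • y from rfl, inner_smul_right,
      inner_self_eq_norm_sq_to_K]
    simp [← Complex.ofReal_pow]
  · filter_upwards [hβk] with k hk h0
    rw [hk, h0, mul_zero]
  · refine wreal_le_of_wnorm_le (by positivity) ?_
    have h1 : wnorm w (ε • Q (F t) - H : L1 d ℂ)
        ≤ ENNReal.ofReal (ε ^ 2 / |μ| * Λ) * ENNReal.ofReal X := by
      refine le_trans ?_ (mul_le_mul_right hFX _)
      have h2 := wnorm_le_of_ae (w := w) (w' := W) (f := (ε • Q (F t) - H : L1 d ℂ)) (g := F t)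
        (Real.toNNReal (ε ^ 2 / |μ| * Λ)) ?_
      · exact h2
      rw [Real.coe_toNNReal _ (by positivity)]
      filter_upwards [Lp.coeFn_sub (ε • Q (F t)) H, Lp.coeFn_smul ε (Q (F t)), hHk,
        coeFn_component S κ ε j l (F t)] with k h3 h4 h5 h6
      rw [h3, Pi.sub_apply, h4, Pi.smul_apply, h5, hQ, h6]
      have e : ε • (inner ℂ (psiJ S κ j l (ε • k)) (F t k) : ℂ)
          - ((ε * lamJ S ω κ j l (ε • k) / μ : ℝ) : ℂ) * inner ℂ (psiJ S κ j l (ε • k)) (F t k)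
          = ((ε / μ * (μ - lamJ S ω κ j l (ε • k)) : ℝ) : ℂ)
            * inner ℂ (psiJ S κ j l (ε • k)) (F t k) := by
        rw [Complex.real_smul]
        push_cast
        field_simp
      rw [e, norm_mul, Complex.norm_real, Real.norm_eq_abs, abs_mul, abs_div, abs_of_pos hε,
        abs_sub_comm]
      have h7 := norm_inner_psiJ_le S κ j l (ε • k) (F t k)
      have h8 : (w k : ℝ) * ‖k‖ ≤ W k := by
        have : (w k : ℝ) * (1 + ‖k‖) ≤ W k := by exact_mod_cast hwW k
        nlinarith [(w k).coe_nonneg]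
      exact weighted_detuning_le NNReal.zero_le_coe h8 hε.le hμ'.le hΛ (norm_nonneg _) (hlin k)
        (norm_nonneg _) h7
    have h3 : wnorm w (c • Q F' : L1 d ℂ) ≤ ENNReal.ofReal (ε ^ 2 / |μ|) * ENNReal.ofReal Y :=
      (wnorm_correction_le S ω κ ε j l w F').trans (mul_le_mul_right hFY _)
    refine (wnorm_coe_add_le hw _ _).trans ((add_le_add h1 h3).trans (le_of_eq ?_))
    rw [← ENNReal.ofReal_mul (by positivity), ← ENNReal.ofReal_mul (by positivity),
      ← ENNReal.ofReal_add (by positivity) (by positivity)]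
    congr 1
    ring

/-- The correction has size ε²X/|λ(0)|, so components and normal forms are interchangeable at a cost
below the O(ε) that is sought. -/
theorem wreal_normalForm_le {ε : ℝ} {j : ℤ} {l : Fin n} {w : Space d → ℝ≥0} (hw : Measurable w)
    {N : ℝ≥0} (hN : ∀ k, w k ≤ N) {f g : L1 d (Vec n)} {X : ℝ} (hX : 0 ≤ X)
    (hg : wnorm w g ≤ ENNReal.ofReal X) :
    wreal w (normalForm S ω κ ε j l f g)
        ≤ wreal w (component S κ ε j l f) + ε ^ 2 / |lamJ S ω κ j l 0| * X ∧
      wreal w (component S κ ε j l f)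
        ≤ wreal w (normalForm S ω κ ε j l f g) + ε ^ 2 / |lamJ S ω κ j l 0| * X := by
  set h : L1 d ℂ :=
    (Complex.I * ((ε ^ 2 / lamJ S ω κ j l 0 : ℝ) : ℂ)) • component S κ ε j l g with hh
  have e1 : wnorm w h ≤ ENNReal.ofReal (ε ^ 2 / |lamJ S ω κ j l 0| * X) := by
    rw [ENNReal.ofReal_mul (by positivity)]
    exact (wnorm_correction_le S ω κ ε j l w g).trans (mul_le_mul_right hg _)
  have e2 := wreal_le_of_wnorm_le (by positivity) e1
  have e3 : wreal w (-h : L1 d ℂ) = wreal w h := by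
    unfold wreal
    congr 1
    exact wnorm_congr_ae ((Lp.coeFn_neg h).mono fun k hk => by rw [hk, Pi.neg_apply, norm_neg])
  have e4 : normalForm S ω κ ε j l f g = component S κ ε j l f + h := rfl
  refine ⟨?_, ?_⟩
  · rw [e4]
    linarith [wreal_add_le hw hN (component S κ ε j l f) h]
  · have e5 := wreal_add_le hw hN (normalForm S ω κ ε j l f g) (-h)
    rw [e3, e4, add_neg_cancel_right, ← e4] at e5
    linarith

end Spectral

end

/-! ### Time derivatives in terms of the noncritical components -/

section

variable {d n : ℕ}

section Components

variable [NeZero n] {A : Fin d → Matrix (Fin n) (Fin n) ℝ} {Em : Matrix (Fin n) (Fin n) ℝ}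
  (S : ℤ → SmoothEigen A Em) (ω : ℝ) (κ : Space d)

/-- The critical mode may be included at no cost when its term vanishes. Applied with the factor
|λ_{jl}(0)|, this is how λ_{11}(0) = 0 keeps the critical component out of the terms of size 1/ε. -/
theorem sum_le_sum_modes {f : ℤ × Fin n → ℝ} (hf : ∀ i, 0 ≤ f i) (h0 : f (1, 0) = 0) {j : ℤ}
    (hj : j ∈ ({1, 3} : Finset ℤ)) : ∑ l, f (j, l) ≤ ∑ i ∈ modes n, f i := by
  have h1 : ∑ i ∈ modes n, f i = ∑ i ∈ ({1, 3} : Finset ℤ) ×ˢ Finset.univ, f i := by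
    rw [modes, Finset.sum_erase _ h0]
  rw [h1, Finset.sum_product]
  exact Finset.single_le_sum (f := fun j => ∑ l, f (j, l))
    (fun j _ => Finset.sum_nonneg fun l _ => hf _) hj

/-- The linear part of `∂_t a_j` is of size `1/ε` times the noncritical components, up to `O(1)`. -/
theorem wnorm_linear_part_le (hA : ∀ l, (A l).IsSymm) (hE : Em.transpose = -Em)
    (hS : lamJ S ω κ 1 0 0 = 0) {Λ : ℝ} (hΛ : 0 ≤ Λ)
    (hlip : ∀ j ∈ ({1, 3} : Finset ℤ), ∀ l θ,
      |lamJ S ω κ j l θ - lamJ S ω κ j l 0| ≤ Λ * ‖θ‖)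
    {ε : ℝ} (hε : 0 < ε) {w W : Space d → ℝ≥0} (hw : Measurable w) {N : ℝ≥0} (hN : ∀ k, w k ≤ N)
    (hwW : ∀ k, w k * (1 + ‖k‖₊) ≤ W k) {B : ℝ} (hB : 0 ≤ B) {a : ℤ → L1 d (Vec n)} {j : ℤ}
    (hj : j ∈ ({1, 3} : Finset ℤ)) (hWB : wnorm W (a j) ≤ ENNReal.ofReal B) {β : L1 d (Vec n)}
    (hβ : ∀ᵐ k, β k = -((Complex.I / (ε : ℂ)) •
      symL A Em ((j : ℝ) * ω) ((j : ℝ) • κ + ε • k) (a j k))) :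
    wnorm w β ≤ ENNReal.ofReal ((∑ i ∈ modes n, |lamJ S ω κ i.1 i.2 0|
      * wreal w (component S κ ε i.1 i.2 (a i.1))) / ε + n * Λ * B) := by
  set c : Fin n → L1 d ℂ := fun l => component S κ ε j l (a j) with hc
  -- λ_{jl}(εk) is split into λ_{jl}(0) and an error O(ε|k|). After division by ε the error is
  -- O(|k|) in each of the n components and is absorbed by W.
  have hpt : ∀ᵐ k, (w k : ℝ) * ‖β k‖ ≤ w k * ‖(∑ l, |lamJ S ω κ j l 0| / ε * ‖c l k‖)
      + n * Λ * (‖k‖ * ‖a j k‖)‖ := by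
    have hck : ∀ᵐ k, ∀ l, c l k = inner ℂ (psiJ S κ j l (ε • k)) (a j k) := by
      rw [ae_all_iff]
      exact fun l => coeFn_component S κ ε j l (a j)
    filter_upwards [hβ, hck] with k h1 h2
    refine mul_le_mul_of_nonneg_left ?_ NNReal.zero_le_coe
    rw [Real.norm_of_nonneg (by positivity), h1, norm_neg, norm_smul, norm_div, Complex.norm_I,
      Complex.norm_real, Real.norm_of_nonneg hε.le]
    have h3 := norm_symL_le_sum S ω κ hA hE j (ε • k) (a j k)
    have h4 : ∑ l, |lamJ S ω κ j l (ε • k)| * ‖inner ℂ (psiJ S κ j l (ε • k)) (a j k)‖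
        ≤ ∑ l, (|lamJ S ω κ j l 0| * ‖c l k‖ + Λ * ε * (‖k‖ * ‖a j k‖)) := by
      refine Finset.sum_le_sum fun l _ => ?_
      rw [h2]
      have h5 := hlip j hj l (ε • k)
      rw [norm_smul, Real.norm_of_nonneg hε.le] at h5
      have h6 : |lamJ S ω κ j l (ε • k)| ≤ |lamJ S ω κ j l 0| + Λ * (ε * ‖k‖) := by
        have := abs_sub_abs_le_abs_sub (lamJ S ω κ j l (ε • k)) (lamJ S ω κ j l 0)
        linarith
      have h7 := norm_inner_psiJ_le S κ j l (ε • k) (a j k)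
      calc _ ≤ (|lamJ S ω κ j l 0| + Λ * (ε * ‖k‖))
              * ‖inner ℂ (psiJ S κ j l (ε • k)) (a j k)‖ := by gcongr
        _ = |lamJ S ω κ j l 0| * ‖inner ℂ (psiJ S κ j l (ε • k)) (a j k)‖
              + Λ * ε * (‖k‖ * ‖inner ℂ (psiJ S κ j l (ε • k)) (a j k)‖) := by ring
        _ ≤ _ := by gcongr
    rw [Finset.sum_add_distrib, Finset.sum_const, Finset.card_univ, Fintype.card_fin,
      nsmul_eq_mul] at h4
    have h8 : ∑ l, |lamJ S ω κ j l 0| / ε * ‖c l k‖ = (∑ l, |lamJ S ω κ j l 0| * ‖c l k‖) / ε := by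
      rw [Finset.sum_div]
      exact Finset.sum_congr rfl fun l _ => by ring
    rw [h8, one_div, inv_mul_le_iff₀ hε]
    have h9 : ε * ((∑ l, |lamJ S ω κ j l 0| * ‖c l k‖) / ε + n * Λ * (‖k‖ * ‖a j k‖))
        = (∑ l, |lamJ S ω κ j l 0| * ‖c l k‖) + n * (Λ * ε * (‖k‖ * ‖a j k‖)) := by
      field_simp
    rw [h9]
    exact h3.trans h4
  have hcm : ∀ l ∈ (Finset.univ : Finset (Fin n)),
      AEStronglyMeasurable (fun k => |lamJ S ω κ j l 0| / ε * ‖c l k‖) := fun l _ =>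
    (L1.integrable_coeFn (c l)).1.norm.const_mul _
  have h1 : wnorm w (fun k => ∑ l, |lamJ S ω κ j l 0| / ε * ‖c l k‖)
      ≤ ENNReal.ofReal ((∑ i ∈ modes n, |lamJ S ω κ i.1 i.2 0|
        * wreal w (component S κ ε i.1 i.2 (a i.1))) / ε) := by
    calc _ ≤ ∑ l, wnorm w (fun k => |lamJ S ω κ j l 0| / ε * ‖c l k‖) := wnorm_sum_le _ hw hcm
      _ ≤ ∑ l, ENNReal.ofReal (|lamJ S ω κ j l 0| / ε * wreal w (c l)) := by
        refine Finset.sum_le_sum fun l _ => ?_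
        rw [ENNReal.ofReal_mul (by positivity), ofReal_wreal hN]
        refine wnorm_le_of_ae (Real.toNNReal _) (ae_of_all _ fun k => ?_)
        rw [Real.coe_toNNReal _ (by positivity), norm_mul, norm_norm,
          Real.norm_of_nonneg (by positivity)]
        exact le_of_eq (by ring)
      _ = ENNReal.ofReal (∑ l, |lamJ S ω κ j l 0| / ε * wreal w (c l)) :=
        (ENNReal.ofReal_sum_of_nonneg fun l _ =>
          mul_nonneg (by positivity) (wreal_nonneg _ _)).symm
      _ ≤ _ := by
        apply ENNReal.ofReal_le_ofReal
        have h2 := sum_le_sum_modes (n := n)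
          (f := fun i => |lamJ S ω κ i.1 i.2 0| * wreal w (component S κ ε i.1 i.2 (a i.1)))
          (fun i => mul_nonneg (abs_nonneg _) (wreal_nonneg _ _)) (by simp [hS]) hj
        rw [le_div_iff₀ hε, Finset.sum_mul]
        refine le_trans (le_of_eq ?_) h2
        refine Finset.sum_congr rfl fun l _ => ?_
        field_simp
        rfl
  have h2 : wnorm w (fun k => n * Λ * (‖k‖ * ‖a j k‖)) ≤ ENNReal.ofReal (n * Λ * B) := by
    rw [ENNReal.ofReal_mul (by positivity)]
    refine le_trans ?_ (mul_le_mul_right hWB _)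
    refine wnorm_le_of_ae (Real.toNNReal _) (ae_of_all _ fun k => ?_)
    rw [Real.coe_toNNReal _ (by positivity), Real.norm_of_nonneg (by positivity)]
    have h3 : (w k : ℝ) * ‖k‖ ≤ W k := by
      have : (w k : ℝ) * (1 + ‖k‖) ≤ W k := by exact_mod_cast hwW k
      nlinarith [(w k).coe_nonneg]
    calc (w k : ℝ) * (n * Λ * (‖k‖ * ‖a j k‖)) = n * Λ * ((w k * ‖k‖) * ‖a j k‖) := by ring
      _ ≤ _ := by gcongr
  refine (wnorm_mono_ae hpt).trans ?_
  have hm : AEStronglyMeasurable (fun k => ∑ l, |lamJ S ω κ j l 0| / ε * ‖c l k‖) :=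
    Finset.aestronglyMeasurable_fun_sum _ hcm
  refine (wnorm_add_le hw hm _).trans ((add_le_add h1 h2).trans (le_of_eq ?_))
  rw [← ENNReal.ofReal_add _ (by positivity)]
  exact div_nonneg (Finset.sum_nonneg fun i _ => mul_nonneg (abs_nonneg _) (wreal_nonneg _ _)) hε.le

/-- By the product rule each term contains one time derivative, of size 1/ε times the noncritical
components plus O(1). The factor ε² of the normal form will leave a coefficient of size ε in front
of those components. -/
theorem Evolution.exists_hasDerivWithinAt_nonlin
    {T : (Fin n → ℝ) →ₗ[ℝ] (Fin n → ℝ) →ₗ[ℝ] (Fin n → ℝ) →ₗ[ℝ] (Fin n → ℝ)}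
    (hA : ∀ l, (A l).IsSymm) (hE : Em.transpose = -Em)
    (hS : lamJ S ω κ 1 0 0 = 0) {Λ : ℝ} (hΛ : 0 ≤ Λ)
    (hlip : ∀ j ∈ ({1, 3} : Finset ℤ), ∀ l θ,
      |lamJ S ω κ j l θ - lamJ S ω κ j l 0| ≤ Λ * ‖θ‖)
    {ε τ : ℝ} (hε : 0 < ε) (hε1 : ε ≤ 1) {a : ℤ → ℝ → L1 d (Vec n)}
    (ha : Evolution A Em T ω κ ε τ a) {w W : Space d → ℝ≥0} (hw : Measurable w) {N : ℝ≥0}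
    (hN : ∀ k, w k ≤ N) (heven : ∀ k, w (-k) = w k) (hmul : ∀ x y, w (x + y) ≤ w x * w y)
    (hwW : ∀ k, w k * (1 + ‖k‖₊) ≤ W k) {B : ℝ} (hB : 0 ≤ B)
    {t : ℝ} (ht : t ∈ Icc 0 τ)
    (hWB : ∀ j ∈ ({1, 3} : Finset ℤ), wnorm W (a j t) ≤ ENNReal.ofReal B) (j : ℤ) :
    ∃ F' : L1 d (Vec n), HasDerivWithinAt (fun x => nonlin T j fun i => a i x) F' (Icc 0 τ) t ∧
      wnorm w F' ≤ ENNReal.ofReal (nonlinConst T d * (3 * B ^ 2 *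
        ((∑ i ∈ modes n, |lamJ S ω κ i.1 i.2 0|
          * wreal w (component S κ ε i.1 i.2 (a i.1 t))) / ε + n * Λ * B
          + nonlinConst T d * B ^ 3))) := by
  have hc := nonlinConst_nonneg (d := d) T
  have hle : ∀ k, w k ≤ W k := fun k => by
    refine le_trans ?_ (hwW k)
    rw [mul_add, mul_one]
    exact le_self_add
  have hwB : ∀ i ∈ harmonics, wnorm w (a i t) ≤ ENNReal.ofReal B :=
    ha.wnorm_le heven ht fun j hj => (wnorm_mono_weight _ hle).trans (hWB j hj)
  set q : ℝ := (∑ i ∈ modes n, |lamJ S ω κ i.1 i.2 0|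
    * wreal w (component S κ ε i.1 i.2 (a i.1 t))) / ε with hq
  have hq0 : 0 ≤ q :=
    div_nonneg (Finset.sum_nonneg fun i _ => mul_nonneg (abs_nonneg _) (wreal_nonneg _ _)) hε.le
  have hnn : 0 ≤ nonlinConst T d * B ^ 3 := by positivity
  have hder : ∀ j ∈ ({1, 3} : Finset ℤ), ∃ v, HasDerivWithinAt (a j) v (Icc 0 τ) t ∧
      wnorm w v ≤ ENNReal.ofReal (q + n * Λ * B + nonlinConst T d * B ^ 3) := by
    intro j hj
    obtain ⟨β, hβ, hd⟩ := ha.deriv j hj t ht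
    refine ⟨_, hd, (wnorm_coe_add_le hw _ _).trans ?_⟩
    rw [ENNReal.ofReal_add (by positivity) hnn]
    have h0 := wnorm_linear_part_le S ω κ hA hE hS hΛ hlip hε hw hN hwW hB (a := fun i => a i t) hj
      (hWB j hj) hβ
    refine add_le_add h0 ?_
    refine (wnorm_coe_smul_le w ε _).trans ?_
    have h1 := wnorm_nonlin_le_mul T hw hmul j hB hwB
    refine (mul_le_mul_right h1 _).trans ?_
    rw [Real.norm_of_nonneg hε.le, ← ENNReal.ofReal_mul hε.le]
    exact ENNReal.ofReal_le_ofReal (mul_le_of_le_one_left hnn hε1)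
  -- Negative harmonics inherit derivative and bound by conjugation, as w is even. Outside the
  -- harmonics the value is a dummy.
  have hder' : ∀ i, ∃ v, i ∈ harmonics → HasDerivWithinAt (a i) v (Icc 0 τ) t ∧
      wnorm w v ≤ ENNReal.ofReal (q + n * Λ * B + nonlinConst T d * B ^ 3) := by
    intro i
    by_cases hi : i ∈ harmonics
    · obtain ⟨j, hj, rfl | rfl⟩ := cases_of_mem_harmonics hi
      · obtain ⟨v, hv⟩ := hder _ hj
        exact ⟨v, fun _ => hv⟩
      · obtain ⟨v, hv, hv'⟩ := hder _ hj
        refine ⟨conjRefl v, fun _ => ⟨?_, by rwa [wnorm_conjRefl heven]⟩⟩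
        exact (conjRefl.hasFDerivAt.comp_hasDerivWithinAt t hv).congr
          (fun s hs => ha.conj j hj s hs) (ha.conj j hj t ht)
    · exact ⟨0, fun h => absurd h hi⟩
  choose a' ha' using hder'
  obtain ⟨F', hF', hb⟩ := Envelope.exists_hasDerivWithinAt_nonlin T j fun i hi => (ha' i hi).1
  exact ⟨F', hF', hb w hw hmul B _ hB (by positivity) hwB fun i hi => (ha' i hi).2⟩

end Components

end

/-! ### Gronwall argument for the noncritical components -/

section

variable {d n : ℕ}

section ComponentsBound

variable [NeZero n] {A : Fin d → Matrix (Fin n) (Fin n) ℝ} {Em : Matrix (Fin n) (Fin n) ℝ}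
  (S : ℤ → SmoothEigen A Em) (ω : ℝ) (κ : Space d)

/-- For εt ≤ T the exponent is at most KT, and the forcing contributes ε²L/(εK) = εL/K; the whole
bound scales like ε. -/
theorem gronwallBound_scaled_le {δ K L ε t T : ℝ} (hδ : 0 ≤ δ) (hK : 0 < K) (hL : 0 ≤ L)
    (hε : 0 < ε) (ht : ε * t ≤ T) :
    gronwallBound (ε * δ) (ε * K) (ε ^ 2 * L) t ≤ ε * ((δ + L / K) * Real.exp (K * T)) := by
  rw [gronwallBound_of_K_ne_0 (mul_pos hε hK).ne']
  have h1 : Real.exp (ε * K * t) ≤ Real.exp (K * T) := by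
    apply Real.exp_le_exp.mpr
    nlinarith
  have h2 : ε ^ 2 * L / (ε * K) = ε * (L / K) := by field_simp
  have h3 : 0 ≤ L / K := by positivity
  rw [h2]
  have h4 := mul_le_mul_of_nonneg_left h1 (mul_nonneg hε.le hδ)
  have h5 := mul_le_mul_of_nonneg_left h1 (mul_nonneg hε.le h3)
  have h6 : 0 ≤ ε * (L / K) := by positivity
  nlinarith

set_option maxHeartbeats 1000000 in
/-- The noncritical components stay of size `O(ε)` on the time scale `1/ε`. -/
theorem exists_component_bound (hA : ∀ l, (A l).IsSymm) (hE : Em.transpose = -Em)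
    (T : (Fin n → ℝ) →ₗ[ℝ] (Fin n → ℝ) →ₗ[ℝ] (Fin n → ℝ) →ₗ[ℝ] (Fin n → ℝ))
    (hS : lamJ S ω κ 1 0 0 = 0) (hμ : ∀ i ∈ modes n, lamJ S ω κ i.1 i.2 0 ≠ 0) (tend : ℝ)
    {B q₀ : ℝ} (hB : 0 ≤ B) (hq₀ : 0 ≤ q₀) :
    ∃ C : ℝ, 0 ≤ C ∧ ∀ ε : ℝ, 0 < ε → ε ≤ 1 → ∀ τ, ε * τ ≤ tend → ∀ a : ℤ → ℝ → L1 d (Vec n),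
      Evolution A Em T ω κ ε τ a → ∀ w W : Space d → ℝ≥0, Measurable w → (∃ N, ∀ k, w k ≤ N) →
      (∀ k, w (-k) = w k) → (∀ x y, w (x + y) ≤ w x * w y) → Measurable W →
      (∀ k, W (-k) = W k) → (∀ x y, W (x + y) ≤ W x * W y) → (∀ k, 1 + ‖k‖₊ ≤ W k) →
      (∀ k, w k * (1 + ‖k‖₊) ≤ W k) →
      (∀ t ∈ Icc 0 τ, ∀ j ∈ ({1, 3} : Finset ℤ), wnorm W (a j t) ≤ ENNReal.ofReal B) →
      (∀ i ∈ modes n, wnorm w (component S κ ε i.1 i.2 (a i.1 0)) ≤ ENNReal.ofReal (q₀ * ε)) →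
      ∀ t ∈ Icc 0 τ, ∀ i ∈ modes n,
        wnorm w (component S κ ε i.1 i.2 (a i.1 t)) ≤ ENNReal.ofReal (C * ε) := by
  obtain ⟨Λ, hΛ, hlip⟩ := exists_lamJ_lipschitz S ω κ
  set c₀ := nonlinConst T d with hc₀
  have hc : 0 ≤ c₀ := nonlinConst_nonneg T
  set X := c₀ * B ^ 3 with hX
  have hX0 : 0 ≤ X := by positivity
  set R := ∑ i ∈ modes n, 1 / |lamJ S ω κ i.1 i.2 0| with hR
  have hR0 : 0 ≤ R := Finset.sum_nonneg fun i _ => by positivity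
  set Mμ := ∑ i ∈ modes n, |lamJ S ω κ i.1 i.2 0| with hMμ
  have hM0 : 0 ≤ Mμ := Finset.sum_nonneg fun i _ => abs_nonneg _
  -- `K - 1` is the feedback of the noncritical components through the time derivative of the
  -- nonlinearity; the added 1 keeps K positive for the division by K.
  set K := R * (c₀ * (3 * B ^ 2 * Mμ)) + 1 with hK
  have hK0 : 0 < K := by positivity
  -- Forcing from the detuning and from the bounded part of the time derivative, plus the cost of
  -- replacing q by the norms of the normal forms.
  set L := R * (Λ * X + c₀ * (3 * B ^ 2 * (n * Λ * B + X))) + K * (R * X) with hL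
  have hL0 : 0 ≤ L := by positivity
  set δ := (modes n).card * q₀ + R * X with hδ
  have hδ0 : 0 ≤ δ := by positivity
  -- Gronwall's bound for the normal forms, plus `R * X` for the return to the components, where ε²
  -- ≤ ε.
  refine ⟨(δ + L / K) * Real.exp (K * tend) + R * X, by positivity, ?_⟩
  intro ε hε hε1 τ hτ a ha w W hw ⟨N, hN⟩ heven hmul hW hWeven hWmul hW1 hwW hWB hq t ht i hi
  have hle : ∀ k, w k ≤ W k := fun k => by
    refine le_trans ?_ (hwW k)
    rw [mul_add, mul_one]
    exact le_self_add
  set y : ℤ × Fin n → ℝ → L1 d ℂ := fun i s =>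
    normalForm S ω κ ε i.1 i.2 (a i.1 s) (nonlin T i.1 fun m => a m s) with hy
  set q : ℝ → ℝ := fun s => ∑ i ∈ modes n, wreal w (component S κ ε i.1 i.2 (a i.1 s)) with hqdef
  have hFW : ∀ j, ∀ s ∈ Icc 0 τ, wnorm W (nonlin T j fun m => a m s) ≤ ENNReal.ofReal X :=
    fun j s hs => wnorm_nonlin_le_mul T hW hWmul j hB (ha.wnorm_le hWeven hs (hWB s hs))
  have hFw : ∀ j, ∀ s ∈ Icc 0 τ, wnorm w (nonlin T j fun m => a m s) ≤ ENNReal.ofReal X :=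
    fun j s hs => (wnorm_mono_weight _ hle).trans (hFW j s hs)
  have hRsum : ∀ x : ℝ, ∑ i ∈ modes n, ε ^ 2 / |lamJ S ω κ i.1 i.2 0| * x = ε ^ 2 * (R * x) := by
    intro x
    rw [hR, Finset.sum_mul, Finset.mul_sum]
    exact Finset.sum_congr rfl fun i _ => by ring
  have hyq : ∀ s ∈ Icc 0 τ, ∑ i ∈ modes n, wreal w (y i s) ≤ q s + ε ^ 2 * (R * X) := by
    intro s hs
    rw [hqdef, ← hRsum, ← Finset.sum_add_distrib]
    exact Finset.sum_le_sum fun i _ =>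
      (wreal_normalForm_le S ω κ hw hN hX0 (hFw i.1 s hs)).1
  have hqy : ∀ s ∈ Icc 0 τ, q s ≤ (∑ i ∈ modes n, wreal w (y i s)) + ε ^ 2 * (R * X) := by
    intro s hs
    rw [hqdef, ← hRsum, ← Finset.sum_add_distrib]
    exact Finset.sum_le_sum fun i _ =>
      (wreal_normalForm_le S ω κ hw hN hX0 (hFw i.1 s hs)).2
  have hqM : ∀ s, ∑ i ∈ modes n, |lamJ S ω κ i.1 i.2 0|
      * wreal w (component S κ ε i.1 i.2 (a i.1 s)) ≤ Mμ * q s := by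
    intro s
    rw [hMμ, Finset.sum_mul]
    refine Finset.sum_le_sum fun i hi => mul_le_mul_of_nonneg_left ?_ (abs_nonneg _)
    exact Finset.single_le_sum (f := fun i : ℤ × Fin n =>
      wreal w (component S κ ε i.1 i.2 (a i.1 s))) (fun i _ => wreal_nonneg _ _) hi
  have hq0 : ∀ s, 0 ≤ q s := fun s => Finset.sum_nonneg fun i _ => wreal_nonneg _ _
  set Y : ℝ → ℝ := fun s => c₀ * (3 * B ^ 2 * (Mμ * q s / ε + n * Λ * B + X)) with hYdef
  have hY0 : ∀ s, 0 ≤ Y s := fun s => by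
    have := hq0 s
    positivity
  have hslope : ∀ s ∈ Ico 0 τ, ∀ i ∈ modes n, RightSlopeLE (fun x => wreal w (y i x))
      (ε ^ 2 / |lamJ S ω κ i.1 i.2 0| * (Λ * X + Y s)) s := by
    intro s hs i hi
    have hs' : s ∈ Icc 0 τ := ⟨hs.1, hs.2.le⟩
    have hj := fst_mem_of_mem_modes hi
    obtain ⟨β, hβ, hd⟩ := ha.deriv i.1 hj s hs'
    obtain ⟨F', hF', hb⟩ := ha.exists_hasDerivWithinAt_nonlin S ω κ hA hE hS hΛ hlip hε hε1 hw hN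
      heven hmul hwW hB hs' (hWB s hs') i.1
    refine rightSlopeLE_normalForm S ω κ hA hE hε (hμ i hi) hΛ (hlip i.1 hj i.2) hβ
      (F := fun x => nonlin T i.1 fun m => a m x) (hd.Ici_of_Icc hs)
      (hF'.Ici_of_Icc hs) hw hN hW hW1 hwW hX0 (hY0 s) (hFW _ s hs')
      (hb.trans (ENNReal.ofReal_le_ofReal ?_))
    rw [hYdef]
    have := hqM s
    dsimp only
    gcongr
  have hcont : ContinuousOn (fun s => ∑ i ∈ modes n, wreal w (y i s)) (Icc 0 τ) := by
    refine continuousOn_finsetSum _ fun i hi => ?_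
    refine (continuous_wreal hw hN).comp_continuousOn ?_
    have hj := fst_mem_of_mem_modes hi
    have hnl : ContinuousOn (fun x => nonlin T i.1 fun m => a m x) (Icc 0 τ) := fun s hs => by
      obtain ⟨F', hF', -⟩ := ha.exists_hasDerivWithinAt_nonlin S ω κ hA hE hS hΛ hlip hε hε1 hw hN
        heven hmul hwW hB hs (hWB s hs) i.1
      exact hF'.continuousWithinAt
    exact ((component S κ ε i.1 i.2).continuous.comp_continuousOn (ha.continuousOn hj)).add
      (((component S κ ε i.1 i.2).continuous.comp_continuousOn hnl).const_smul
        (Complex.I * ((ε ^ 2 / lamJ S ω κ i.1 i.2 0 : ℝ) : ℂ)))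
  have h0mem : (0 : ℝ) ∈ Icc 0 τ := ⟨le_rfl, ht.1.trans ht.2⟩
  have hinit : ∑ i ∈ modes n, wreal w (y i 0) ≤ ε * δ := by
    refine (hyq 0 h0mem).trans ?_
    have h1 : q 0 ≤ (modes n).card * (q₀ * ε) := by
      rw [hqdef, ← nsmul_eq_mul]
      exact Finset.sum_le_card_nsmul _ _ _ fun i hi =>
        wreal_le_of_wnorm_le (by positivity) (hq i hi)
    have h2 : ε ^ 2 * (R * X) ≤ ε * (R * X) := by
      have : ε ^ 2 ≤ ε := by nlinarith
      have : 0 ≤ R * X := by positivity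
      gcongr
    rw [hδ]
    linarith
  have key := le_gronwallBound_of_rightSlopeLE (T := τ) (δ := ε * δ) (K := ε * K) (e := ε ^ 2 * L)
    hcont (fun s hs => RightSlopeLE.sum (modes n) (hslope s hs)) hinit (fun s hs => by
      have hs' : s ∈ Icc 0 τ := ⟨hs.1, hs.2.le⟩
      rw [hRsum]
      set Z := ∑ i ∈ modes n, wreal w (y i s)
      -- The 1/ε in `Y` cancels one power of ε; this produces the closed linear inequality with
      -- coefficient εK and forcing of size ε².
      have h1 : ε ^ 2 * (R * (Λ * X + Y s)) = ε * ((K - 1) * q s)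
          + ε ^ 2 * (R * (Λ * X + c₀ * (3 * B ^ 2 * (n * Λ * B + X)))) := by
        rw [hYdef, hK]
        field_simp
        ring
      have h2 : (K - 1) * q s ≤ K * (Z + ε ^ 2 * (R * X)) := by
        have := mul_le_mul_of_nonneg_left (hqy s hs') hK0.le
        linarith [hq0 s]
      have h3 := mul_le_mul_of_nonneg_left h2 hε.le
      have h4 : ε * (K * (ε ^ 2 * (R * X))) ≤ ε ^ 2 * (K * (R * X)) := by
        have h5 : 0 ≤ ε ^ 2 * (K * (R * X)) := by positivity
        calc ε * (K * (ε ^ 2 * (R * X))) = ε * (ε ^ 2 * (K * (R * X))) := by ring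
          _ ≤ _ := mul_le_of_le_one_left h5 hε1
      rw [h1, hL]
      linarith)
  have h1 := key t ht
  have h2 : ε * t ≤ tend := (mul_le_mul_of_nonneg_left ht.2 hε.le).trans hτ
  have h3 := h1.trans (gronwallBound_scaled_le hδ0 hK0 hL0 hε h2)
  have h4 : wreal w (component S κ ε i.1 i.2 (a i.1 t)) ≤ q t :=
    Finset.single_le_sum (f := fun i : ℤ × Fin n =>
      wreal w (component S κ ε i.1 i.2 (a i.1 t))) (fun i _ => wreal_nonneg _ _) hi
  have h5 := hqy t ht
  refine wnorm_le_of_wreal_le hN ?_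
  have h6 : ε ^ 2 * (R * X) ≤ ε * (R * X) := by
    have : ε ^ 2 ≤ ε := by nlinarith
    have : 0 ≤ R * X := by positivity
    gcongr
  linarith

end ComponentsBound

end

/-! ### Moments and polarization of the initial data -/

section

variable {d n : ℕ}

section InitialData

theorem contDiff_pderiv {r : ℕ} {f : Space d → Vec n} (hf : ContDiff ℝ (r + 1 : ℕ) f) (l : Fin d) :
    ContDiff ℝ r (pderiv l f) := by
  unfold pderiv
  exact (hf.fderiv_right (m := r) (by norm_cast)).clm_apply contDiff_const

theorem contDiff_iterate_pderiv (l : Fin d) (m : ℕ) {r : ℕ} {f : Space d → Vec n}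
    (hf : ContDiff ℝ (r + m : ℕ) f) : ContDiff ℝ r ((pderiv l)^[m] f) := by
  induction m generalizing f with
  | zero => exact hf
  | succ m ih =>
    rw [Function.iterate_succ_apply]
    exact ih (contDiff_pderiv (r := r + m) hf l)

theorem MemWs.hat_iterate_pderiv {s : ℕ} {f : Space d → Vec n} (h : MemWs s f) (l : Fin d) {m : ℕ}
    (hm : m ≤ s) :
    hat ((pderiv l)^[m] f) =ᵐ[volume] fun k => (Complex.I * ((k l : ℝ) : ℂ)) ^ m • hat f k := by
  induction m with
  | zero => simp
  | succ m ih =>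
    have hc : ContDiff ℝ 1 ((pderiv l)^[m] f) := by
      have : ContDiff ℝ (1 + m : ℕ) f := h.1.of_le (by
        rw [add_comm]
        exact_mod_cast hm)
      exact_mod_cast contDiff_iterate_pderiv l m this
    have h1 := h.memW_iterate_pderiv hm l
    rw [Function.iterate_succ_apply'] at h1 ⊢
    filter_upwards [ih (by omega), hat_pderiv hc (h.memW_iterate_pderiv (by omega) l) l h1]
      with k hk hk'
    rw [hk', hk, smul_smul, pow_succ']

theorem norm_le_sum_abs (k : Space d) : ‖k‖ ≤ ∑ l, |k l| := by
  have h : k = ∑ l, EuclideanSpace.single l (k l) := by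
    ext i
    simp
  calc ‖k‖ = ‖∑ l, EuclideanSpace.single l (k l)‖ := by rw [← h]
    _ ≤ ∑ l, ‖EuclideanSpace.single l (k l)‖ := norm_sum_le _ _
    _ = _ := by simp

/-- The largest of the d + 1 numbers 1, |k_l| bounds them all. In this form only the pure
derivatives ∂_l^s enter the moment bound. -/
theorem one_add_norm_pow_le (s : ℕ) (k : Space d) :
    (1 + ‖k‖) ^ s ≤ (d + 1) ^ s * (1 + ∑ l, |k l| ^ s) := by
  obtain ⟨i, -, hi⟩ := Finset.exists_max_image (Finset.univ : Finset (Option (Fin d)))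
    (fun o => o.elim 1 fun l => |k l|) ⟨none, Finset.mem_univ _⟩
  have h1 : 1 + ‖k‖ ≤ (d + 1) * i.elim 1 fun l => |k l| := by
    calc 1 + ‖k‖ ≤ 1 + ∑ l, |k l| := by gcongr; exact norm_le_sum_abs k
      _ = ∑ o : Option (Fin d), o.elim 1 fun l => |k l| := by simp [Fintype.sum_option]
      _ ≤ ∑ o : Option (Fin d), i.elim 1 fun l => |k l| :=
        Finset.sum_le_sum fun o _ => hi o (Finset.mem_univ _)
      _ = _ := by simp
  refine (pow_le_pow_left₀ (by positivity) h1 s).trans ?_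
  rw [mul_pow]
  gcongr
  have h0 : 0 ≤ ∑ l, |k l| ^ s := Finset.sum_nonneg fun l _ => by positivity
  cases i with
  | none => simpa using h0
  | some l =>
    have := Finset.single_le_sum (f := fun l => |k l| ^ s) (fun l _ => by positivity)
      (Finset.mem_univ l)
    simp only [Option.elim_some]
    linarith

theorem normW_mderiv_le_normWs {s : ℕ} (f : Space d → Vec n) {α : Fin d → ℕ} (h : ∑ l, α l ≤ s) :
    normW (mderiv α f) ≤ normWs s f := by
  unfold normWs
  refine le_trans ?_ (Finset.single_le_sum (fun m _ => zero_le)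
    (Finset.mem_range.mpr (Nat.lt_succ_of_le h)))
  exact Finset.single_le_sum (f := fun α => normW (mderiv α f)) (fun m _ => zero_le)
    (Finset.mem_piAntidiag.mpr ⟨rfl, fun _ _ => Finset.mem_univ _⟩)

theorem MemW.normL1_hat {f : Space d → Vec n} (h : MemW f) : normL1 (hat f) = normW f := by
  rw [normW, if_pos h]

theorem wnorm_one_hatL1 (f : Space d → Vec n) : wnorm 1 (hatL1 f) = normL1 (hat f) := by
  rw [wnorm_congr_ae (w := 1) (g := hat f) ((coeFn_hatL1 f).mono fun k hk => by rw [hk])]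
  simp [wnorm, normL1]

theorem MemWs.wnorm_one_le {s : ℕ} {f : Space d → Vec n} (h : MemWs s f) :
    wnorm 1 (hatL1 f) ≤ normWs s f := by
  rw [wnorm_one_hatL1, h.memW.normL1_hat]
  simpa [mderiv_zero] using normW_mderiv_le_normWs (s := s) f (α := 0) (by simp)

/-- Moments of the Fourier transform are controlled by the norm of `W^s`. -/
theorem MemWs.wnorm_polyWeight_le {s : ℕ} {f : Space d → Vec n} (h : MemWs s f) :
    wnorm (polyWeight d s) (hatL1 f) ≤ ENNReal.ofReal ((d + 1) ^ (s + 1)) * normWs s f := by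
  have hm : ∀ l, normL1 (hat ((pderiv l)^[s] f)) ≤ normWs s f := fun l => by
    rw [(h.memW_iterate_pderiv le_rfl l).normL1_hat, ← mderiv_single]
    exact normW_mderiv_le_normWs f (by simp)
  have h0 : normL1 (hat f) ≤ normWs s f := by
    rw [← wnorm_one_hatL1]
    exact h.wnorm_one_le
  have key : wnorm (polyWeight d s) (hatL1 f) ≤ ENNReal.ofReal ((d + 1) ^ s)
      * (normL1 (hat f) + ∑ l, normL1 (hat ((pderiv l)^[s] f))) := by
    unfold wnorm normL1
    rw [← lintegral_finsetSum' _ fun l _ => (integrable_hat _).1.enorm,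
      ← lintegral_add_left' (integrable_hat f).1.enorm,
      ← lintegral_const_mul' _ _ ENNReal.ofReal_ne_top]
    apply lintegral_mono_ae
    filter_upwards [coeFn_hatL1 f, ae_all_iff.mpr fun l => h.hat_iterate_pderiv l le_rfl]
      with k h1 h2
    rw [h1]
    simp only [← ofReal_norm, ← ENNReal.ofReal_coe_nnreal]
    rw [← ENNReal.ofReal_sum_of_nonneg fun l _ => norm_nonneg _,
      ← ENNReal.ofReal_add (norm_nonneg _) (Finset.sum_nonneg fun l _ => norm_nonneg _),
      ← ENNReal.ofReal_mul (by positivity), ← ENNReal.ofReal_mul (by positivity)]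
    apply ENNReal.ofReal_le_ofReal
    have h3 : ∀ l, ‖hat ((pderiv l)^[s] f) k‖ = |k l| ^ s * ‖hat f k‖ := fun l => by
      rw [h2 l, norm_smul, norm_pow, norm_mul, Complex.norm_I, one_mul, Complex.norm_real,
        Real.norm_eq_abs]
    have h4 := mul_le_mul_of_nonneg_right (one_add_norm_pow_le s k) (norm_nonneg (hat f k))
    simp only [h3]
    rw [← Finset.sum_mul, ← one_add_mul, ← mul_assoc]
    simpa [polyWeight] using h4
  refine key.trans ?_
  calc _ ≤ ENNReal.ofReal ((d + 1) ^ s) * (normWs s f + ∑ l : Fin d, normWs s f) := by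
        gcongr with l
        exact hm l
    _ = ENNReal.ofReal ((d + 1) ^ s) * ENNReal.ofReal (d + 1) * normWs s f := by
        rw [Finset.sum_const, Finset.card_univ, Fintype.card_fin, nsmul_eq_mul, mul_assoc]
        congr 1
        rw [ENNReal.ofReal_add (by positivity) (by positivity), ENNReal.ofReal_natCast,
          ENNReal.ofReal_one]
        ring
    _ = _ := by rw [← ENNReal.ofReal_mul (by positivity), pow_succ]

theorem hatL1_eq_zero {f : Space d → Vec n} (h : MemW f) (h0 : ∀ x, f x = 0) : hatL1 f = 0 :=
  eq_of_invFourierL_eq fun x => by rw [invFourierL_hatL1 h, h0, map_zero]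

/-- A constant matrix commutes with the Fourier transform, so polarization at every x becomes
polarization of the transform at almost every k. -/
theorem mapL_hatL1_eq_zero {f : Space d → Vec n} (h : MemW f) {B : Vec n →L[ℂ] Vec n}
    (h0 : ∀ x, B (f x) = 0) : ∀ᵐ k, B (hatL1 f k) = 0 := by
  have e : mapL B (hatL1 f) = 0 := eq_of_invFourierL_eq fun x => by
    rw [invFourierL_mapL, invFourierL_hatL1 h, h0, map_zero]
  filter_upwards [coeFn_mapL B (hatL1 f), Lp.coeFn_zero (Vec n) 1 (volume : Measure (Space d))]
    with k h1 h2
  rw [← h1, e, h2]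
  rfl

variable [NeZero n] {A : Fin d → Matrix (Fin n) (Fin n) ℝ} {Em : Matrix (Fin n) (Fin n) ℝ}
  (S : ℤ → SmoothEigen A Em) (ω : ℝ) (κ : Space d)

/-- The noncritical components of polarized data are of size `O(ε)`. -/
theorem exists_polarized_component_bound (hA : ∀ l, (A l).IsSymm) (hE : Em.transpose = -Em)
    (hμ : ∀ i ∈ modes n, lamJ S ω κ i.1 i.2 0 ≠ 0) :
    ∃ Q : ℝ≥0, ∀ ε : ℝ≥0, ∀ v : L1 d (Vec n), (∀ᵐ k, symL A Em ω κ (v k) = 0) →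
      ∀ w W : Space d → ℝ≥0, (∀ k, w k * (1 + ‖k‖₊) ≤ W k) → ∀ l, (1, l) ∈ modes n →
      wnorm w (component S κ ε 1 l v) ≤ (Q * ε : ℝ≥0) * wnorm W v := by
  obtain ⟨Λ, hΛ, hlip⟩ := exists_lamJ_lipschitz S ω κ
  set a : Fin d → Vec n →L[ℂ] Vec n := fun l =>
    LinearMap.toContinuousLinearMap (Matrix.toEuclideanLin ((A l).map Complex.ofReal)) with ha
  set c : ℝ := ∑ l, ‖a l‖ with hc
  set R := ∑ i ∈ modes n, 1 / |lamJ S ω κ i.1 i.2 0| with hR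
  have hR0 : 0 ≤ R := Finset.sum_nonneg fun i _ => by positivity
  have hc0 : 0 ≤ c := Finset.sum_nonneg fun i _ => by positivity
  have hcΛ : 0 ≤ c + Λ := by positivity
  refine ⟨(R * (c + Λ)).toNNReal, fun ε v hv w W hwW l hl => ?_⟩
  refine wnorm_le_of_ae _ ?_
  filter_upwards [coeFn_component S κ ε 1 l v, hv] with k hk hvk
  rw [hk]
  set x := v k
  set ψ := psiJ S κ 1 l ((ε : ℝ) • k)
  -- Two evaluations of ⟨ψ, L(ω, κ + εk)v⟩ are compared: it equals λ(εk)⟨ψ, v⟩, and since L(ω, κ)v =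
  -- 0 it also equals ⟨ψ, εA(k)v⟩ = O(ε|k||v|).
  have h1 := inner_psiJ_symL S ω κ hA hE 1 l ((ε : ℝ) • k) x
  rw [symL_shift] at h1
  simp only [Int.cast_one, one_mul, one_smul] at h1
  rw [hvk, zero_add] at h1
  have h2 : |lamJ S ω κ 1 l ((ε : ℝ) • k)| * ‖inner ℂ ψ x‖ ≤ ε * ‖k‖ * (c * ‖x‖) := by
    have h3 : ‖∑ m, ((((ε : ℝ) • k) m : ℝ) : ℂ) • a m x‖ ≤ ε * ‖k‖ * (c * ‖x‖) := by
      refine (norm_sum_le _ _).trans ?_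
      rw [hc, Finset.sum_mul, Finset.mul_sum]
      refine Finset.sum_le_sum fun m _ => ?_
      rw [norm_smul, Complex.norm_real, PiLp.smul_apply, norm_smul, Real.norm_eq_abs,
        NNReal.abs_eq]
      gcongr
      · exact PiLp.norm_apply_le k m
      · exact (a m).le_opNorm x
    calc _ = ‖inner ℂ ψ (∑ m, ((((ε : ℝ) • k) m : ℝ) : ℂ) • a m x)‖ := by
          erw [h1]
          rw [norm_mul, Complex.norm_real, Real.norm_eq_abs]
      _ ≤ ‖ψ‖ * _ := norm_inner_le_norm _ _
      _ ≤ _ := by rw [norm_psiJ, one_mul]; exact h3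
  -- λ(εk) itself may vanish for some k. It is replaced by λ(0) ≠ 0, with an error of the same order
  -- ε|k|.
  have h3 : |lamJ S ω κ 1 l 0| ≤ |lamJ S ω κ 1 l ((ε : ℝ) • k)| + Λ * (ε * ‖k‖) := by
    have h4 := hlip 1 (by simp) l ((ε : ℝ) • k)
    rw [norm_smul, Real.norm_eq_abs, NNReal.abs_eq] at h4
    have h5 := abs_sub_abs_le_abs_sub (lamJ S ω κ 1 l 0) (lamJ S ω κ 1 l ((ε : ℝ) • k))
    rw [abs_sub_comm] at h5
    linarith
  have h4 : ‖inner ℂ ψ x‖ ≤ ‖x‖ := norm_inner_psiJ_le S κ 1 l _ x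
  have h5 : |lamJ S ω κ 1 l 0| * ‖inner ℂ ψ x‖ ≤ ε * ‖k‖ * ((c + Λ) * ‖x‖) := by
    have e1 := mul_le_mul_of_nonneg_right h3 (norm_nonneg (inner ℂ ψ x))
    have e2 : Λ * (ε * ‖k‖) * ‖inner ℂ ψ x‖ ≤ Λ * (ε * ‖k‖) * ‖x‖ := by gcongr
    linarith
  have h6 : 1 / |lamJ S ω κ 1 l 0| ≤ R :=
    Finset.single_le_sum (f := fun i : ℤ × Fin n => 1 / |lamJ S ω κ i.1 i.2 0|)
      (fun i _ => by positivity) hl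
  have hpos : 0 < |lamJ S ω κ 1 l 0| := abs_pos.mpr (hμ _ hl)
  have h7 : ‖inner ℂ ψ x‖ ≤ R * (ε * ‖k‖ * ((c + Λ) * ‖x‖)) := by
    calc ‖inner ℂ ψ x‖ = 1 / |lamJ S ω κ 1 l 0| * (|lamJ S ω κ 1 l 0| * ‖inner ℂ ψ x‖) := by
          field_simp
      _ ≤ _ := by gcongr
  have h8 : (w k : ℝ) * ‖k‖ ≤ W k := by
    have h9 : (w k : ℝ) * (1 + ‖k‖) ≤ W k := by exact_mod_cast hwW k
    have : (0 : ℝ) ≤ w k := (w k).2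
    linarith
  calc (w k : ℝ) * ‖inner ℂ ψ x‖ ≤ w k * (R * (ε * ‖k‖ * ((c + Λ) * ‖x‖))) := by gcongr
    _ = R * (c + Λ) * ε * (w k * ‖k‖ * ‖x‖) := by ring
    _ ≤ R * (c + Λ) * ε * (W k * ‖x‖) := by gcongr
    _ = _ := by rw [NNReal.coe_mul, Real.coe_toNNReal _ (by positivity)]

end InitialData

end

/-! ### The transformed variables and the scaled norm -/

section

variable {d n : ℕ}

section TransformedVariables

variable {A : Fin d → Matrix (Fin n) (Fin n) ℝ} {Em : Matrix (Fin n) (Fin n) ℝ}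
  (S : ℤ → SmoothEigen A Em) (ω : ℝ) (κ : Space d) (ε : ℝ) (u : ℤ → ℝ → Space d → Vec n)

/-- The diagonal factor consists of phases of modulus one, so time disappears and the entries of z
have the moduli of the spectral components of û. -/
theorem norm_zVar_apply (j : ℤ) (t : ℝ) (k : Space d) (l : Fin n) :
    ‖zVar S ω κ ε u j t k l‖ = ‖inner ℂ (psiJ S κ j l (ε • k)) (hat (u j t) k)‖ := by
  have h : zVar S ω κ ε u j t k l
      = Complex.exp (Complex.I * (t : ℂ) / (ε : ℂ) * (lamJ S ω κ j l (ε • k) : ℂ))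
        * inner ℂ (psiJ S κ j l (ε • k)) (hat (u j t) k) := by
    simp only [zVar, SMat, Matrix.toLpLin_apply, ← Matrix.mulVec_mulVec, Matrix.mulVec_diagonal]
    congr 1
    simp only [Matrix.mulVec, dotProduct, Matrix.conjTranspose_apply, PsiJ, Matrix.of_apply,
      PiLp.inner_apply, RCLike.inner_apply]
    exact Finset.sum_congr rfl fun i _ => mul_comm _ _
  have e : Complex.I * (t : ℂ) / (ε : ℂ) * (lamJ S ω κ j l (ε • k) : ℂ)
      = ((t / ε * lamJ S ω κ j l (ε • k) : ℝ) : ℂ) * Complex.I := by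
    push_cast
    ring
  rw [h, norm_mul, e, Complex.norm_exp_ofReal_mul_I, one_mul]

theorem norm_zVar (j : ℤ) (t : ℝ) (k : Space d) :
    ‖zVar S ω κ ε u j t k‖ = ‖hat (u j t) k‖ := by
  rw [← sq_eq_sq₀ (norm_nonneg _) (norm_nonneg _), EuclideanSpace.norm_sq_eq,
    ← sum_norm_sq_inner_psiJ S κ j (ε • k) (hat (u j t) k)]
  simp only [norm_zVar_apply]

theorem norm_le_sum_norm_apply (v : Vec n) : ‖v‖ ≤ ∑ l, ‖v l‖ := by
  have h : v = ∑ l, EuclideanSpace.single l (v l) := by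
    ext i
    simp
  calc ‖v‖ = ‖∑ l, EuclideanSpace.single l (v l)‖ := by rw [← h]
    _ ≤ ∑ l, ‖EuclideanSpace.single l (v l)‖ := norm_sum_le _ _
    _ = _ := by simp

/-- Pointwise bounds by components imply bounds of weighted norms. -/
theorem wnorm_le_sum_component {E : Type*} [NormedAddCommGroup E] {w : Space d → ℝ≥0}
    (hw : Measurable w) (s : Finset (Fin n)) (j : ℤ) {f : Space d → Vec n} {g : Space d → E}
    (h : ∀ᵐ k, ‖g k‖ ≤ ∑ l ∈ s, ‖inner ℂ (psiJ S κ j l (ε • k)) (hat f k)‖) :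
    wnorm w g ≤ ∑ l ∈ s, wnorm w (component S κ ε j l (hatL1 f)) := by
  unfold wnorm
  rw [← lintegral_finsetSum' _ fun i hi =>
    aemeasurable_weight_mul_enorm hw (L1.integrable_coeFn _).1]
  apply lintegral_mono_ae
  filter_upwards [h, coeFn_hatL1 f, ae_all_iff.mpr fun l => coeFn_component S κ ε j l (hatL1 f)]
    with k h1 h2 h3
  rw [← Finset.mul_sum]
  gcongr
  simp only [h3, h2]
  simp only [← ofReal_norm]
  rw [← ENNReal.ofReal_sum_of_nonneg fun l _ => norm_nonneg _]
  exact ENNReal.ofReal_le_ofReal h1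

theorem normL1_smul (m : Space d → ℂ) (f : Space d → Vec n) :
    normL1 (fun k => m k • f k) = wnorm (fun k => ‖m k‖₊) f := by
  unfold normL1 wnorm
  refine lintegral_congr fun k => ?_
  rw [enorm_smul]
  rfl

variable [NeZero n]

theorem norm_sub_projP_le (v : Vec n) :
    ‖v - projP v‖ ≤ ∑ l ∈ Finset.univ.erase 0, ‖v l‖ := by
  refine (norm_le_sum_norm_apply _).trans ?_
  rw [← Finset.add_sum_erase _ _ (Finset.mem_univ (0 : Fin n))]
  refine (add_le_add_left (le_of_eq ?_) _).trans_eq ((zero_add _).trans ?_)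
  · simp [projP]
  · exact Finset.sum_congr rfl fun l hl => by simp [projP, Finset.ne_of_mem_erase hl]

theorem projP_smul (c : ℂ) (v : Vec n) : projP (c • v) = c • projP v := by
  ext i
  by_cases hi : i = 0 <;> simp [projP, hi]

theorem sum_modes (f : ℤ × Fin n → ℝ≥0∞) :
    ∑ l ∈ Finset.univ.erase 0, f (1, l) + ∑ l, f (3, l) = ∑ i ∈ modes n, f i := by
  unfold modes
  rw [← Finset.filter_ne', ← Finset.filter_ne', Finset.sum_filter, Finset.sum_filter,
    Finset.sum_product, Finset.sum_pair (by norm_num)]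
  simp

/-- The scaled norm of the transformed variables, multiplied by `m`, in terms of components. -/
theorem scaledNorm_smul_zVar_le {m : Space d → ℂ} (hm : Measurable m) (t : ℝ) (hε : 0 < ε)
    {X C : ℝ} (hX : 0 ≤ X) (hC : 0 ≤ C)
    (h1 : wnorm (fun k => ‖m k‖₊) (hatL1 (u 1 t)) ≤ ENNReal.ofReal X)
    (h : ∀ i ∈ modes n, wnorm (fun k => ‖m k‖₊) (component S κ ε i.1 i.2 (hatL1 (u i.1 t)))
      ≤ ENNReal.ofReal (C * ε)) :
    scaledNorm ε (fun k => m k • zVar S ω κ ε u 1 t k) (fun k => m k • zVar S ω κ ε u 3 t k)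
      ≤ ENNReal.ofReal (2 * X + 2 * ((modes n).card * C)) := by
  have hw : Measurable fun k => ‖m k‖₊ := hm.nnnorm
  have e1 : normL1 (fun k => projP (m k • zVar S ω κ ε u 1 t k)) ≤ ENNReal.ofReal X := by
    simp only [projP_smul]
    rw [normL1_smul]
    refine le_trans (wnorm_mono_ae ?_) h1
    filter_upwards [coeFn_hatL1 (u 1 t)] with k hk
    rw [hk]
    gcongr
    simp only [projP, PiLp.norm_single, norm_zVar_apply]
    exact norm_inner_psiJ_le S κ 1 0 _ _
  have e2 : normL1 (fun k => m k • zVar S ω κ ε u 1 t k - projP (m k • zVar S ω κ ε u 1 t k))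
      + normL1 (fun k => m k • zVar S ω κ ε u 3 t k)
      ≤ ENNReal.ofReal ((modes n).card * C * ε) := by
    simp only [projP_smul, ← smul_sub]
    rw [normL1_smul, normL1_smul]
    refine (add_le_add
      (wnorm_le_sum_component S κ ε hw (Finset.univ.erase 0) 1 (f := u 1 t) ?_)
      (wnorm_le_sum_component S κ ε hw Finset.univ 3 (f := u 3 t) ?_)).trans ?_
    · refine ae_of_all _ fun k => (norm_sub_projP_le _).trans_eq ?_
      simp only [norm_zVar_apply]
    · refine ae_of_all _ fun k => (norm_le_sum_norm_apply _).trans_eq ?_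
      simp only [norm_zVar_apply]
    · rw [sum_modes fun i => wnorm (fun k => ‖m k‖₊) (component S κ ε i.1 i.2 (hatL1 (u i.1 t)))]
      refine (Finset.sum_le_card_nsmul _ _ _ h).trans_eq ?_
      rw [nsmul_eq_mul, mul_assoc, ENNReal.ofReal_mul (p := ((modes n).card : ℝ)) (by positivity),
        ENNReal.ofReal_natCast]
  unfold scaledNorm
  rw [add_assoc, ← mul_add, ENNReal.ofReal_add (by positivity) (by positivity)]
  refine add_le_add ?_ ?_
  · rw [ENNReal.ofReal_mul (by norm_num), ENNReal.ofReal_ofNat]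
    gcongr
  · calc _ ≤ ENNReal.ofReal (2 / ε) * ENNReal.ofReal ((modes n).card * C * ε) := by gcongr
      _ = _ := by
        rw [← ENNReal.ofReal_mul (by positivity)]
        congr 1
        field_simp

/-- For ε ≤ 1 all three coefficients of the scaled norm are at least 1, so a bound of z controls the
L¹ norm of û uniformly in ε. -/
theorem wnorm_one_le_scaledNorm (hε : ε ∈ Ioc (0 : ℝ) 1) (t : ℝ) {j : ℤ}
    (hj : j ∈ ({1, 3} : Finset ℤ)) :
    wnorm 1 (hatL1 (u j t)) ≤ scaledNorm ε (zVar S ω κ ε u 1 t) (zVar S ω κ ε u 3 t) := by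
  have h2 : (1 : ℝ≥0∞) ≤ ENNReal.ofReal (2 / ε) := by
    rw [← ENNReal.ofReal_one]
    refine ENNReal.ofReal_le_ofReal ?_
    rw [le_div_iff₀ hε.1]
    linarith [hε.2]
  have hz : ∀ j, wnorm 1 (hatL1 (u j t)) = normL1 (zVar S ω κ ε u j t) := fun j => by
    rw [wnorm_one_hatL1]
    unfold normL1
    refine lintegral_congr fun k => ?_
    rw [← ofReal_norm, ← ofReal_norm, norm_zVar]
  rw [hz]
  simp only [Finset.mem_insert, Finset.mem_singleton] at hj
  unfold scaledNorm
  rcases hj with rfl | rfl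
  -- Splitting the integral requires measurability of one summand; it is read off from the critical
  -- component, which has the same modulus.
  · have hmeas : AEMeasurable fun k => ‖projP (zVar S ω κ ε u 1 t k)‖ₑ := by
      refine (L1.integrable_coeFn (component S κ ε 1 0 (hatL1 (u 1 t)))).1.enorm.congr ?_
      filter_upwards [coeFn_hatL1 (u 1 t), coeFn_component S κ ε 1 0 (hatL1 (u 1 t))] with k h h'
      rw [h', h, ← ofReal_norm, ← ofReal_norm, projP, PiLp.norm_single, norm_zVar_apply]
    have h3 : normL1 (zVar S ω κ ε u 1 t) ≤ normL1 (fun k => projP (zVar S ω κ ε u 1 t k))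
        + normL1 (fun k => zVar S ω κ ε u 1 t k - projP (zVar S ω κ ε u 1 t k)) := by
      unfold normL1
      rw [← lintegral_add_left' hmeas]
      refine lintegral_mono fun k => ?_
      refine le_trans (le_of_eq ?_) (enorm_add_le _ _)
      rw [add_sub_cancel]
    refine h3.trans (le_trans ?_ le_self_add)
    gcongr
    · exact le_mul_of_one_le_left zero_le one_le_two
    · exact le_mul_of_one_le_left zero_le h2
  · exact (le_mul_of_one_le_left zero_le h2).trans le_add_self

theorem hat_sub_projEps (t : ℝ) (k : Space d) :
    hat (u 1 t) k - projEps S κ ε k (hat (u 1 t) k)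
      = ∑ l ∈ Finset.univ.erase 0,
        inner ℂ (psiJ S κ 1 l (ε • k)) (hat (u 1 t) k) • psiJ S κ 1 l (ε • k) := by
  rw [sub_eq_iff_eq_add', projEps, Finset.add_sum_erase _ (fun l : Fin n =>
    inner ℂ (psiJ S κ 1 l (ε • k)) (hat (u 1 t) k) • psiJ S κ 1 l (ε • k)) (Finset.mem_univ 0),
    sum_inner_psiJ_smul]

end TransformedVariables

end

/-! ### Component bounds for classical solutions with polarized data -/

section

variable {d n : ℕ}

section ClassicalSolutions

variable {A : Fin d → Matrix (Fin n) (Fin n) ℝ} {Em : Matrix (Fin n) (Fin n) ℝ}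
  {T : (Fin n → ℝ) →ₗ[ℝ] (Fin n → ℝ) →ₗ[ℝ] (Fin n → ℝ) →ₗ[ℝ] (Fin n → ℝ)} {ω : ℝ} {κ : Space d}

theorem IsClassicalSolution.hatL1_one_zero {ε τ : ℝ} {p : Space d → Vec n}
    {u : ℤ → ℝ → Space d → Vec n} (hu : IsClassicalSolution A Em T ω κ ε τ p u) :
    hatL1 (u 1 0) = hatL1 p := by
  rw [funext hu.initial_one]

theorem IsClassicalSolution.hatL1_three_zero {ε τ : ℝ} (hτ : 0 ≤ τ) {p : Space d → Vec n}
    {u : ℤ → ℝ → Space d → Vec n} (hu : IsClassicalSolution A Em T ω κ ε τ p u) :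
    hatL1 (u 3 0) = 0 :=
  hatL1_eq_zero (hu.memW1 3 (by simp) 0 ⟨le_rfl, hτ⟩).memW hu.initial_three

/-- A classical solution with data in `W^s` that stays bounded in `W` has bounded moments of
order `s`. -/
theorem IsClassicalSolution.wnorm_polyWeight_le (hA : ∀ l, (A l).IsSymm) (hE : Em.transpose = -Em)
    {tend tstar : ℝ} (htend : 0 < tend) (htstar : tstar ≤ tend) {ε : ℝ} (hε : 0 < ε) {s : ℕ}
    {M : ℝ} {p : Space d → Vec n} (hp : MemWs s p) (hpM : normWs s p ≤ ENNReal.ofReal M)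
    {u : ℤ → ℝ → Space d → Vec n} (hu : IsClassicalSolution A Em T ω κ ε (tend / ε) p u) {B : ℝ}
    (hB : 0 ≤ B) (hBu : ∀ t ∈ Icc 0 (tstar / ε), ∀ j ∈ ({1, 3} : Finset ℤ),
      wnorm 1 (hatL1 (u j t)) ≤ ENNReal.ofReal B) :
    ∀ t ∈ Icc 0 (tstar / ε), ∀ j ∈ ({1, 3} : Finset ℤ), wnorm (polyWeight d s) (hatL1 (u j t))
      ≤ ENNReal.ofReal ((d + 1) ^ (s + 1) * max M 0
        * Real.exp (2 * (nonlinConst T d * (((2 ^ s : ℝ≥0) : ℝ) ^ 2 * (3 * B ^ 2))) * tend)) := by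
  have hτ : tstar / ε ≤ tend / ε := by gcongr
  refine ((hu.evolution hε (by positivity)).mono hτ).wnorm_growth hA hE hε
    (by rw [mul_div_cancel₀ _ hε.ne']; exact htstar) (measurable_polyWeight s) (polyWeight_neg s)
    (one_le_pow₀ one_le_two) (polyWeight_add_le_add s) hB (by positivity) hBu ?_
    (hu.hatL1_three_zero (by positivity))
  rw [hu.hatL1_one_zero]
  refine hp.wnorm_polyWeight_le.trans ?_
  rw [ENNReal.ofReal_mul (by positivity)]
  gcongr
  exact hpM.trans (ENNReal.ofReal_le_ofReal (le_max_left _ _))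

variable [NeZero n]

/-- For polarized data the noncritical components of classical solutions stay of size `O(ε)`. -/
theorem exists_solution_component_bound (S : ℤ → SmoothEigen A Em) (hA : ∀ l, (A l).IsSymm)
    (hE : Em.transpose = -Em)
    (T : (Fin n → ℝ) →ₗ[ℝ] (Fin n → ℝ) →ₗ[ℝ] (Fin n → ℝ) →ₗ[ℝ] (Fin n → ℝ))
    (hS : lamJ S ω κ 1 0 0 = 0) (hμ : ∀ i ∈ modes n, lamJ S ω κ i.1 i.2 0 ≠ 0) {tend : ℝ}
    (htend : 0 < tend) {B : ℝ} (hB : 0 ≤ B) :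
    ∃ C : ℝ, 0 ≤ C ∧ ∀ ε ∈ Ioc (0 : ℝ) 1, ∀ tstar ≤ tend, ∀ p : Space d → Vec n,
      (∀ x, Matrix.toEuclideanLin (symbolL A Em ω κ) (p x) = 0) → ∀ u : ℤ → ℝ → Space d → Vec n,
      IsClassicalSolution A Em T ω κ ε (tend / ε) p u → ∀ w W : Space d → ℝ≥0, Measurable w →
      (∃ N, ∀ k, w k ≤ N) → (∀ k, w (-k) = w k) → (∀ x y, w (x + y) ≤ w x * w y) →
      Measurable W → (∀ k, W (-k) = W k) → (∀ x y, W (x + y) ≤ W x * W y) →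
      (∀ k, 1 + ‖k‖₊ ≤ W k) → (∀ k, w k * (1 + ‖k‖₊) ≤ W k) →
      (∀ t ∈ Icc 0 (tstar / ε), ∀ j ∈ ({1, 3} : Finset ℤ),
        wnorm W (hatL1 (u j t)) ≤ ENNReal.ofReal B) →
      ∀ t ∈ Icc 0 (tstar / ε), ∀ i ∈ modes n,
        wnorm w (component S κ ε i.1 i.2 (hatL1 (u i.1 t))) ≤ ENNReal.ofReal (C * ε) := by
  obtain ⟨Q, hQ⟩ := exists_polarized_component_bound S ω κ hA hE hμ
  -- Polarization makes the initial components at most Qε times the W-norm of the data, and that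
  -- norm is at most B.
  obtain ⟨C, hC, h⟩ := exists_component_bound S ω κ hA hE T hS hμ tend hB (q₀ := Q * B)
    (by positivity)
  refine ⟨C, hC, ?_⟩
  rintro ε ⟨hε, hε1⟩ tstar htstar p hp u hu w W hw hN heven hmul hW hWeven hWmul hW1 hwW hWB t ht
  have hτ : tstar / ε ≤ tend / ε := by gcongr
  have h0 : (0 : ℝ) ∈ Icc 0 (tstar / ε) := ⟨le_rfl, ht.1.trans ht.2⟩
  have hpol : ∀ᵐ k, symL A Em ω κ (hatL1 (u 1 0) k) = 0 :=
    mapL_hatL1_eq_zero (hu.memW1 1 (by simp) 0 ⟨le_rfl, by positivity⟩).memW fun x => by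
      rw [hu.initial_one]
      exact hp x
  refine h ε hε hε1 (tstar / ε) (by rw [mul_div_cancel₀ _ hε.ne']; exact htstar)
    (fun j t => hatL1 (u j t)) ((hu.evolution hε (by positivity)).mono hτ) w W hw hN heven hmul hW
    hWeven hWmul hW1 hwW hWB ?_ t ht
  rintro ⟨j, l⟩ hi
  have hj := fst_mem_of_mem_modes hi
  simp only [Finset.mem_insert, Finset.mem_singleton] at hj
  rcases hj with rfl | rfl
  · refine (hQ ⟨ε, hε.le⟩ _ hpol w W hwW l hi).trans ?_
    refine (mul_le_mul_right (hWB 0 h0 1 (by simp)) _).trans_eq ?_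
    rw [← ENNReal.ofReal_coe_nnreal, ← ENNReal.ofReal_mul (by positivity)]
    congr 1
    change (Q : ℝ) * ε * B = _
    ring
  · obtain ⟨N, hN⟩ := hN
    refine wnorm_le_of_wreal_le hN ?_
    simp only [hu.hatL1_three_zero (div_nonneg htend.le hε.le), map_zero, wreal_zero hw]
    positivity

/-- The component bound demands a bounded submultiplicative weight. The weight |k| is not of this
kind, but 1 + min(|k|, N) is, and it dominates the truncation of |k|. -/
theorem one_add_min_add_le_mul (N x y : ℝ≥0) :
    1 + min (x + y) N ≤ (1 + min x N) * (1 + min y N) := by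
  have h : min (x + y) N ≤ min x N + min y N := by
    rcases le_total x N with hx | hx
    · rcases le_total y N with hy | hy
      · rw [min_eq_left hx, min_eq_left hy]
        exact min_le_left _ _
      · rw [min_eq_right hy]
        exact (min_le_right _ _).trans le_add_self
    · rw [min_eq_right hx]
      exact (min_le_right _ _).trans le_self_add
  calc 1 + min (x + y) N ≤ 1 + (min x N + min y N) := by gcongr
    _ ≤ 1 + (min x N + min y N) + min x N * min y N := le_self_add
    _ = _ := by ring

/-- For polarized data the gradients of the noncritical components of classical solutions stay of
size `O(ε)`. -/
theorem exists_solution_grad_component_bound (S : ℤ → SmoothEigen A Em) (hA : ∀ l, (A l).IsSymm)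
    (hE : Em.transpose = -Em)
    (T : (Fin n → ℝ) →ₗ[ℝ] (Fin n → ℝ) →ₗ[ℝ] (Fin n → ℝ) →ₗ[ℝ] (Fin n → ℝ))
    (hS : lamJ S ω κ 1 0 0 = 0) (hμ : ∀ i ∈ modes n, lamJ S ω κ i.1 i.2 0 ≠ 0) {tend : ℝ}
    (htend : 0 < tend) {B : ℝ} (hB : 0 ≤ B) :
    ∃ C : ℝ, 0 ≤ C ∧ ∀ ε ∈ Ioc (0 : ℝ) 1, ∀ tstar ≤ tend, ∀ p : Space d → Vec n,
      (∀ x, Matrix.toEuclideanLin (symbolL A Em ω κ) (p x) = 0) → ∀ u : ℤ → ℝ → Space d → Vec n,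
      IsClassicalSolution A Em T ω κ ε (tend / ε) p u →
      (∀ t ∈ Icc 0 (tstar / ε), ∀ j ∈ ({1, 3} : Finset ℤ),
        wnorm (polyWeight d 2) (hatL1 (u j t)) ≤ ENNReal.ofReal B) →
      ∀ t ∈ Icc 0 (tstar / ε), ∀ i ∈ modes n,
        wnorm (fun k => ‖k‖₊) (component S κ ε i.1 i.2 (hatL1 (u i.1 t)))
          ≤ ENNReal.ofReal (C * ε) := by
  obtain ⟨C, hC, h⟩ := exists_solution_component_bound S hA hE T hS hμ htend hB
  refine ⟨C, hC, fun ε hε tstar htstar p hp u hu hu2 t ht i hi => ?_⟩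
  -- C does not depend on the weights, so N can tend to infinity. The weights are w = 1 + min(|k|,
  -- N) and W = (1 + |k|)².
  refine wnorm_le_of_forall_min measurable_nnnorm (L1.integrable_coeFn _).1 fun N => ?_
  refine le_trans (wnorm_mono_weight _ fun k => le_add_self)
    (h ε hε tstar htstar p hp u hu (fun k => 1 + min ‖k‖₊ N) (polyWeight d 2)
      (measurable_const.add (measurable_nnnorm.min measurable_const))
      ⟨1 + N, fun k => by gcongr; exact min_le_right _ _⟩ (fun k => by rw [nnnorm_neg])
      (fun x y => ?_) (measurable_polyWeight 2) (polyWeight_neg 2) (polyWeight_add_le_mul 2)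
      (fun k => le_self_pow₀ le_self_add two_ne_zero) (fun k => ?_) hu2 t ht i hi)
  · refine le_trans ?_ (one_add_min_add_le_mul _ _ _)
    gcongr
    exact nnnorm_add_le _ _
  · unfold polyWeight
    rw [sq]
    gcongr
    exact min_le_left _ _

end ClassicalSolutions

end

/-! ### The two assertions of the proposition -/

section

variable {d n : ℕ}

section Bounds

variable [NeZero n] {A : Fin d → Matrix (Fin n) (Fin n) ℝ} {Em : Matrix (Fin n) (Fin n) ℝ}
  {ω : ℝ} {κ : Space d}

/-- Bounds of `û` and its noncritical components imply bounds of gradients. -/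
theorem grad_bounds_of_component_bounds (S : ℤ → SmoothEigen A Em) (ω : ℝ) (κ : Space d) {ε : ℝ}
    (hε0 : 0 < ε) {u : ℤ → ℝ → Space d → Vec n} {t : ℝ} (hW1 : MemWs 1 (u 3 t)) {B C : ℝ}
    (hB0 : 0 ≤ B) (hC : 0 ≤ C) (hu : wnorm (fun k => ‖k‖₊) (hatL1 (u 1 t)) ≤ ENNReal.ofReal B)
    (hcomp : ∀ i ∈ modes n, wnorm (fun k => ‖k‖₊) (component S κ ε i.1 i.2 (hatL1 (u i.1 t)))
      ≤ ENNReal.ofReal (C * ε)) (μ : Fin d) :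
    scaledNorm ε (mulD μ (zVar S ω κ ε u 1 t)) (mulD μ (zVar S ω κ ε u 3 t))
        ≤ ENNReal.ofReal (2 * B + 2 * ((modes n).card * C)) ∧
      normL1 (mulD μ fun k => hat (u 1 t) k - projEps S κ ε k (hat (u 1 t) k))
        ≤ ENNReal.ofReal ((2 * B + 2 * ((modes n).card * C)) * ε) ∧
      normW (pderiv μ (u 3 t)) ≤ ENNReal.ofReal ((2 * B + 2 * ((modes n).card * C)) * ε) := by
  set m : Space d → ℂ := fun k => Complex.I * (k μ : ℂ) with hm
  have hmeas : Measurable m := by fun_prop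
  have hmul : ∀ w : Space d → Vec n, mulD μ w = fun k => m k • w k := fun w => rfl
  have hmk : ∀ k, ‖m k‖₊ ≤ ‖k‖₊ := fun k => by
    rw [hm, ← NNReal.coe_le_coe, coe_nnnorm, coe_nnnorm, norm_mul, Complex.norm_I, one_mul,
      Complex.norm_real]
    exact PiLp.norm_apply_le k μ
  have hmc : ∀ i ∈ modes n, wnorm (fun k => ‖m k‖₊) (component S κ ε i.1 i.2 (hatL1 (u i.1 t)))
      ≤ ENNReal.ofReal (C * ε) := fun i hi =>
    (wnorm_mono_weight _ hmk).trans (hcomp i hi)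
  have hsum : ∑ i ∈ modes n, wnorm (fun k => ‖m k‖₊)
      (component S κ ε i.1 i.2 (hatL1 (u i.1 t)))
      ≤ ENNReal.ofReal ((2 * B + 2 * ((modes n).card * C)) * ε) := by
    refine (Finset.sum_le_card_nsmul _ _ _ hmc).trans ?_
    rw [nsmul_eq_mul, ← ENNReal.ofReal_natCast, ← ENNReal.ofReal_mul (by positivity)]
    refine ENNReal.ofReal_le_ofReal ?_
    have h1 : 0 ≤ B * ε := by positivity
    have h2 : 0 ≤ (modes n).card * C * ε := by positivity
    linarith
  rw [← sum_modes fun i => wnorm (fun k => ‖m k‖₊)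
    (component S κ ε i.1 i.2 (hatL1 (u i.1 t)))] at hsum
  dsimp only at hsum
  refine ⟨?_, ?_, ?_⟩
  · rw [hmul, hmul]
    exact scaledNorm_smul_zVar_le S ω κ ε u hmeas t hε0 hB0 hC
      ((wnorm_mono_weight _ hmk).trans hu) hmc
  · refine le_trans ?_ (le_self_add.trans hsum)
    rw [hmul, normL1_smul]
    refine wnorm_le_sum_component S κ ε hmeas.nnnorm (Finset.univ.erase 0) 1 (f := u 1 t)
      (ae_of_all _ fun k => ?_)
    rw [hat_sub_projEps]
    refine (norm_sum_le _ _).trans_eq (Finset.sum_congr rfl fun l _ => ?_)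
    rw [norm_smul, norm_psiJ, mul_one]
  · refine le_trans ?_ (le_add_self.trans hsum)
    have h1 := hW1.memW_pderiv μ
    rw [← h1.normL1_hat]
    have h2 : normL1 (hat (pderiv μ (u 3 t))) = normL1 fun k => m k • hat (u 3 t) k := by
      refine lintegral_congr_ae ?_
      filter_upwards [hat_pderiv (by exact_mod_cast hW1.1) hW1.memW μ h1] with k hk
      rw [hk]
    rw [h2, normL1_smul]
    refine wnorm_le_sum_component S κ ε hmeas.nnnorm Finset.univ 3 (f := u 3 t)
      (ae_of_all _ fun k => ?_)
    conv_lhs => rw [← sum_inner_psiJ_smul S κ 3 (ε • k) (hat (u 3 t) k)]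
    refine (norm_sum_le _ _).trans_eq (Finset.sum_congr rfl fun l _ => ?_)
    rw [norm_smul, norm_psiJ, mul_one]

/-- Boundedness of the transformed variables in the scaled norm on the time scale `1/ε`. -/
theorem exists_scaledNorm_zVar_bound (S : ℤ → SmoothEigen A Em) (hA : ∀ l, (A l).IsSymm)
    (hE : Em.transpose = -Em)
    (T : (Fin n → ℝ) →ₗ[ℝ] (Fin n → ℝ) →ₗ[ℝ] (Fin n → ℝ) →ₗ[ℝ] (Fin n → ℝ))
    (hS : lamJ S ω κ 1 0 0 = 0) (hμ : ∀ i ∈ modes n, lamJ S ω κ i.1 i.2 0 ≠ 0) {tend : ℝ}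
    (htend : 0 < tend) (M : ℝ) :
    ∃ r₀ : ℝ, 0 < r₀ ∧ ∀ r ≥ r₀, ∃ tstar ∈ Ioc 0 tend,
      ∀ p : Space d → Vec n, MemWs 1 p → normWs 1 p ≤ ENNReal.ofReal M →
      (∀ x, Matrix.toEuclideanLin (symbolL A Em ω κ) (p x) = 0) →
      ∀ ε ∈ Ioc (0 : ℝ) 1, ∀ u : ℤ → ℝ → Space d → Vec n,
      IsClassicalSolution A Em T ω κ ε (tend / ε) p u →
      ∀ t ∈ Icc 0 (tstar / ε),
        scaledNorm ε (zVar S ω κ ε u 1 t) (zVar S ω κ ε u 3 t) ≤ ENNReal.ofReal r := by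
  have hc := nonlinConst_nonneg (d := d) T
  -- The time estimate needs B > 0, even when M = 0.
  set B : ℝ := max M 0 + 1 with hB
  have hB0 : 0 < B := by positivity
  obtain ⟨tstar, hts, htime⟩ := exists_time_wnorm_le hA hE T ω κ htend hB0
  -- The number given for B is the bound of the first moment that results from the L¹ bound 2B. The
  -- weights will be w = 1 and W = 1 + |k|.
  obtain ⟨C, hC, hcomp⟩ := exists_solution_component_bound S hA hE T hS hμ htend
    (B := (d + 1) ^ (1 + 1) * max M 0 * Real.exp (2 * (nonlinConst T d
      * (((2 ^ 1 : NNReal) : ℝ) ^ 2 * (3 * (2 * B) ^ 2))) * tend)) (by positivity)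
  -- `tstar` is fixed before r, so the same time serves every r above this threshold.
  refine ⟨2 * (2 * B) + 2 * ((modes n).card * C), by positivity, fun r hr => ⟨tstar, hts, ?_⟩⟩
  intro p hp hpM hpol ε hε u hu t ht
  have hτ : tstar / ε ≤ tend / ε := div_le_div_of_nonneg_right hts.2 hε.1.le
  have hτ0 : 0 < tend / ε := div_pos htend hε.1
  have hu1 := htime ε hε.1 _ ((hu.evolution hε.1 hτ0).mono hτ)
    (by
      rw [hu.hatL1_one_zero]
      refine (hp.wnorm_one_le.trans hpM).trans (ENNReal.ofReal_le_ofReal ?_)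
      linarith [le_max_left M 0])
    (hu.hatL1_three_zero hτ0.le)
  have huW := hu.wnorm_polyWeight_le hA hE htend hts.2 hε.1 hp hpM (B := 2 * B) (by positivity) hu1
  have hone : (fun _ : Space d => ‖(1 : ℂ)‖₊) = 1 := by
    ext
    simp
  have key := scaledNorm_smul_zVar_le S ω κ ε u (m := fun _ => 1) measurable_const t hε.1
    (X := 2 * B) (C := C) (by positivity) hC (by rw [hone]; exact hu1 t ht 1 (by simp))
    (by
      rw [hone]
      exact hcomp ε hε tstar hts.2 p hpol u hu 1 (polyWeight d 1) measurable_const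
        ⟨1, fun _ => le_rfl⟩ (fun _ => rfl) (fun _ _ => by simp) (measurable_polyWeight 1)
        (polyWeight_neg 1) (polyWeight_add_le_mul 1) (fun k => by simp [polyWeight])
        (fun k => by simp [polyWeight]) huW t ht)
  simp only [one_smul] at key
  exact key.trans (ENNReal.ofReal_le_ofReal hr)

/-- Boundedness of the gradients on the time scale `1/ε`. -/
theorem exists_grad_bound (S : ℤ → SmoothEigen A Em) (hA : ∀ l, (A l).IsSymm)
    (hE : Em.transpose = -Em)
    (T : (Fin n → ℝ) →ₗ[ℝ] (Fin n → ℝ) →ₗ[ℝ] (Fin n → ℝ) →ₗ[ℝ] (Fin n → ℝ))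
    (hS : lamJ S ω κ 1 0 0 = 0) (hμ : ∀ i ∈ modes n, lamJ S ω κ i.1 i.2 0 ≠ 0) {tend : ℝ}
    (htend : 0 < tend) (M : ℝ) (r : ℝ) :
    ∃ C : ℝ, ∀ tstar ∈ Ioc 0 tend,
      ∀ p : Space d → Vec n, MemWs 2 p → normWs 2 p ≤ ENNReal.ofReal M →
      (∀ x, Matrix.toEuclideanLin (symbolL A Em ω κ) (p x) = 0) →
      ∀ ε ∈ Ioc (0 : ℝ) 1, ∀ u : ℤ → ℝ → Space d → Vec n,
      IsClassicalSolution A Em T ω κ ε (tend / ε) p u →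
      (∀ t ∈ Icc 0 (tstar / ε),
        scaledNorm ε (zVar S ω κ ε u 1 t) (zVar S ω κ ε u 3 t) ≤ ENNReal.ofReal r) →
      ∀ (μ : Fin d), ∀ t ∈ Icc 0 (tstar / ε),
        scaledNorm ε (mulD μ (zVar S ω κ ε u 1 t)) (mulD μ (zVar S ω κ ε u 3 t))
            ≤ ENNReal.ofReal C ∧
        normL1 (mulD μ fun k => hat (u 1 t) k - projEps S κ ε k (hat (u 1 t) k))
            ≤ ENNReal.ofReal (C * ε) ∧
        normW (pderiv μ (u 3 t)) ≤ ENNReal.ofReal (C * ε) := by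
  have hc := nonlinConst_nonneg (d := d) T
  set B : ℝ := (d + 1) ^ (2 + 1) * max M 0 * Real.exp (2 * (nonlinConst T d
      * (((2 ^ 2 : NNReal) : ℝ) ^ 2 * (3 * max r 0 ^ 2))) * tend) with hB
  have hB0 : 0 ≤ B := by positivity
  obtain ⟨C, hC, hcomp⟩ := exists_solution_grad_component_bound S hA hE T hS hμ htend hB0
  refine ⟨2 * B + 2 * ((modes n).card * C), ?_⟩
  intro tstar hts p hp hpM hpol ε hε u hu hr μ t ht
  have hε0 := hε.1
  -- This is where the assumed bound on z enters. It replaces the short-time estimate, so the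
  -- moments are controlled up to whatever `tstar` is given.
  have hu1 : ∀ t ∈ Icc 0 (tstar / ε), ∀ j ∈ ({1, 3} : Finset ℤ),
      wnorm 1 (hatL1 (u j t)) ≤ ENNReal.ofReal (max r 0) := fun t ht j hj =>
    (wnorm_one_le_scaledNorm S ω κ ε u hε t hj).trans
      ((hr t ht).trans (ENNReal.ofReal_le_ofReal (le_max_left _ _)))
  have huW := hu.wnorm_polyWeight_le hA hE htend hts.2 hε0 hp hpM (le_max_right r 0) hu1
  exact grad_bounds_of_component_bounds S ω κ hε0
    (hu.memW1 3 (by simp) t ⟨ht.1, ht.2.trans (div_le_div_of_nonneg_right hts.2 hε0.le)⟩) hB0 hC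
    ((wnorm_mono_weight _ fun k => le_add_self.trans (le_self_pow₀ le_self_add two_ne_zero)).trans
      (huW t ht 1 (by simp))) (hcomp ε hε tstar hts.2 p hpol u hu huW t ht) μ

end Bounds

end

end Envelope

end

open Envelope in
theorem proposition2 {d n : ℕ} [NeZero n]
    (A : Fin d → Matrix (Fin n) (Fin n) ℝ) (hA : ∀ l, (A l).IsSymm)
    (Em : Matrix (Fin n) (Fin n) ℝ) (hE : Em.transpose = -Em)
    (T : (Fin n → ℝ) →ₗ[ℝ] (Fin n → ℝ) →ₗ[ℝ] (Fin n → ℝ) →ₗ[ℝ] (Fin n → ℝ))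
    (κ : Space d) (hκ : κ ≠ 0) (ω : ℝ)
    (hker : Module.finrank ℂ (LinearMap.ker (Matrix.toEuclideanLin (symbolL A Em ω κ))) = 1)
    (hinv : ∀ j ∈ ({3, 5} : Finset ℤ), IsUnit (symbolL A Em ((j : ℝ) * ω) ((j : ℝ) • κ)))
    (S : ℤ → SmoothEigen A Em) (hS : lamJ S ω κ 1 0 0 = 0)
    (tend : ℝ) (htend : 0 < tend) (M : ℝ) :
    (∃ r₀ : ℝ, 0 < r₀ ∧ ∀ r ≥ r₀, ∃ tstar ∈ Set.Ioc 0 tend,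
      ∀ p : Space d → Vec n, MemWs 1 p → normWs 1 p ≤ ENNReal.ofReal M →
      (∀ x, Matrix.toEuclideanLin (symbolL A Em ω κ) (p x) = 0) →
      ∀ ε ∈ Set.Ioc (0 : ℝ) 1, ∀ u : ℤ → ℝ → Space d → Vec n,
      IsClassicalSolution A Em T ω κ ε (tend / ε) p u →
      ∀ t ∈ Set.Icc 0 (tstar / ε),
        scaledNorm ε (zVar S ω κ ε u 1 t) (zVar S ω κ ε u 3 t) ≤ ENNReal.ofReal r) ∧
    (∀ r : ℝ, ∃ C : ℝ, ∀ tstar ∈ Set.Ioc 0 tend,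
      ∀ p : Space d → Vec n, MemWs 2 p → normWs 2 p ≤ ENNReal.ofReal M →
      (∀ x, Matrix.toEuclideanLin (symbolL A Em ω κ) (p x) = 0) →
      ∀ ε ∈ Set.Ioc (0 : ℝ) 1, ∀ u : ℤ → ℝ → Space d → Vec n,
      IsClassicalSolution A Em T ω κ ε (tend / ε) p u →
      (∀ t ∈ Set.Icc 0 (tstar / ε),
        scaledNorm ε (zVar S ω κ ε u 1 t) (zVar S ω κ ε u 3 t) ≤ ENNReal.ofReal r) →
      ∀ (μ : Fin d), ∀ t ∈ Set.Icc 0 (tstar / ε),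
        scaledNorm ε (mulD μ (zVar S ω κ ε u 1 t)) (mulD μ (zVar S ω κ ε u 3 t))
            ≤ ENNReal.ofReal C ∧
        normL1 (mulD μ fun k => hat (u 1 t) k - projEps S κ ε k (hat (u 1 t) k))
            ≤ ENNReal.ofReal (C * ε) ∧
        normW (pderiv μ (u 3 t)) ≤ ENNReal.ofReal (C * ε)) := by
  have hμ : ∀ i ∈ modes n, lamJ S ω κ i.1 i.2 0 ≠ 0 := fun i hi =>
    lamJ_ne_zero S ω κ hker (hinv 3 (by simp)) hS hi
  exact ⟨exists_scaledNorm_zVar_bound S hA hE T hS hμ htend M,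
    exists_grad_bound S hA hE T hS hμ htend M⟩
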